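/- **Setting.** Let $S=\prod_p p^{\varepsilon_p}$, $\varepsilon_p\in\{0,1,\dots,\infty\}$, be a supernatural number with $\sum_p\varepsilon_p=\infty$, and let $\mathbb Z/S\mathbb Z=\prod_p\mathbb Z/p^{\varepsilon_p}\mathbb Z$ (with $\mathbb Z/p^\infty\mathbb Z=\mathbb Z_p$), a compact ring in which $\mathbb Z$ is embedded diagonally. A positive integer $l$ divides $S$ if its exponent at each prime $p$ is at most $\varepsilon_p$. Let $\{E_l\}_{l\in\mathbb Z}$ and $\{E^+_k\}_{k\ge 0}$ be the canonical bases of $H=\ell^2(\mathbb Z)$ and $H_+=\ell^2(\mathbb Z_{\ge0})$. Put $VE_l=E_{l+1}$, $UE^+_k=E^+_{k+1}$ and, for $f\in C(\mathbb Z/S\mathbb Z)$, $m_fE_l=f(l)E_l$, $M_fE^+_k=f(k)E^+_k$. Let $B_S\subseteq B(H)$ be the C$^*$-algebra generated by $V$ and all $m_f$, and let $A_S\subseteq B(H_+)$ be the C$^*$-algebra generated by $U$ and all $M_f$ (the Bunce-Deddens-Toeplitz algebra). The Toeplitz map is $T(b)=P_{\ge0}\,b\,s$ for $b\in B(H)$,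 where $sE^+_k=E_k$, and $P_{\ge0}E_k=E^+_k$ for $k\ge0$, $P_{\ge0}E_k=0$ for $k<0$. For $l\mid S$ let $B^\infty_{S,l}$ be the set of all $b=\sum_{n\in\mathbb Z}V^nm_{f_n}\in B_S$ with $f_n(x+l)=f_n(x)$ for all $n$ and $x$, and with $(\|f_n\|)_n$ rapidly decaying. Put $B_S^\infty=\bigcup_{l\mid S}B^\infty_{S,l}$. Let $\mathcal K^\infty$ be the set of operators $\sum_{k,s\ge0}c_{ks}P_{ks}$ with $(c_{ks})$ rapidly decaying, where $P_{ks}E^+_r=\delta_{sr}E^+_k$. The smooth Bunce-Deddens-Toeplitz algebra is $$A_S^\infty=\{T(b)+c:\ b\in B_S^\infty,\ c\in\mathcal K^\infty\}.$$ Its LF topology is the finest locally convex topology for which the maps $B^\infty_{S,l}\oplus\mathcal K^\infty\to A_S^\infty$, $(b,c)\mapsto T(b)+c$, $l\mid S$, are continuous. Here $B^\infty_{S,l}$ carries the norms $\|b\|_P=\sum_{j=0}^P\binom Pj\|\delta^j(b)\|$, $\delta(b)=[\mathbb L,b]$, $\mathbb LE_l=lE_l$, and $\mathcal K^\infty$ carries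 the norms $\|c\|_{M,N}=\sum_{j=0}^M\binom Mj\|d^j(c)(I+\mathbb K)^N\|$, $d(c)=[\mathbb K,c]$, $\mathbb KE^+_k=kE^+_k$. **Statement.** $A_S^\infty$ is a unital $*$-subalgebra of $A_S$, and: 1. $A_S^\infty$ is closed under the holomorphic functional calculus of $A_S$. That is, if $a\in A_S^\infty$, $W\subseteq\mathbb C$ is an open set containing the spectrum $\sigma(a)$ of $a$ in $A_S$, and $f$ is holomorphic on $W$, then $$f(a)=\frac1{2\pi i}\int_\Gamma f(z)(z-a)^{-1}\,dz\ \in\ A_S^\infty$$ for every cycle $\Gamma$ (a finite union of closed piecewise $C^1$ curves) in $W\setminus\sigma(a)$ whose index is $1$ about every point of $\sigma(a)$ and $0$ about every point of $\mathbb C\setminus W$. 2. $A_S^\infty$ is inverse-closed: if $a\in A_S^\infty$ is invertible in $A_S$, then $a^{-1}\in A_S^\infty$. 3. $A_S^\infty$ and $A_S$ have the same K-theory: the inclusion $A_S^\infty\hookrightarrow A_S$ induces isomorphisms $K_0(A_S^\infty)\cong K_0(A_S)$ and $K_1(A_S^\infty)\cong K_1(A_S)$. Here $K_0$ is the Grothendieck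 group of the monoid of Murray-von Neumann classes of idempotent matrices, and $K_1=GL_\infty/(GL_\infty)_0$ is formed with respect to the LF topology on $A_S^\infty$ and the norm topology on $A_S$. -/

import Mathlib

open scoped ENNReal NNReal

noncomputable section

namespace QuantumOdometer

/-! ## Supernatural numbers and odometers -/

/-- A supernatural number `∏ p ^ ε_p`, given by its exponents `ε_p ∈ {0, 1, …, ∞}`. -/
abbrev Supernatural : Type := Nat.Primes → ℕ∞

/-- `S` is infinite: the sum of all its exponents is `∞`. -/
def Supernatural.IsInfinite (S : Supernatural) : Prop :=
  (⨆ s : Finset Nat.Primes, ∑ p ∈ s, S p) = ⊤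

/-- The natural number `l` divides the supernatural number `S`. -/
def Divides (l : ℕ) (S : Supernatural) : Prop :=
  l ≠ 0 ∧ ∀ p : Nat.Primes, (l.factorization p : ℕ∞) ≤ S p

instance factPrime (p : Nat.Primes) : Fact (p : ℕ).Prime := ⟨p.2⟩

/-- `ℤ / p ^ ε ℤ`, which is the ring of `p`-adic integers if `ε = ∞`. -/
def LocalFactor (p : Nat.Primes) : ℕ∞ → Type
  | none => ℤ_[p]
  | some k => ZMod ((p : ℕ) ^ k)

instance (p : Nat.Primes) : (e : ℕ∞) → CommRing (LocalFactor p e)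
  | none => inferInstanceAs (CommRing ℤ_[p])
  | some k => inferInstanceAs (CommRing (ZMod ((p : ℕ) ^ k)))

/-- The `p`-adic topology if `ε = ∞`, the discrete topology otherwise. -/
instance (p : Nat.Primes) : (e : ℕ∞) → TopologicalSpace (LocalFactor p e)
  | none => inferInstanceAs (TopologicalSpace ℤ_[p])
  | some k => inferInstanceAs (TopologicalSpace (ZMod ((p : ℕ) ^ k)))

instance (p : Nat.Primes) : (e : ℕ∞) → CompactSpace (LocalFactor p e)
  | none => inferInstanceAs (CompactSpace ℤ_[p])
  | some k =>
    haveI : NeZero ((p : ℕ) ^ k) := ⟨pow_ne_zero _ p.2.ne_zero⟩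
    inferInstanceAs (CompactSpace (ZMod ((p : ℕ) ^ k)))

/-- The `S`-adic ring `ℤ / S ℤ = ∏ p, ℤ / p ^ ε_p ℤ` with the product topology. The integers are
embedded diagonally by the cast `ℤ → ℤ / S ℤ`. -/
abbrev Odometer (S : Supernatural) : Type := (p : Nat.Primes) → LocalFactor p (S p)

/-! ## The Hilbert spaces and the basic operators -/

/-- The Hilbert space `ℓ²(ι)`. -/
abbrev Ell2 (ι : Type) : Type := lp (fun _ : ι => ℂ) 2

/-- Bounded operators on `ℓ²(ι)`. -/
abbrev Op (ι : Type) : Type := Ell2 ι →L[ℂ] Ell2 ι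

/-- The canonical basis vector `E_i` of `ℓ²(ι)`. -/
def E {ι : Type} [DecidableEq ι] (i : ι) : Ell2 ι := lp.single 2 i 1

section CoordOp

variable {ι κ : Type}

/-- The coordinates `i ↦ w i * x (σ i)`, read as `0` where `σ i` is undefined. -/
def coordFun (σ : ι → Option κ) (w : ι → ℂ) (x : κ → ℂ) (i : ι) : ℂ :=
  (σ i).elim 0 fun j => w i * x j

lemma coordFun_sum_le (σ : ι → Option κ) (hσ : ∀ i i' j, σ i = some j → σ i' = some j → i = i')
    (w : ι → ℂ) (C : ℝ) (hC : 0 ≤ C) (hw : ∀ i, ‖w i‖ ≤ C) (x : Ell2 κ) (s : Finset ι) :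
    ∑ i ∈ s, ‖coordFun σ w x i‖ ^ (2 : ℝ≥0∞).toReal ≤ (C * ‖x‖) ^ (2 : ℝ≥0∞).toReal := by
  classical
  have hp : (0 : ℝ) < (2 : ℝ≥0∞).toReal := by norm_num
  calc ∑ i ∈ s, ‖coordFun σ w x i‖ ^ (2 : ℝ≥0∞).toReal
      ≤ ∑ i ∈ s, ∑ j ∈ (σ i).toFinset, (C * ‖x j‖) ^ (2 : ℝ≥0∞).toReal := by
        refine Finset.sum_le_sum fun i _ => ?_
        cases h : σ i with
        | none => simp [coordFun, h]
        | some j =>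
          simp only [coordFun, h, Option.elim_some, Option.toFinset_some, Finset.sum_singleton,
            norm_mul]
          gcongr
          exact hw i
    _ = ∑ j ∈ s.biUnion fun i => (σ i).toFinset, (C * ‖x j‖) ^ (2 : ℝ≥0∞).toReal := by
        refine (Finset.sum_biUnion ?_).symm
        intro i _ i' _ hii'
        rw [Function.onFun, Finset.disjoint_left]
        intro j hj hj'
        rw [Option.mem_toFinset] at hj hj'
        exact hii' (hσ i i' j hj hj')
    _ = C ^ (2 : ℝ≥0∞).toReal *
          ∑ j ∈ s.biUnion fun i => (σ i).toFinset, ‖x j‖ ^ (2 : ℝ≥0∞).toReal := by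
        rw [Finset.mul_sum]
        exact Finset.sum_congr rfl fun j _ => Real.mul_rpow hC (norm_nonneg _)
    _ ≤ C ^ (2 : ℝ≥0∞).toReal * ‖x‖ ^ (2 : ℝ≥0∞).toReal := by
        gcongr
        exact lp.sum_rpow_le_norm_rpow hp x _
    _ = (C * ‖x‖) ^ (2 : ℝ≥0∞).toReal := (Real.mul_rpow hC (norm_nonneg _)).symm

/-- The bounded operator `(W x) i = w i * x (σ i)` for a bounded weight `w` and a partially defined
injective map `σ`, with `(W x) i = 0` where `σ i` is undefined. -/
def coordOp (σ : ι → Option κ) (hσ : ∀ i i' j, σ i = some j → σ i' = some j → i = i')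
    (w : ι → ℂ) (C : ℝ) (hC : 0 ≤ C) (hw : ∀ i, ‖w i‖ ≤ C) : Ell2 κ →L[ℂ] Ell2 ι :=
  LinearMap.mkContinuous
    { toFun := fun x => ⟨coordFun σ w x, memℓp_gen' (coordFun_sum_le σ hσ w C hC hw x)⟩
      map_add' := fun x y => by
        ext i
        change coordFun σ w (x + y : Ell2 κ) i = coordFun σ w x i + coordFun σ w y i
        cases h : σ i <;> simp [coordFun, h, mul_add]
      map_smul' := fun c x => by
        ext i
        change coordFun σ w (c • x : Ell2 κ) i = c * coordFun σ w x i
        cases h : σ i <;> simp [coordFun, h, mul_left_comm] }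
    C fun x => lp.norm_le_of_forall_sum_le (by norm_num) (by positivity)
      (coordFun_sum_le σ hσ w C hC hw x)

lemma coordOp_apply (σ : ι → Option κ) (hσ : ∀ i i' j, σ i = some j → σ i' = some j → i = i')
    (w : ι → ℂ) (C : ℝ) (hC : 0 ≤ C) (hw : ∀ i, ‖w i‖ ≤ C) (x : Ell2 κ) (i : ι) :
    coordOp σ hσ w C hC hw x i = (σ i).elim 0 fun j => w i * x j := rfl

end CoordOp

/-- The power `V ^ n`, `n ∈ ℤ`, of the bilateral shift `V` on `ℓ²(ℤ)`: `V ^ n E_l = E_{l + n}`. -/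
def shiftPow (n : ℤ) : Op ℤ :=
  coordOp (fun i => some (i - n)) (by intro i i' j h h'; simp at h h'; omega) (fun _ => 1) 1
    zero_le_one (by simp)

/-- The bilateral shift `V`. -/
def V : Op ℤ := shiftPow 1

/-- The unilateral shift `U` on `ℓ²(ℤ≥0)`: `U E_k = E_{k + 1}`. -/
def U : Op ℕ :=
  coordOp (fun i => if i = 0 then none else some (i - 1))
    (by intro i i' j h h'; split_ifs at h h'; simp at h h'; omega) (fun _ => 1) 1
    zero_le_one (by simp)

/-- The multiplication operator `m_f E_l = f(l) E_l` on `ℓ²(ℤ)`. -/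
def mulZ {S : Supernatural} (f : C(Odometer S, ℂ)) : Op ℤ :=
  coordOp some (by intro i i' j h h'; simp at h h'; omega) (fun l => f ((l : ℤ) : Odometer S)) ‖f‖
    (norm_nonneg f) fun _ => f.norm_coe_le_norm _

/-- The multiplication operator `M_f E_k = f(k) E_k` on `ℓ²(ℤ≥0)`. -/
def mulN {S : Supernatural} (f : C(Odometer S, ℂ)) : Op ℕ :=
  coordOp some (by intro i i' j h h'; simp at h h'; omega) (fun k => f ((k : ℕ) : Odometer S)) ‖f‖
    (norm_nonneg f) fun _ => f.norm_coe_le_norm _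

/-- The inclusion `s : ℓ²(ℤ≥0) → ℓ²(ℤ)`, `s E_k = E_k`. -/
def incl : Ell2 ℕ →L[ℂ] Ell2 ℤ :=
  coordOp (fun i => if 0 ≤ i then some i.toNat else none)
    (by intro i i' j h h'; split_ifs at h h'; simp at h h'; omega) (fun _ => 1) 1
    zero_le_one (by simp)

/-- The projection `P : ℓ²(ℤ) → ℓ²(ℤ≥0)`, `P E_k = E_k` for `k ≥ 0` and `P E_k = 0` for
`k < 0`. -/
def proj : Ell2 ℤ →L[ℂ] Ell2 ℕ :=
  coordOp (fun k => some (k : ℤ)) (by intro i i' j h h'; simp at h h'; omega) (fun _ => 1) 1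
    zero_le_one (by simp)

lemma E_apply {ι : Type} [DecidableEq ι] (i j : ι) : (E i : Ell2 ι) j = if j = i then 1 else 0 := by
  simp [E, lp.single_apply, Pi.single_apply]

lemma shiftPow_E (n l : ℤ) : shiftPow n (E l) = E (l + n) := by
  ext i
  simp [shiftPow, coordOp_apply, E_apply, sub_eq_iff_eq_add]

lemma shiftPow_zero : shiftPow 0 = 1 := by
  ext x i
  simp [shiftPow, coordOp_apply]

lemma shiftPow_add (m n : ℤ) : shiftPow (m + n) = shiftPow m * shiftPow n := by
  ext x i
  simp [shiftPow, coordOp_apply, sub_sub]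

lemma U_E (k : ℕ) : U (E k) = E (k + 1) := by
  ext i
  cases i <;> simp [U, coordOp_apply, E_apply]

lemma mulZ_E {S : Supernatural} (f : C(Odometer S, ℂ)) (l : ℤ) :
    mulZ f (E l) = f ((l : ℤ) : Odometer S) • E l := by
  ext i
  by_cases h : i = l <;> simp [mulZ, coordOp_apply, E_apply, h]

lemma mulN_E {S : Supernatural} (f : C(Odometer S, ℂ)) (k : ℕ) :
    mulN f (E k) = f ((k : ℕ) : Odometer S) • E k := by
  ext i
  by_cases h : i = k <;> simp [mulN, coordOp_apply, E_apply, h]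

lemma incl_E (k : ℕ) : incl (E k) = E (k : ℤ) := by
  ext i
  by_cases h : 0 ≤ i
  · simp only [incl, coordOp_apply, E_apply, h, if_true, Option.elim_some, one_mul]
    congr 1
    apply propext
    omega
  · have : i ≠ k := by omega
    simp [incl, coordOp_apply, E_apply, h, this]

lemma proj_E (k : ℤ) : proj (E k) = if 0 ≤ k then E k.toNat else 0 := by
  ext i
  by_cases h : 0 ≤ k
  · simp only [proj, coordOp_apply, E_apply, h, if_true, Option.elim_some, one_mul]
    congr 1
    apply propext
    omega
  · have : (i : ℤ) ≠ k := by omega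
    simp [proj, coordOp_apply, E_apply, h, this]

/-- The Toeplitz map `T(b) = P b s`. -/
def toeplitz (b : Op ℤ) : Op ℕ := proj ∘L b ∘L incl

/-! ## The C*-algebras `B_S` and `A_S` -/

/-- The Bunce-Deddens algebra `B_S = C*{V, m_f : f ∈ C(ℤ / S ℤ)}`. -/
def BunceDeddens (S : Supernatural) : StarSubalgebra ℂ (Op ℤ) :=
  (StarAlgebra.adjoin ℂ ({V} ∪ Set.range fun f : C(Odometer S, ℂ) => mulZ f)).topologicalClosure

/-- The Bunce-Deddens-Toeplitz algebra `A_S = C*{U, M_f : f ∈ C(ℤ / S ℤ)}`. -/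
def BunceDeddensToeplitz (S : Supernatural) : StarSubalgebra ℂ (Op ℕ) :=
  (StarAlgebra.adjoin ℂ ({U} ∪ Set.range fun f : C(Odometer S, ℂ) => mulN f)).topologicalClosure

/-! ## The smooth subalgebras -/

/-- The matrix unit `P_{ks}`: `P_{ks} E_r = δ_{sr} E_k`. -/
def matrixUnit (k s : ℕ) : Op ℕ := InnerProductSpace.rankOne ℂ (E k) (E s)

/-- The smooth compact operators `K^∞`: the operators `∑ c_{ks} P_{ks}` with rapidly decaying
coefficients. -/
def smoothCompact : Set (Op ℕ) :=
  {c | ∃ m : ℕ → ℕ → ℂ,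
    (∀ N : ℕ, ∃ C : ℝ, ∀ k s : ℕ, (1 + (k : ℝ) + s) ^ N * ‖m k s‖ ≤ C) ∧
    HasSum (fun q : ℕ × ℕ => m q.1 q.2 • matrixUnit q.1 q.2) c}

/-- The elements `b = ∑ V ^ n m_{f_n}` of `B_S` for which the norms `‖f_n‖` are rapidly decaying and
all the `f_n` are invariant under the translation by `l`. -/
def smoothBDStep (S : Supernatural) (l : ℕ) : Set (Op ℤ) :=
  {b | b ∈ BunceDeddens S ∧ ∃ f : ℤ → C(Odometer S, ℂ),
    (∀ N : ℕ, ∃ C : ℝ, ∀ n : ℤ, (1 + |(n : ℝ)|) ^ N * ‖f n‖ ≤ C) ∧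
    (∀ (n : ℤ) (x : Odometer S), f n (x + (l : Odometer S)) = f n x) ∧
    HasSum (fun n : ℤ => shiftPow n * mulZ (f n)) b}

/-- The smooth Bunce-Deddens algebra `B_S^∞`: the elements of `B_S` whose Fourier coefficients are
uniformly locally constant and have rapidly decaying norms. -/
def smoothBD (S : Supernatural) : Set (Op ℤ) :=
  {b | ∃ l : ℕ, Divides l S ∧ b ∈ smoothBDStep S l}

/-- The smooth Bunce-Deddens-Toeplitz algebra `A_S^∞ = {T(b) + c : b ∈ B_S^∞, c ∈ K^∞}`. -/
def smoothBDT (S : Supernatural) : Set (Op ℕ) :=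
  {a | ∃ b ∈ smoothBD S, ∃ c ∈ smoothCompact, a = toeplitz b + c}

/-! ## The LF topology -/

/-- The matrix coefficient `⟨E_k, x E_s⟩`. -/
def coeff {ι : Type} [DecidableEq ι] (x : Op ι) (k s : ι) : ℂ := (x (E s)) k

/-- The operator norm of the operator with the given matrix coefficients, `∞` if there is no such
bounded operator. -/
def matrixNorm {ι : Type} [DecidableEq ι] (m : ι → ι → ℂ) : ℝ≥0∞ :=
  ⨅ (x : Op ι) (_ : ∀ k s, coeff x k s = m k s), ‖x‖ₑ

/-- The norm `‖b‖_P = ∑ j ≤ P, (P choose j) ‖δ^j(b)‖`, where `δ(b) = [𝕃, b]` for the label operator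
`𝕃 E_l = l E_l`, so that `δ^j(b)` has the matrix coefficients `(k - s) ^ j b_{ks}`. -/
def normBD (P : ℕ) (b : Op ℤ) : ℝ≥0∞ :=
  ∑ j ∈ Finset.range (P + 1),
    (P.choose j : ℝ≥0∞) * matrixNorm fun k s : ℤ => ((k : ℂ) - s) ^ j * coeff b k s

/-- The norm `‖c‖_{M,N} = ∑ j ≤ M, (M choose j) ‖d^j(c) (I + 𝕂)^N‖`, where `d(c) = [𝕂, c]` for the
label operator `𝕂 E_k = k E_k`. -/
def normCompact (M N : ℕ) (c : Op ℕ) : ℝ≥0∞ :=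
  ∑ j ∈ Finset.range (M + 1), (M.choose j : ℝ≥0∞) *
    matrixNorm fun k s : ℕ => ((k : ℂ) - s) ^ j * coeff c k s * (1 + (s : ℂ)) ^ N

/-- The seminorms on `A_S^∞` that are continuous for the LF topology: along `(b, c) ↦ T(b) + c`,
they restrict to continuous seminorms on each of the Fréchet spaces `B_{S,l}^∞ ⊕ K^∞`, `l ∣ S`,
which are topologized by the norms `‖b‖_P + ‖c‖_{M,N}`. -/
def LFSeminorm (S : Supernatural) (A : StarSubalgebra ℂ (Op ℕ)) : Type :=
  {p : Seminorm ℂ A // ∀ l : ℕ, Divides l S → ∃ (P M N : ℕ) (C : ℝ≥0),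
    ∀ b ∈ smoothBDStep S l, ∀ c ∈ smoothCompact, ∀ a : A, (a : Op ℕ) = toeplitz b + c →
      ENNReal.ofReal (p a) ≤ C * (normBD P b + normCompact M N c)}

instance (S : Supernatural) (A : StarSubalgebra ℂ (Op ℕ)) : Nonempty (LFSeminorm S A) :=
  ⟨⟨0, fun _ _ => ⟨0, 0, 0, 0, fun _ _ _ _ _ _ => by simp⟩⟩⟩

/-- The LF topology of `A_S^∞ ≅ B_S^∞ ⊕ K^∞`, where `B_S^∞` is the inductive limit of its Fréchet
subspaces `B_{S,l}^∞`, `l ∣ S`: the finest locally convex topology for which all the maps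
`B_{S,l}^∞ ⊕ K^∞ → A_S^∞`, `(b, c) ↦ T(b) + c`, are continuous. It is meant for the star subalgebra
`A` with underlying set `A_S^∞`. -/
abbrev lfTopology (S : Supernatural) (A : StarSubalgebra ℂ (Op ℕ)) : TopologicalSpace A :=
  (SeminormFamily.moduleFilterBasis (𝕜 := ℂ) (F := A)
    (fun p : LFSeminorm S A => p.1)).topology

/-! ## The holomorphic functional calculus -/

/-- A finite family of `C¹` arcs, parametrized by `[0, 1]`. -/
structure Chain where
  /-- the number of arcs -/
  size : ℕ
  /-- the arcs -/
  arc : Fin size → ℝ → ℂ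
  contDiff : ∀ i, ContDiffOn ℝ 1 (arc i) (Set.Icc 0 1)

/-- The support of a chain. -/
def Chain.support (Γ : Chain) : Set ℂ := ⋃ i, Γ.arc i '' Set.Icc 0 1

/-- A cycle: the initial points of the arcs are, with multiplicities, their terminal points. In
other words, the arcs make up finitely many closed piecewise `C¹` curves. -/
def Chain.IsCycle (Γ : Chain) : Prop :=
  Finset.univ.val.map (fun i => Γ.arc i 0) = Finset.univ.val.map fun i => Γ.arc i 1

/-- The contour integral `∫_Γ F(z) dz`. -/
def Chain.integral {X : Type*} [NormedAddCommGroup X] [NormedSpace ℂ X] (Γ : Chain) (F : ℂ → X) :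
    X :=
  ∑ i, ∫ t in (0 : ℝ)..1, derivWithin (Γ.arc i) (Set.Icc 0 1) t • F (Γ.arc i t)

/-- The index (winding number) of `Γ` with respect to `w`. -/
def Chain.index (Γ : Chain) (w : ℂ) : ℂ :=
  (2 * Real.pi * Complex.I)⁻¹ * Γ.integral fun z => (z - w)⁻¹

/-- The cycle `Γ` surrounds `K` in `W`. -/
def Chain.Surrounds (Γ : Chain) (K W : Set ℂ) : Prop :=
  Γ.IsCycle ∧ Γ.support ⊆ W \ K ∧ (∀ w ∈ K, Γ.index w = 1) ∧ ∀ w, w ∉ W → Γ.index w = 0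

/-- The integral `(2πi)⁻¹ ∫_Γ f(z) (z - a)⁻¹ dz`, the value `f(a)` of the holomorphic functional
calculus if `Γ` surrounds the spectrum of `a` in a domain of holomorphy of `f`. -/
def holomorphicCalculus {A : Type*} [NormedRing A] [NormedAlgebra ℂ A] (Γ : Chain) (f : ℂ → ℂ)
    (a : A) : A :=
  ((2 * Real.pi * Complex.I)⁻¹ : ℂ) • Γ.integral fun z => f z • resolvent a z

/-! ## K-theory -/

section KZero

variable (R : Type*) [Ring R]

/-- An idempotent matrix of arbitrary finite size. -/
structure IdemMatrix where
  /-- the size -/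
  size : ℕ
  /-- the matrix -/
  mat : Matrix (Fin size) (Fin size) R
  idem : mat * mat = mat

variable {R}

/-- Murray-von Neumann equivalence: `e = x y` and `f = y x` for rectangular matrices `x`, `y`. -/
def IdemMatrix.MvN (e f : IdemMatrix R) : Prop :=
  ∃ (x : Matrix (Fin e.size) (Fin f.size) R) (y : Matrix (Fin f.size) (Fin e.size) R),
    x * y = e.mat ∧ y * x = f.mat

/-- The block diagonal matrix `diag(e, f)`. -/
def blockDiag {m n : ℕ} (e : Matrix (Fin m) (Fin m) R) (f : Matrix (Fin n) (Fin n) R) :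
    Matrix (Fin (m + n)) (Fin (m + n)) R :=
  Matrix.reindex finSumFinEquiv finSumFinEquiv (Matrix.fromBlocks e 0 0 f)

lemma blockDiag_mul {m n : ℕ} (e e' : Matrix (Fin m) (Fin m) R) (f f' : Matrix (Fin n) (Fin n) R) :
    blockDiag e f * blockDiag e' f' = blockDiag (e * e') (f * f') := by
  simp [blockDiag, Matrix.submatrix_mul_equiv, Matrix.fromBlocks_multiply]

lemma blockDiag_one {m n : ℕ} :
    blockDiag (1 : Matrix (Fin m) (Fin m) R) (1 : Matrix (Fin n) (Fin n) R) = 1 := by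
  simp [blockDiag, Matrix.fromBlocks_one]

/-- The direct sum of idempotents. -/
def IdemMatrix.sum (e f : IdemMatrix R) : IdemMatrix R :=
  ⟨e.size + f.size, blockDiag e.mat f.mat, by rw [blockDiag_mul, e.idem, f.idem]⟩

lemma IdemMatrix.MvN.refl (e : IdemMatrix R) : e.MvN e := ⟨e.mat, e.mat, e.idem, e.idem⟩

lemma IdemMatrix.MvN.symm {e f : IdemMatrix R} : e.MvN f → f.MvN e
  | ⟨x, y, h, h'⟩ => ⟨y, x, h', h⟩

lemma IdemMatrix.MvN.trans {e f g : IdemMatrix R} : e.MvN f → f.MvN g → e.MvN g := by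
  rintro ⟨x, y, hxy, hyx⟩ ⟨z, w, hzw, hwz⟩
  refine ⟨x * z, w * y, ?_, ?_⟩
  · rw [Matrix.mul_assoc, ← Matrix.mul_assoc z, hzw, ← hyx, ← Matrix.mul_assoc, ← Matrix.mul_assoc,
      hxy, Matrix.mul_assoc, hxy, e.idem]
  · rw [Matrix.mul_assoc, ← Matrix.mul_assoc y, hyx, ← hzw, ← Matrix.mul_assoc, ← Matrix.mul_assoc,
      hwz, Matrix.mul_assoc, hwz, g.idem]

instance idemSetoid (R : Type*) [Ring R] : Setoid (IdemMatrix R) where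
  r := IdemMatrix.MvN
  iseqv := ⟨IdemMatrix.MvN.refl, IdemMatrix.MvN.symm, IdemMatrix.MvN.trans⟩

/-- Idempotents whose matrices, placed on index types `I` and `J`, are equivalent. -/
lemma IdemMatrix.equiv_of_reindex {I J : Type} [Fintype I] [Fintype J] {e f : IdemMatrix R}
    (α : I ≃ Fin e.size) (β : J ≃ Fin f.size) (x : Matrix I J R) (y : Matrix J I R)
    (h : x * y = e.mat.submatrix α α) (h' : y * x = f.mat.submatrix β β) : e.MvN f := by
  refine ⟨x.submatrix α.symm β.symm, y.submatrix β.symm α.symm, ?_, ?_⟩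
  · rw [Matrix.submatrix_mul_equiv, h]
    simp
  · rw [Matrix.submatrix_mul_equiv, h']
    simp

lemma blockDiag_inl_inl {m n : ℕ} (e : Matrix (Fin m) (Fin m) R) (f : Matrix (Fin n) (Fin n) R)
    (i j : Fin m) :
    blockDiag e f (finSumFinEquiv (Sum.inl i)) (finSumFinEquiv (Sum.inl j)) = e i j := by
  simp only [blockDiag, Matrix.reindex_apply, Matrix.submatrix_apply, Equiv.symm_apply_apply,
    Matrix.fromBlocks_apply₁₁]

lemma blockDiag_inl_inr {m n : ℕ} (e : Matrix (Fin m) (Fin m) R) (f : Matrix (Fin n) (Fin n) R)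
    (i : Fin m) (j : Fin n) :
    blockDiag e f (finSumFinEquiv (Sum.inl i)) (finSumFinEquiv (Sum.inr j)) = 0 := by
  simp only [blockDiag, Matrix.reindex_apply, Matrix.submatrix_apply, Equiv.symm_apply_apply,
    Matrix.fromBlocks_apply₁₂, Matrix.zero_apply]

lemma blockDiag_inr_inl {m n : ℕ} (e : Matrix (Fin m) (Fin m) R) (f : Matrix (Fin n) (Fin n) R)
    (i : Fin n) (j : Fin m) :
    blockDiag e f (finSumFinEquiv (Sum.inr i)) (finSumFinEquiv (Sum.inl j)) = 0 := by
  simp only [blockDiag, Matrix.reindex_apply, Matrix.submatrix_apply, Equiv.symm_apply_apply,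
    Matrix.fromBlocks_apply₂₁, Matrix.zero_apply]

lemma blockDiag_inr_inr {m n : ℕ} (e : Matrix (Fin m) (Fin m) R) (f : Matrix (Fin n) (Fin n) R)
    (i j : Fin n) :
    blockDiag e f (finSumFinEquiv (Sum.inr i)) (finSumFinEquiv (Sum.inr j)) = f i j := by
  simp only [blockDiag, Matrix.reindex_apply, Matrix.submatrix_apply, Equiv.symm_apply_apply,
    Matrix.fromBlocks_apply₂₂]

lemma blockDiag_submatrix {m n : ℕ} (e : Matrix (Fin m) (Fin m) R) (f : Matrix (Fin n) (Fin n) R) :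
    (blockDiag e f).submatrix finSumFinEquiv finSumFinEquiv = Matrix.fromBlocks e 0 0 f := by
  simp [blockDiag]

lemma IdemMatrix.MvN.sum_congr {e e' f f' : IdemMatrix R} :
    e.MvN e' → f.MvN f' → (e.sum f).MvN (e'.sum f') := by
  rintro ⟨x, y, hxy, hyx⟩ ⟨z, w, hzw, hwz⟩
  refine IdemMatrix.equiv_of_reindex (e := e.sum f) (f := e'.sum f') finSumFinEquiv finSumFinEquiv
    (Matrix.fromBlocks x 0 0 z) (Matrix.fromBlocks y 0 0 w) ?_ ?_
  · refine Eq.trans ?_ (blockDiag_submatrix e.mat f.mat).symm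
    simp [Matrix.fromBlocks_multiply, hxy, hzw]
  · refine Eq.trans ?_ (blockDiag_submatrix e'.mat f'.mat).symm
    simp [Matrix.fromBlocks_multiply, hyx, hwz]

/-- An idempotent is equivalent to its image under a permutation of the indices. -/
lemma IdemMatrix.equiv_of_eq {e f : IdemMatrix R} {I : Type} [Fintype I]
    (α : I ≃ Fin e.size) (β : I ≃ Fin f.size)
    (h : e.mat.submatrix α α = f.mat.submatrix β β) : e.MvN f := by
  refine IdemMatrix.equiv_of_reindex α β (e.mat.submatrix α α) (e.mat.submatrix α α) ?_ ?_
  · rw [Matrix.submatrix_mul_equiv, e.idem]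
  · rw [Matrix.submatrix_mul_equiv, e.idem, h]

lemma IdemMatrix.sum_comm (e f : IdemMatrix R) : (e.sum f).MvN (f.sum e) := by
  refine IdemMatrix.equiv_of_eq (e := e.sum f) (f := f.sum e) finSumFinEquiv
    ((Equiv.sumComm _ _).trans finSumFinEquiv) ?_
  ext i j
  change blockDiag e.mat f.mat (finSumFinEquiv i) (finSumFinEquiv j) =
    blockDiag f.mat e.mat (finSumFinEquiv i.swap) (finSumFinEquiv j.swap)
  rcases i with i | i <;> rcases j with j | j <;>
    simp only [Sum.swap_inl, Sum.swap_inr, blockDiag_inl_inl, blockDiag_inl_inr, blockDiag_inr_inl,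
      blockDiag_inr_inr]

lemma IdemMatrix.sum_assoc (e f g : IdemMatrix R) :
    ((e.sum f).sum g).MvN (e.sum (f.sum g)) := by
  refine IdemMatrix.equiv_of_eq (e := (e.sum f).sum g) (f := e.sum (f.sum g))
    (((Equiv.sumAssoc _ _ _).symm.trans (Equiv.sumCongr finSumFinEquiv (Equiv.refl _))).trans
      finSumFinEquiv)
    ((Equiv.sumCongr (Equiv.refl _) finSumFinEquiv).trans finSumFinEquiv) ?_
  ext i j
  change blockDiag (blockDiag e.mat f.mat) g.mat
      (finSumFinEquiv (((Equiv.sumAssoc _ _ _).symm i).map finSumFinEquiv id))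
      (finSumFinEquiv (((Equiv.sumAssoc _ _ _).symm j).map finSumFinEquiv id)) =
    blockDiag e.mat (blockDiag f.mat g.mat) (finSumFinEquiv (i.map id finSumFinEquiv))
      (finSumFinEquiv (j.map id finSumFinEquiv))
  rcases i with i | i | i <;> rcases j with j | j | j <;>
    simp only [Equiv.sumAssoc_symm_apply_inl, Equiv.sumAssoc_symm_apply_inr_inl,
      Equiv.sumAssoc_symm_apply_inr_inr, Sum.map_inl, Sum.map_inr, id, blockDiag_inl_inl,
      blockDiag_inl_inr, blockDiag_inr_inl, blockDiag_inr_inr]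

/-- The zero idempotent, of size `0`. -/
def IdemMatrix.zero (R : Type*) [Ring R] : IdemMatrix R := ⟨0, 0, by simp⟩

lemma IdemMatrix.zero_sum (e : IdemMatrix R) : ((IdemMatrix.zero R).sum e).MvN e := by
  refine IdemMatrix.equiv_of_eq (e := (IdemMatrix.zero R).sum e) (f := e)
    ((Equiv.emptySum (Fin 0) (Fin e.size)).symm.trans finSumFinEquiv) (Equiv.refl _) ?_
  ext i j
  exact blockDiag_inr_inr (0 : Matrix (Fin 0) (Fin 0) R) e.mat i j

/-- The monoid `V(R)` of equivalence classes of idempotent matrices over `R`. -/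
def IdemMonoid (R : Type*) [Ring R] : Type _ := Quotient (idemSetoid R)

instance : Zero (IdemMonoid R) := ⟨Quotient.mk _ (IdemMatrix.zero R)⟩

/-- The addition of `V(R)` is `[e] + [f] = [diag(e, f)]`. -/
instance : Add (IdemMonoid R) :=
  ⟨Quotient.map₂ IdemMatrix.sum fun _ _ h _ _ h' => IdemMatrix.MvN.sum_congr h h'⟩

instance : AddCommMonoid (IdemMonoid R) where
  add_assoc a b c := by
    induction a, b using Quotient.inductionOn₂
    induction c using Quotient.inductionOn
    exact Quotient.sound (IdemMatrix.sum_assoc _ _ _)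
  add_comm a b := by
    induction a, b using Quotient.inductionOn₂
    exact Quotient.sound (IdemMatrix.sum_comm _ _)
  zero_add a := by
    induction a using Quotient.inductionOn
    exact Quotient.sound (IdemMatrix.zero_sum _)
  add_zero a := by
    induction a using Quotient.inductionOn
    exact Quotient.sound ((IdemMatrix.sum_comm _ _).trans (IdemMatrix.zero_sum _))
  nsmul := nsmulRec

/-- `K_0(R)`, the Grothendieck group of `V(R)`. -/
abbrev KZero (R : Type*) [Ring R] : Type _ := Algebra.GrothendieckAddGroup (IdemMonoid R)

/-- The class `[e]` of an idempotent matrix in `K_0(R)`. -/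
def KZero.mk (e : IdemMatrix R) : KZero R :=
  Algebra.GrothendieckAddGroup.of (Quotient.mk (idemSetoid R) e : IdemMonoid R)

/-- The image of an idempotent matrix under a ring homomorphism. -/
def IdemMatrix.map {R' : Type*} [Ring R'] (φ : R →+* R') (e : IdemMatrix R) : IdemMatrix R' :=
  ⟨e.size, e.mat.map φ, by rw [← Matrix.map_mul, e.idem]⟩

end KZero

section KOne

variable (R : Type*) [Ring R]

/-- `GL_n(R)`. -/
abbrev GLn (n : ℕ) : Type _ := (Matrix (Fin n) (Fin n) R)ˣ

variable {R}

/-- The stabilization `u ↦ diag(u, 1)` from `n × n` matrices to `m × m` matrices, `n ≤ m`. -/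
def stabMat {n m : ℕ} (h : n ≤ m) : Matrix (Fin n) (Fin n) R →* Matrix (Fin m) (Fin m) R where
  toFun u := Matrix.reindex (finCongr (Nat.add_sub_of_le h)) (finCongr (Nat.add_sub_of_le h))
    (blockDiag u (1 : Matrix (Fin (m - n)) (Fin (m - n)) R))
  map_one' := by simp [blockDiag_one]
  map_mul' u v := by simp [Matrix.submatrix_mul_equiv, blockDiag_mul]

lemma blockDiag_apply {m n : ℕ} (e : Matrix (Fin m) (Fin m) R) (f : Matrix (Fin n) (Fin n) R)
    (i j : Fin (m + n)) : blockDiag e f i j =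
      if hi : (i : ℕ) < m then (if hj : (j : ℕ) < m then e ⟨i, hi⟩ ⟨j, hj⟩ else 0)
      else (if hj : (j : ℕ) < m then 0 else f ⟨i - m, by omega⟩ ⟨j - m, by omega⟩) := by
  obtain ⟨i, rfl⟩ := finSumFinEquiv.surjective i
  obtain ⟨j, rfl⟩ := finSumFinEquiv.surjective j
  rcases i with i | i <;> rcases j with j | j <;>
    simp only [blockDiag_inl_inl, blockDiag_inl_inr, blockDiag_inr_inl, blockDiag_inr_inr] <;>
    simp

lemma stabMat_apply {n m : ℕ} (h : n ≤ m) (u : Matrix (Fin n) (Fin n) R) (i j : Fin m) :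
    stabMat h u i j =
      if hi : (i : ℕ) < n then (if hj : (j : ℕ) < n then u ⟨i, hi⟩ ⟨j, hj⟩ else 0)
      else if i = j then 1 else 0 := by
  change blockDiag u 1 ⟨i, _⟩ ⟨j, _⟩ = _
  rw [blockDiag_apply]
  simp only [Matrix.one_apply, Fin.ext_iff]
  split_ifs <;> first | rfl | omega

/-- The stabilization `GL_n(R) → GL_m(R)`, `n ≤ m`. -/
def stab (n m : ℕ) (h : n ≤ m) : GLn R n →* GLn R m := Units.map (stabMat h)

instance : DirectedSystem (GLn R) (fun n m h => stab (R := R) n m h) where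
  map_self n u := by
    ext i j
    simp [stab, stabMat_apply]
  map_map n m k h h' u := by
    ext i j
    change stabMat h' (stabMat h u.val) i j = stabMat (h.trans h') u.val i j
    simp only [stabMat_apply, Fin.ext_iff]
    split_ifs <;> first | rfl | omega

variable (R) in
/-- `GL_∞(R)`, the direct limit of the groups `GL_n(R)`. -/
abbrev GLInf : Type _ := DirectLimit (GLn R) (stab (R := R))

/-- The class of `u ∈ GL_n(R)` in `GL_∞(R)`. -/
def GLInf.mk {n : ℕ} (u : GLn R n) : GLInf R := Quotient.mk _ ⟨n, u⟩

/-- There is a continuous path of invertible `n × n` matrices from `1` to `u`. -/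
def JoinedToOne (t : TopologicalSpace R) {n : ℕ} (u : GLn R n) : Prop :=
  ∃ γ : unitInterval → Matrix (Fin n) (Fin n) R,
    Continuous γ ∧ γ 0 = 1 ∧ γ 1 = u ∧ ∀ s, IsUnit (γ s)

/-- The subgroup `GL_∞(R)_0` of `GL_∞(R)`, generated by the path components of `1` in the groups
`GL_n(R)` and their conjugates. (For a separately continuous multiplication, these path
components already make up a normal subgroup.) -/
def GLInfZero (t : TopologicalSpace R) : Subgroup (GLInf R) :=
  Subgroup.normalClosure {g | ∃ (n : ℕ) (u : GLn R n), JoinedToOne t u ∧ g = GLInf.mk u}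

instance (t : TopologicalSpace R) : (GLInfZero t).Normal := Subgroup.normalClosure_normal

/-- The topological group `K_1(R) = GL_∞(R) / GL_∞(R)_0`. -/
abbrev KOne (R : Type*) [Ring R] (t : TopologicalSpace R) : Type _ := GLInf R ⧸ GLInfZero t

/-- The class `[u]` of an invertible matrix in `K_1(R)`. -/
def KOne.mk (t : TopologicalSpace R) {n : ℕ} (u : GLn R n) : KOne R t :=
  QuotientGroup.mk (GLInf.mk u)

/-- The image of an invertible matrix under a ring homomorphism. -/
def GLn.map {R' : Type*} [Ring R'] (φ : R →+* R') {n : ℕ} (u : GLn R n) : GLn R' n :=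
  Units.map (RingHom.mapMatrix φ : _ →+* _).toMonoidHom u

end KOne

end QuantumOdometer
end

open scoped ENNReal NNReal

noncomputable section

namespace QuantumOdometer

/-! ### Matrix coefficients of bounded operators. -/

section Coeff

variable {ι : Type} [DecidableEq ι]

/-! The smooth algebra is described through matrix coefficients. An operator `a` belongs to it
exactly when, for some `l ∣ S`, its coefficients `a_{ks}` decay faster than every power of `1 + |k -
s|`, and its defect `U*^l a U^l - a` has coefficients that decay faster than every power of `1 + k +
s` (`mem_smoothBDT_iff`, with `SmoothMod`). A Toeplitz operator with an `l`-periodic symbol has zero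
defect, and smooth compact operators satisfy both conditions. Conversely, the numbers `a_{k+jl,
s+jl}` converge as `j → ∞`, because their increments are coefficients of the defect; the limits are
the coefficients of an `l`-periodic symbol `b`, and `a - T(b)` is smooth compact.

Both conditions survive inversion. Off-diagonal decay is equivalent to norm smoothness of `t ↦
exp(it𝕂) a exp(-it𝕂)`, and inversion in a Banach algebra is smooth. For the defect, compression by
`U^l` is multiplicative up to a corner through a finite-rank projection, so the defect of an inverse
is a sum of products, each with a radially decaying factor; radial decay is absorbing under
multiplication by operators with off-diagonal decay. The argument runs for matrices and uniformly
over bounded families with one fixed `l` (`SmoothMod.of_mul_eq_one`).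

The uniformity is what gives the functional calculus: a continuous functional bounded by `C` on a
family is bounded by a multiple of `C` on anything in its closed absolutely convex hull
(`Dominated`), and coefficients are such functionals. The resolvents of `a` along a contour form a
uniform family, and the contour integral is dominated by it.

For K-theory the smooth algebra is dense in `A_S` and its matrix algebras are inverse-closed. As the
invertible matrices over `A_S` are open, paths can be replaced by short segments over the smooth
algebra; the LF topology enters only as a vector space topology for which the inclusion is
continuous. This gives `K_1`. For `K_0`, injectivity is a perturbation of `x` and `y` in `e = xy`,
`f = yx`. Surjectivity needs smooth idempotents near a given one: for a smooth `a` nearby take `a +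
(1 - 2a) g` with `g = k + g²` and `k = (a² - a)(1 + 4(a² - a))⁻¹`. Here `g` is the Catalan series in
`k`, and it is dominated by inverses of `1 - 5zk`, `|z| = 1`, hence smooth. -/

lemma norm_E (i : ι) : ‖(E i : Ell2 ι)‖ = 1 := by
  rw [E, lp.norm_single (by norm_num)]
  simp

lemma inner_E_left (i : ι) (x : Ell2 ι) : inner ℂ (E i) x = x i := by
  rw [E, lp.inner_single_left]
  simp

lemma coeff_eq_inner (x : Op ι) (k s : ι) : coeff x k s = inner ℂ (E k) (x (E s)) :=
  (inner_E_left k _).symm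

lemma hasSum_coord_smul_E (x : Ell2 ι) : HasSum (fun i => x i • (E i : Ell2 ι)) x := by
  have h := lp.hasSum_single (p := 2) (by norm_num) x
  convert h using 2 with i
  ext j
  by_cases hj : j = i
  · subst hj; simp [E_apply]
  · simp [E_apply, hj]

/-- The matrix coefficient as a continuous linear functional. -/
def coeffL (k s : ι) : Op ι →L[ℂ] ℂ :=
  (innerSL ℂ (E k : Ell2 ι)) ∘L (ContinuousLinearMap.apply ℂ (Ell2 ι) (E s : Ell2 ι))

lemma coeffL_apply (k s : ι) (x : Op ι) : coeffL k s x = coeff x k s := by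
  simp [coeffL, coeff_eq_inner]

lemma norm_coeff_le (x : Op ι) (k s : ι) : ‖coeff x k s‖ ≤ ‖x‖ := by
  rw [coeff_eq_inner]
  refine (norm_inner_le_norm _ _).trans ?_
  rw [norm_E, one_mul]
  exact (x.le_opNorm _).trans (by rw [norm_E, mul_one])

/-- The basis expansion of a vector converges in norm, so continuity reduces everything to basis
vectors. Most operator identities below are verified on coefficients through this lemma. -/
lemma op_ext {x y : Op ι} (h : ∀ k s, coeff x k s = coeff y k s) : x = y := by
  have hE : ∀ s, x (E s) = y (E s) := fun s => by
    ext k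
    exact h k s
  ext1 v
  have h1 := (hasSum_coord_smul_E v).mapL x
  have h2 := (hasSum_coord_smul_E v).mapL y
  simp only [map_smul, hE] at h1 h2
  exact h1.unique h2

lemma coeff_add (x y : Op ι) (k s : ι) : coeff (x + y) k s = coeff x k s + coeff y k s := by
  simp [← coeffL_apply]

lemma coeff_sub (x y : Op ι) (k s : ι) : coeff (x - y) k s = coeff x k s - coeff y k s := by
  simp [← coeffL_apply]

lemma coeff_neg (x : Op ι) (k s : ι) : coeff (-x) k s = -coeff x k s := by
  simp [← coeffL_apply]

lemma coeff_smul (c : ℂ) (x : Op ι) (k s : ι) : coeff (c • x) k s = c * coeff x k s := by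
  simp [← coeffL_apply]

lemma coeff_zero (k s : ι) : coeff (0 : Op ι) k s = 0 := by
  simp [← coeffL_apply]

lemma coeff_one (k s : ι) : coeff (1 : Op ι) k s = if k = s then 1 else 0 := by
  simp [coeff, E_apply]

lemma coeff_star (x : Op ι) (k s : ι) : coeff (star x) k s = star (coeff x s k) := by
  rw [coeff_eq_inner, coeff_eq_inner, ContinuousLinearMap.star_eq_adjoint,
    ContinuousLinearMap.adjoint_inner_right]
  exact (inner_conj_symm _ _).symm

lemma hasSum_coeff_mul (x y : Op ι) (k s : ι) :
    HasSum (fun m => coeff x k m * coeff y m s) (coeff (x * y) k s) := by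
  have h := (hasSum_coord_smul_E (y (E s))).mapL ((innerSL ℂ (E k : Ell2 ι)) ∘L x)
  have e : coeff (x * y) k s = ((innerSL ℂ (E k : Ell2 ι)) ∘L x) (y (E s)) := coeff_eq_inner _ _ _
  have e' : (fun m => coeff x k m * coeff y m s) = fun m =>
      ((innerSL ℂ (E k : Ell2 ι)) ∘L x) ((y (E s)) m • (E m : Ell2 ι)) := funext fun m => by
    rw [map_smul, smul_eq_mul, mul_comm, coeff_eq_inner x]
    rfl
  rw [e, e']
  exact h

lemma hasSum_coeff {α : Type*} {f : α → Op ι} {x : Op ι} (h : HasSum f x) (k s : ι) :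
    HasSum (fun a => coeff (f a) k s) (coeff x k s) := by
  simpa [coeffL_apply] using h.mapL (coeffL k s)

end Coeff

lemma coeff_toeplitz (b : Op ℤ) (k s : ℕ) : coeff (toeplitz b) k s = coeff b k s := by
  simp [coeff, toeplitz, incl_E, proj, coordOp_apply]

lemma coeff_shiftPow_mul (n : ℤ) (b : Op ℤ) (k s : ℤ) :
    coeff (shiftPow n * b) k s = coeff b (k - n) s := by
  simp [coeff, shiftPow, coordOp_apply]

lemma coeff_mulZ {S : Supernatural} (f : C(Odometer S, ℂ)) (k s : ℤ) :
    coeff (mulZ f) k s = if k = s then f ((s : ℤ) : Odometer S) else 0 := by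
  simp [coeff, mulZ_E, E_apply]

lemma coeff_mulN {S : Supernatural} (f : C(Odometer S, ℂ)) (k s : ℕ) :
    coeff (mulN f) k s = if k = s then f ((s : ℕ) : Odometer S) else 0 := by
  simp [coeff, mulN_E, E_apply]

lemma coeff_matrixUnit (p q k s : ℕ) :
    coeff (matrixUnit p q) k s = if k = p ∧ s = q then 1 else 0 := by
  simp only [coeff, matrixUnit, InnerProductSpace.rankOne_apply, inner_E_left, lp.coeFn_smul,
    Pi.smul_apply, smul_eq_mul, E_apply]
  split_ifs <;> simp_all

lemma U_pow_E (l k : ℕ) : (U ^ l) (E k) = E (k + l) := by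
  induction l with
  | zero => simp
  | succ l ih =>
    rw [pow_succ', mul_apply_eq_comp, ih, U_E]
    rfl

lemma coeff_mul_U_pow (x : Op ℕ) (l k s : ℕ) : coeff (x * U ^ l) k s = coeff x k (s + l) := by
  rw [coeff, coeff, mul_apply_eq_comp, U_pow_E]

lemma coeff_star_U_pow_mul (x : Op ℕ) (l k s : ℕ) :
    coeff (star (U ^ l) * x) k s = coeff x (k + l) s := by
  rw [← star_star x, ← star_mul, coeff_star, coeff_mul_U_pow, ← coeff_star]

lemma coeff_U (k s : ℕ) : coeff U k s = if k = s + 1 then 1 else 0 := by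
  simp [coeff, U_E, E_apply]

lemma star_U_pow_mul_self (l : ℕ) : star (U ^ l) * U ^ l = 1 := by
  refine op_ext fun k s => ?_
  rw [coeff_star_U_pow_mul, ← one_mul (U ^ l), coeff_mul_U_pow, coeff_one, coeff_one]
  simp

lemma coeff_U_pow (l k s : ℕ) : coeff (U ^ l) k s = if k = s + l then 1 else 0 := by
  rw [← one_mul (U ^ l), coeff_mul_U_pow, coeff_one]

/-- The coefficients of the projection onto the span of the first `l` basis vectors. -/
lemma coeff_one_sub_U_pow_mul_star (l k s : ℕ) :
    coeff (1 - U ^ l * star (U ^ l)) k s = if k = s ∧ k < l then 1 else 0 := by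
  have h : coeff (U ^ l * star (U ^ l)) k s = if k = s ∧ l ≤ k then 1 else 0 := by
    refine (hasSum_coeff_mul (U ^ l) (star (U ^ l)) k s).unique ?_
    simp only [coeff_star, coeff_U_pow]
    by_cases hk : k = s ∧ l ≤ k
    · rw [if_pos hk]
      convert hasSum_single (k - l) ?_ using 1
      · rw [if_pos (by omega), if_pos (by omega)]; simp
      · intro m hm
        rw [if_neg (by omega)]; simp
    · rw [if_neg hk]
      convert hasSum_zero using 2 with m
      split_ifs <;> first | omega | simp
  rw [coeff_sub, coeff_one, h]
  split_ifs <;> first | omega | simp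

/-! ## Families of operators with decaying coefficients -/

section Decay

/-- The coefficients of the operators `x i` decay, uniformly in `i`, faster than any power of the
weight `w`. -/
def Decay {I : Type*} (w : ℕ → ℕ → ℝ) (x : I → Op ℕ) : Prop :=
  ∀ N : ℕ, ∃ C : ℝ, ∀ i k s, w k s ^ N * ‖coeff (x i) k s‖ ≤ C

/-- The weight that measures the distance to the diagonal. -/
def offDiag (k s : ℕ) : ℝ := 1 + |(k : ℝ) - s|

/-- The weight that measures the distance to the origin. -/
def radial (k s : ℕ) : ℝ := 1 + (k : ℝ) + s

lemma one_le_offDiag (k s : ℕ) : 1 ≤ offDiag k s := by simp [offDiag]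

lemma one_le_radial (k s : ℕ) : 1 ≤ radial k s := by
  rw [radial, add_assoc]
  have : (0 : ℝ) ≤ k + s := by positivity
  linarith

lemma offDiag_comm (k s : ℕ) : offDiag k s = offDiag s k := by simp [offDiag, abs_sub_comm]

lemma radial_comm (k s : ℕ) : radial k s = radial s k := by simp [radial]; ring

lemma offDiag_le_radial (k s : ℕ) : offDiag k s ≤ radial k s := by
  have : |(k : ℝ) - s| ≤ k + s := by
    rw [abs_le]
    constructor <;> linarith [(k.cast_nonneg : (0 : ℝ) ≤ k), (s.cast_nonneg : (0 : ℝ) ≤ s)]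
  rw [offDiag, radial]
  linarith

/-- Since `s ≤ m + |m - s|`, moving from column `m` to column `s` costs only an off-diagonal factor.
This makes radial decay absorbing under multiplication by operators with off-diagonal decay. -/
lemma radial_le_mul (k m s : ℕ) : radial k s ≤ radial k m * offDiag m s := by
  have h : (s : ℝ) - m ≤ |(m : ℝ) - s| := by rw [abs_sub_comm]; exact le_abs_self _
  have h1 : (0 : ℝ) ≤ (k : ℝ) + m := by positivity
  rw [radial, radial, offDiag]
  nlinarith [mul_nonneg h1 (abs_nonneg ((m : ℝ) - s))]

variable {I J : Type*} {w : ℕ → ℕ → ℝ} {x y : I → Op ℕ}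

lemma Decay.comp (h : Decay w x) (g : J → I) : Decay w fun j => x (g j) := fun N =>
  (h N).imp fun _ hC j => hC (g j)

lemma Decay.add (hw : ∀ k s, 1 ≤ w k s) (hx : Decay w x) (hy : Decay w y) :
    Decay w fun i => x i + y i := fun N => by
  obtain ⟨C, hC⟩ := hx N
  obtain ⟨D, hD⟩ := hy N
  refine ⟨C + D, fun i k s => ?_⟩
  rw [coeff_add]
  have h0 : 0 ≤ w k s ^ N := pow_nonneg (zero_le_one.trans (hw k s)) N
  calc _ ≤ w k s ^ N * (‖coeff (x i) k s‖ + ‖coeff (y i) k s‖) := by gcongr; exact norm_add_le _ _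
    _ ≤ C + D := by rw [mul_add]; exact add_le_add (hC i k s) (hD i k s)

lemma Decay.zero : Decay w fun _ : I => (0 : Op ℕ) := fun _ =>
  ⟨0, fun _ _ _ => by simp [coeff_zero]⟩

lemma Decay.neg (hx : Decay w x) : Decay w fun i => -x i := fun N =>
  (hx N).imp fun C hC i k s => by rw [coeff_neg, norm_neg]; exact hC i k s

lemma Decay.sub (hw : ∀ k s, 1 ≤ w k s) (hx : Decay w x) (hy : Decay w y) :
    Decay w fun i => x i - y i := by
  simpa only [sub_eq_add_neg] using hx.add hw hy.neg

lemma Decay.sum (hw : ∀ k s, 1 ≤ w k s) {α : Type*} (t : Finset α) {x : α → I → Op ℕ}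
    (h : ∀ a ∈ t, Decay w (x a)) : Decay w fun i => ∑ a ∈ t, x a i := by
  classical
  induction t using Finset.induction_on with
  | empty => simpa using Decay.zero
  | insert a t ha ih =>
    simp only [Finset.sum_insert ha]
    exact (h a (by simp)).add hw (ih fun b hb => h b (by simp [hb]))

lemma Decay.star (hw : ∀ k s, w k s = w s k) (hx : Decay w x) :
    Decay w fun i => star (x i) := fun N =>
  (hx N).imp fun C hC i k s => by rw [coeff_star, norm_star, hw]; exact hC i s k

lemma Decay.offDiag_of_radial (hx : Decay radial x) : Decay offDiag x := fun N =>
  (hx N).imp fun C hC i k s => by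
    refine le_trans ?_ (hC i k s)
    have := zero_le_one.trans (one_le_offDiag k s)
    have := offDiag_le_radial k s
    gcongr

/-- The family `y` lies in multiples of the closed absolutely convex hull of the family `x`. -/
def Dominated (x : I → Op ℕ) (y : J → Op ℕ) : Prop :=
  ∃ K : ℝ, ∀ (Λ : Op ℕ →L[ℂ] ℂ) (C : ℝ), (∀ i, ‖Λ (x i)‖ ≤ C) → ∀ j, ‖Λ (y j)‖ ≤ K * C

/-- Each matrix coefficient is a continuous functional, so domination applies to it with the bound
`C / w k s ^ N`. -/
lemma Decay.of_dominated (hw : ∀ k s, 1 ≤ w k s) (hx : Decay w x) {y : J → Op ℕ}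
    (h : Dominated x y) : Decay w y := fun N => by
  obtain ⟨K, hK⟩ := h
  obtain ⟨C, hC⟩ := hx N
  refine ⟨K * C, fun j k s => ?_⟩
  have h0 : 0 < w k s ^ N := pow_pos (zero_lt_one.trans_le (hw k s)) N
  have := hK (coeffL k s) (C / w k s ^ N)
    (fun i => by rw [coeffL_apply, le_div_iff₀' h0]; exact hC i k s) j
  rw [coeffL_apply, ← mul_div_assoc, le_div_iff₀' h0] at this
  exact this

lemma summable_one_add_nat : Summable fun m : ℕ => ((1 + (m : ℝ)) ^ 2)⁻¹ := by
  have := (summable_nat_add_iff 1).mpr (Real.summable_nat_pow_inv.mpr one_lt_two)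
  refine this.congr fun m => ?_
  push_cast
  rw [add_comm]

lemma summable_one_add_int : Summable fun m : ℤ => ((1 + |(m : ℝ)|) ^ 2)⁻¹ := by
  refine Summable.of_nat_of_neg ?_ ?_ <;> simpa using summable_one_add_nat

/-- In the sum over the middle index `m`, the weight is split by `radial_le_mul`; two surplus powers
of `radial k m ≥ 1 + m` make the sum converge. -/
lemma Decay.radial_mul (hx : Decay radial x) (hy : Decay offDiag y) :
    Decay radial fun i => x i * y i := fun N => by
  obtain ⟨C, hC⟩ := hx (N + 2)
  obtain ⟨D, hD⟩ := hy N
  refine ⟨∑' m : ℕ, C * D * ((1 + (m : ℝ)) ^ 2)⁻¹, fun i k s => ?_⟩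
  have hs := (hasSum_coeff_mul (x i) (y i) k s).mul_left ((radial k s ^ N : ℝ) : ℂ)
  have hn : radial k s ^ N * ‖coeff (x i * y i) k s‖ =
      ‖((radial k s ^ N : ℝ) : ℂ) * coeff (x i * y i) k s‖ := by
    rw [norm_mul, Complex.norm_real, Real.norm_of_nonneg
      (pow_nonneg (zero_le_one.trans (one_le_radial k s)) N)]
  rw [hn]
  refine hs.tsum_eq ▸ tsum_of_norm_bounded (summable_one_add_nat.mul_left (C * D)).hasSum
    fun m => ?_
  have h1 := one_le_radial k s
  have h2 := one_le_radial k m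
  have h3 := one_le_offDiag m s
  rw [norm_mul, norm_mul, Complex.norm_real, Real.norm_of_nonneg (by positivity),
    ← div_eq_mul_inv, le_div_iff₀ (by positivity)]
  have hm : 1 + (m : ℝ) ≤ radial k m := by
    rw [radial]; linarith [(k.cast_nonneg : (0 : ℝ) ≤ k)]
  have hc := hC i k m
  have hd := hD i m s
  calc radial k s ^ N * (‖coeff (x i) k m‖ * ‖coeff (y i) m s‖) * (1 + (m : ℝ)) ^ 2
      ≤ (radial k m * offDiag m s) ^ N * (‖coeff (x i) k m‖ * ‖coeff (y i) m s‖) *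
          radial k m ^ 2 := by
        have := radial_le_mul k m s
        gcongr
    _ = (radial k m ^ (N + 2) * ‖coeff (x i) k m‖) * (offDiag m s ^ N * ‖coeff (y i) m s‖) := by
        ring
    _ ≤ C * D := mul_le_mul hc hd (by positivity) (le_trans (by positivity) hc)

lemma Decay.mul_radial (hx : Decay offDiag x) (hy : Decay radial y) :
    Decay radial fun i => x i * y i := by
  have := ((hy.star radial_comm).radial_mul (hx.star offDiag_comm)).star radial_comm
  simpa using this

end Decay

/-! ## Smooth vectors for a one-parameter group of inner automorphisms -/

section Smooth

attribute [local instance] Matrix.linftyOpNormedRing Matrix.linftyOpNormedAlgebra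

/-- The uniformity of the row-sum norm is definitionally the product uniformity, so completeness is
inherited from functions. -/
lemma completeSpace_matrix {X : Type*} [NormedRing X] [CompleteSpace X] (n : ℕ) :
    @CompleteSpace (Matrix (Fin n) (Fin n) X)
      (inferInstance : PseudoMetricSpace (Matrix (Fin n) (Fin n) X)).toUniformSpace :=
  inferInstanceAs (CompleteSpace (Fin n → Fin n → X))

lemma norm_entry_le {X : Type*} [NormedRing X] {n : ℕ} (M : Matrix (Fin n) (Fin n) X)
    (p q : Fin n) : ‖M p q‖ ≤ ‖M‖ := by
  rw [Matrix.linfty_opNorm_def]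
  refine le_trans ?_ (NNReal.coe_le_coe.mpr (Finset.le_sup (f := fun i => ∑ j, ‖M i j‖₊)
    (Finset.mem_univ p)))
  have := Finset.single_le_sum (f := fun j => ‖M p j‖₊) (fun _ _ => zero_le)
    (Finset.mem_univ q)
  exact_mod_cast this

variable {X : Type*} [NormedRing X] [NormedAlgebra ℂ X]

/-- The entry of a matrix as a continuous linear map. -/
def entryCLM (𝕜 : Type*) [NontriviallyNormedField 𝕜] [NormedAlgebra 𝕜 X] {n : ℕ} (p q : Fin n) :
    Matrix (Fin n) (Fin n) X →L[𝕜] X :=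
  LinearMap.mkContinuous
    { toFun := fun M => M p q, map_add' := fun _ _ => rfl, map_smul' := fun _ _ => rfl } 1
    fun M => by
      rw [one_mul]
      exact norm_entry_le M p q

/-- The matrix with a single entry as a continuous linear function of the entry. -/
def singleCLM {n : ℕ} (p q : Fin n) : X →L[ℝ] Matrix (Fin n) (Fin n) X :=
  LinearMap.mkContinuous
    { toFun := fun x => Matrix.single p q x
      map_add' := fun _ _ => Matrix.single_add _ _ _ _
      map_smul' := fun c x => (Matrix.smul_single c p q x).symm } 1
    fun x => by
      rw [one_mul, Matrix.linfty_opNorm_def]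
      rw [← coe_nnnorm x]
      refine NNReal.coe_le_coe.mpr (Finset.sup_le fun i _ => ?_)
      change ∑ j, ‖Matrix.single p q x i j‖₊ ≤ _
      by_cases hi : p = i
      · subst hi
        rw [Finset.sum_eq_single q]
        · simp
        · intro j _ hj
          simp [hj.symm]
        · simp
      · refine (Finset.sum_eq_zero fun j _ => ?_).le.trans zero_le
        simp [hi]

lemma contDiff_matrix {n : ℕ} {F : ℝ → Matrix (Fin n) (Fin n) X}
    (h : ∀ p q, ContDiff ℝ (⊤ : ℕ∞) fun t => F t p q) : ContDiff ℝ (⊤ : ℕ∞) F := by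
  have e : F = fun t => ∑ p, ∑ q, singleCLM p q (F t p q) := funext fun t =>
    Matrix.matrix_eq_sum_single (F t)
  rw [e]
  exact ContDiff.sum fun p _ => ContDiff.sum fun q _ =>
    (singleCLM (X := X) p q).contDiff.fun_comp (h p q)

/-- A smooth curve in a normed algebra. -/
def SmoothCurve (F : ℝ → X) : Prop := ContDiff ℝ (⊤ : ℕ∞) F

lemma SmoothCurve.mul {F G : ℝ → X} (hF : SmoothCurve F) (hG : SmoothCurve G) :
    SmoothCurve fun t => F t * G t :=
  ContDiff.mul hF hG

lemma SmoothCurve.functional_iteratedDeriv {F : ℝ → X} (hF : SmoothCurve F) (Λ : X →L[ℂ] ℂ)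
    (j : ℕ) (t : ℝ) : iteratedDeriv j (fun t => Λ (F t)) t = Λ (iteratedDeriv j F t) := by
  rw [iteratedDeriv_eq_iteratedFDeriv, iteratedDeriv_eq_iteratedFDeriv]
  exact congrFun (congrArg DFunLike.coe ((Λ.restrictScalars ℝ).iteratedFDeriv_comp_left
    (ContDiff.contDiffAt hF) (i := j) (by exact_mod_cast le_top))) _

/-- The entries of an inverse of a matrix with smooth entries are smooth. -/
lemma smoothCurve_entry_of_mul_eq_one [CompleteSpace X] {n : ℕ} {F G : ℝ → Matrix (Fin n) (Fin n) X}
    (hF : ∀ p q, SmoothCurve fun t => F t p q) (hFG : ∀ t, F t * G t = 1)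
    (hGF : ∀ t, G t * F t = 1) (p q : Fin n) : SmoothCurve fun t => G t p q := by
  have := completeSpace_matrix (X := X) n
  have hG : ContDiff ℝ (⊤ : ℕ∞) G := by
    -- The two-sided inverse is unique, so `G` is the composition of `F` with inversion, which is
    -- smooth at every unit of a complete normed algebra.
    have e : G = fun t => Ring.inverse (F t) := funext fun t => by
      let u : (Matrix (Fin n) (Fin n) X)ˣ := ⟨F t, G t, hFG t, hGF t⟩
      exact (Ring.inverse_unit u).symm
    rw [e, contDiff_iff_contDiffAt]
    intro t
    let u : (Matrix (Fin n) (Fin n) X)ˣ := ⟨F t, G t, hFG t, hGF t⟩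
    exact (contDiffAt_ringInverse ℝ u).comp t (contDiff_matrix hF).contDiffAt
  exact (entryCLM ℝ p q).contDiff.comp hG

end Smooth

/-! ## Off-diagonal decay as smoothness -/

section OffDiag

/-- The unitary operator `exp (i t 𝕂)`. -/
def phase (t : ℝ) : Op ℕ :=
  coordOp some (by intro i i' j h h'; simp at h h'; omega)
    (fun k => Complex.exp (t * k * Complex.I)) 1 zero_le_one fun k => by
      rw [← Complex.ofReal_natCast, ← Complex.ofReal_mul, Complex.norm_exp_ofReal_mul_I]

lemma coeff_phase_mul (t : ℝ) (x : Op ℕ) (k s : ℕ) :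
    coeff (phase t * x) k s = Complex.exp (t * k * Complex.I) * coeff x k s := rfl

lemma phase_E (t : ℝ) (s : ℕ) : phase t (E s) = Complex.exp (t * s * Complex.I) • E s := by
  ext k
  by_cases h : k = s <;> simp [phase, coordOp_apply, E_apply, h]

lemma coeff_mul_phase (t : ℝ) (x : Op ℕ) (k s : ℕ) :
    coeff (x * phase t) k s = Complex.exp (t * s * Complex.I) * coeff x k s := by
  rw [coeff, mul_apply_eq_comp, phase_E, map_smul]
  rfl

/-- The exponential separates the diagonals: on the one with `k - s = ν` the conjugation acts by the
character `exp(iνt)`. Differentiating in `t` therefore produces powers of `i(k - s)`. -/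
lemma coeff_phase_conj (t : ℝ) (x : Op ℕ) (k s : ℕ) :
    coeff (phase t * x * phase (-t)) k s =
      Complex.exp ((((k : ℤ) - s : ℤ) : ℂ) * Complex.I * t) * coeff x k s := by
  rw [coeff_mul_phase, coeff_phase_mul, ← mul_assoc, ← Complex.exp_add]
  congr 2
  push_cast
  ring

lemma phase_mul_phase_neg (t : ℝ) : phase t * phase (-t) = 1 := by
  refine op_ext fun k s => ?_
  have := coeff_phase_conj t 1 k s
  rw [mul_one] at this
  rw [this, coeff_one]
  split_ifs with h
  · simp [h]
  · simp

/-- The operator with the coefficients `w k` at the positions `(k, k - ν)`. -/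
def diagOp (ν : ℤ) (w : ℕ → ℂ) (C : ℝ) (hC : 0 ≤ C) (hw : ∀ k, ‖w k‖ ≤ C) : Op ℕ :=
  coordOp (fun k => if 0 ≤ (k : ℤ) - ν then some ((k : ℤ) - ν).toNat else none)
    (by intro i i' j h h'; split_ifs at h h'; simp at h h'; omega) w C hC hw

lemma coeff_diagOp (ν : ℤ) (w : ℕ → ℂ) (C : ℝ) (hC : 0 ≤ C) (hw : ∀ k, ‖w k‖ ≤ C) (k s : ℕ) :
    coeff (diagOp ν w C hC hw) k s = if (k : ℤ) - s = ν then w k else 0 := by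
  rw [coeff, diagOp, coordOp_apply]
  split_ifs with h1 h2 h2
  · have : s = ((k : ℤ) - ν).toNat := by omega
    simp [E_apply, ← this]
  · have : ((k : ℤ) - ν).toNat ≠ s := by omega
    simp [E_apply, this]
  · omega
  · rfl

/-- The constant `C` used to construct the operator plays no role in its values, so any other bound
`D` on the weights also bounds the norm. This is what turns entrywise decay into norm decay of
diagonals. -/
lemma norm_diagOp_le (ν : ℤ) (w : ℕ → ℂ) (C : ℝ) (hC : 0 ≤ C) (hw : ∀ k, ‖w k‖ ≤ C) (D : ℝ)
    (hD : 0 ≤ D) (hw' : ∀ k, ‖w k‖ ≤ D) : ‖diagOp ν w C hC hw‖ ≤ D :=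
  LinearMap.mkContinuous_norm_le
    { toFun := diagOp ν w D hD hw'
      map_add' := map_add (diagOp ν w D hD hw')
      map_smul' := map_smul (diagOp ν w D hD hw') } hD fun x =>
    lp.norm_le_of_forall_sum_le (by norm_num) (by positivity)
      (coordFun_sum_le _ (by intro i i' j h h'; split_ifs at h h'; simp at h h'; omega)
        w D hD hw' x)

lemma iteratedDeriv_cexp_real (c : ℂ) (n : ℕ) :
    iteratedDeriv n (fun t : ℝ => Complex.exp (c * t)) =
      fun t : ℝ => c ^ n * Complex.exp (c * t) := by
  induction n with
  | zero => simp
  | succ n ih =>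
    rw [iteratedDeriv_succ, ih]
    funext t
    have h : HasDerivAt (fun t : ℝ => Complex.exp (c * t)) (Complex.exp (c * t) * c) t := by
      have := (Complex.ofRealCLM.hasDerivAt (x := t)).const_mul c
      simpa using this.cexp
    rw [(h.const_mul (c ^ n)).deriv]
    ring

/-! ### Fourier series with rapidly decaying coefficients. -/

section Fourier

variable {X : Type*} [NormedRing X] (D : ℤ → X)

lemma summable_of_rapid (hD : ∀ N : ℕ, ∃ C : ℝ, ∀ ν : ℤ, (1 + |(ν : ℝ)|) ^ N * ‖D ν‖ ≤ C) (k : ℕ) :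
    Summable fun ν : ℤ => (1 + |(ν : ℝ)|) ^ k * ‖D ν‖ := by
  obtain ⟨C, hC⟩ := hD (k + 2)
  refine Summable.of_nonneg_of_le (fun ν => by positivity) (fun ν => ?_)
    (summable_one_add_int.mul_left C)
  rw [← div_eq_mul_inv, le_div_iff₀ (by positivity)]
  refine le_trans (le_of_eq ?_) (hC ν)
  ring

variable [NormedAlgebra ℂ X]

lemma norm_exp_smul (ν : ℤ) (t : ℝ) (y : X) :
    ‖Complex.exp ((ν : ℂ) * Complex.I * t) • y‖ = ‖y‖ := by
  rw [norm_smul, mul_right_comm, ← Complex.ofReal_intCast, ← Complex.ofReal_mul,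
    Complex.norm_exp_ofReal_mul_I, one_mul]

lemma summable_exp_smul [CompleteSpace X] (hD : Summable fun ν => ‖D ν‖) (t : ℝ) :
    Summable fun ν : ℤ => Complex.exp ((ν : ℂ) * Complex.I * t) • D ν :=
  Summable.of_norm (by simpa only [norm_exp_smul] using hD)

lemma hasSum_exp_mul [CompleteSpace X] (hD : Summable fun ν => ‖D ν‖) (Λ : X →L[ℂ] ℂ) (t : ℝ) :
    HasSum (fun ν : ℤ => Complex.exp ((ν : ℂ) * Complex.I * t) * Λ (D ν))
      (Λ (∑' ν : ℤ, Complex.exp ((ν : ℂ) * Complex.I * t) • D ν)) := by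
  simpa using (summable_exp_smul D hD t).hasSum.mapL Λ

/-- Termwise differentiation: the `k`-th derivative of the term at `ν` has norm `|ν|^k ‖D ν‖`, which
is summable by rapid decay. -/
lemma contDiff_tsum_exp_smul [CompleteSpace X]
    (hD : ∀ N : ℕ, ∃ C : ℝ, ∀ ν : ℤ, (1 + |(ν : ℝ)|) ^ N * ‖D ν‖ ≤ C) :
    ContDiff ℝ (⊤ : ℕ∞) fun t : ℝ => ∑' ν : ℤ, Complex.exp ((ν : ℂ) * Complex.I * t) • D ν := by
  have hL : ∀ ν : ℤ, (fun t : ℝ => Complex.exp ((ν : ℂ) * Complex.I * t) • D ν) =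
      (ContinuousLinearMap.id ℝ ℂ).smulRight (D ν) ∘
        fun t : ℝ => Complex.exp ((ν : ℂ) * Complex.I * t) := fun ν => rfl
  have he : ∀ ν : ℤ, ContDiff ℝ (⊤ : ℕ∞) fun t : ℝ => Complex.exp ((ν : ℂ) * Complex.I * t) :=
    fun ν => ContDiff.cexp (contDiff_const.mul Complex.ofRealCLM.contDiff)
  refine contDiff_tsum (fun ν => ?_) (fun k _ => summable_of_rapid D hD k) fun k ν t _ => ?_
  · rw [hL]
    exact ContinuousLinearMap.contDiff _ |>.comp (he ν)
  · rw [norm_iteratedFDeriv_eq_norm_iteratedDeriv]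
    have : iteratedDeriv k (fun t : ℝ => Complex.exp ((ν : ℂ) * Complex.I * t) • D ν) t =
        (iteratedDeriv k (fun t : ℝ => Complex.exp ((ν : ℂ) * Complex.I * t)) t) • D ν := by
      rw [iteratedDeriv_eq_iteratedFDeriv, iteratedDeriv_eq_iteratedFDeriv, hL,
        ContinuousLinearMap.iteratedFDeriv_comp_left _ (he ν).contDiffAt
          (by exact_mod_cast le_top)]
      rfl
    rw [this, iteratedDeriv_cexp_real, mul_smul, norm_smul, norm_exp_smul, norm_pow, norm_mul,
      Complex.norm_I, mul_one, Complex.norm_intCast]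
    gcongr
    linarith [abs_nonneg (ν : ℝ)]

/-- Stating the sum through functionals lets the curve be identified later by its coefficients. -/
lemma exists_smoothCurve_hasSum [CompleteSpace X]
    (hD : ∀ N : ℕ, ∃ C : ℝ, ∀ ν : ℤ, (1 + |(ν : ℝ)|) ^ N * ‖D ν‖ ≤ C) :
    ∃ F : ℝ → X, SmoothCurve F ∧ ∀ (Λ : X →L[ℂ] ℂ) (t : ℝ),
      HasSum (fun ν : ℤ => Complex.exp ((ν : ℂ) * Complex.I * t) * Λ (D ν)) (Λ (F t)) :=
  ⟨_, contDiff_tsum_exp_smul D hD, fun Λ t => hasSum_exp_mul D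
    (by simpa using summable_of_rapid D hD 0) Λ t⟩

end Fourier

open BoundedContinuousFunction

variable {I : Type*} [TopologicalSpace I]

/-- A matrix coefficient of a member of a bounded family as a continuous linear functional. -/
def evalCoeff (i : I) (k s : ℕ) : (I →ᵇ Op ℕ) →L[ℂ] ℂ :=
  LinearMap.mkContinuous
    { toFun := fun x : I →ᵇ Op ℕ => coeff (x i) k s
      map_add' := fun x y => coeff_add (x i) (y i) k s
      map_smul' := fun c x => coeff_smul c (x i) k s } 1
    fun x : I →ᵇ Op ℕ => by
      rw [one_mul]
      exact (norm_coeff_le (x i) k s).trans (x.norm_coe_le_norm i)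

lemma evalCoeff_apply (i : I) (k s : ℕ) (x : I →ᵇ Op ℕ) : evalCoeff i k s x = coeff (x i) k s :=
  rfl

/-- The conjugation of a bounded family by the unitary operators `exp (i t 𝕂)`. -/
def phaseConj (x : I →ᵇ Op ℕ) (t : ℝ) : I →ᵇ Op ℕ :=
  const I (phase t) * x * const I (phase (-t))

/-- The `j`-th derivative at `0` has the coefficients `(i(k - s))^j x_{ks}`, and coefficients are
bounded by the norm. The binomial theorem then assembles the powers of `1 + |k - s|`. -/
lemma decay_of_smoothCurve_phaseConj (x : I →ᵇ Op ℕ) (h : SmoothCurve (phaseConj x)) :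
    Decay offDiag x := by
  have key : ∀ (j : ℕ) (i : I) (k s : ℕ), |(k : ℝ) - s| ^ j * ‖coeff (x i) k s‖ ≤
      ‖iteratedDeriv j (phaseConj x) 0‖ := fun j i k s => by
    have hc : (fun t => evalCoeff i k s (phaseConj x t)) = fun t : ℝ =>
        coeff (x i) k s * Complex.exp ((((k : ℤ) - s : ℤ) : ℂ) * Complex.I * t) := by
      funext t
      rw [mul_comm, ← coeff_phase_conj]
      rfl
    have hd := h.functional_iteratedDeriv (evalCoeff i k s) j 0
    have he : iteratedDeriv j (fun t => evalCoeff i k s (phaseConj x t)) 0 =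
        coeff (x i) k s * ((((k : ℤ) - s : ℤ) : ℂ) * Complex.I) ^ j := by
      rw [hc, iteratedDeriv_const_mul_field, iteratedDeriv_cexp_real]
      simp
    have hn := congrArg norm (hd.symm.trans he)
    rw [evalCoeff_apply, norm_mul, norm_pow, norm_mul, Complex.norm_I, mul_one,
      Complex.norm_intCast] at hn
    push_cast at hn
    rw [mul_comm, ← hn]
    exact (norm_coeff_le _ _ _).trans (norm_coe_le_norm _ _)
  intro N
  refine ⟨∑ j ∈ Finset.range (N + 1), ‖iteratedDeriv j (phaseConj x) 0‖ * (N.choose j),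
    fun i k s => ?_⟩
  rw [offDiag, add_comm, add_pow, Finset.sum_mul]
  refine Finset.sum_le_sum fun j _ => ?_
  rw [one_pow, mul_one, mul_right_comm]
  gcongr
  exact key j i k s

/-- An operator supported on one diagonal has norm at most the supremum of its entries, so uniform
off-diagonal decay becomes rapid decay of the norms of the diagonals in `ν`. -/
lemma exists_diagonals [DiscreteTopology I] (x : I →ᵇ Op ℕ) (h : Decay offDiag x) :
    ∃ D : ℤ → I →ᵇ Op ℕ,
      (∀ ν i k s, coeff (D ν i) k s = if (k : ℤ) - s = ν then coeff (x i) k s else 0) ∧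
      ∀ N : ℕ, ∃ C : ℝ, ∀ ν : ℤ, (1 + |(ν : ℝ)|) ^ N * ‖D ν‖ ≤ C := by
  classical
  let w : ℤ → I → ℕ → ℂ := fun ν i k =>
    if 0 ≤ (k : ℤ) - ν then coeff (x i) k ((k : ℤ) - ν).toNat else 0
  have hw : ∀ ν i k, ‖w ν i k‖ ≤ ‖x‖ := fun ν i k => by
    simp only [w]
    split_ifs
    · exact (norm_coeff_le _ _ _).trans (norm_coe_le_norm _ _)
    · rw [norm_zero]; exact norm_nonneg x
  let D : ℤ → I →ᵇ Op ℕ := fun ν => ofNormedAddCommGroupDiscrete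
    (fun i => diagOp ν (w ν i) ‖x‖ (norm_nonneg x) (hw ν i)) ‖x‖
    fun i => norm_diagOp_le _ _ _ _ _ _ (norm_nonneg x) (hw ν i)
  have hDc : ∀ ν i k s, coeff (D ν i) k s = if (k : ℤ) - s = ν then coeff (x i) k s else 0 := by
    intro ν i k s
    refine (coeff_diagOp ν (w ν i) ‖x‖ (norm_nonneg x) (hw ν i) k s).trans ?_
    by_cases hν : (k : ℤ) - s = ν
    · subst hν
      simp [w]
    · simp [hν]
  have hDn : ∀ N : ℕ, ∃ C : ℝ, ∀ ν : ℤ, (1 + |(ν : ℝ)|) ^ N * ‖D ν‖ ≤ C := fun N => by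
    obtain ⟨C, hC⟩ := h N
    refine ⟨max C 0, fun ν => ?_⟩
    rw [← le_div_iff₀' (by positivity)]
    have h0 : 0 ≤ max C 0 / (1 + |(ν : ℝ)|) ^ N := by positivity
    rw [BoundedContinuousFunction.norm_le h0]
    intro i
    refine norm_diagOp_le ν (w ν i) ‖x‖ (norm_nonneg x) (hw ν i) _ h0 fun k => ?_
    simp only [w]
    split_ifs with hk
    · rw [le_div_iff₀' (by positivity)]
      refine le_trans (le_of_eq ?_) ((hC i k ((k : ℤ) - ν).toNat).trans (le_max_left _ _))
      rw [offDiag]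
      congr 4
      have : (((k : ℤ) - ν).toNat : ℤ) = k - ν := Int.toNat_of_nonneg hk
      have : ((((k : ℤ) - ν).toNat : ℤ) : ℝ) = k - ν := by rw [this]; push_cast; rfl
      rw [Int.cast_natCast] at this
      rw [this]
      ring
    · simpa using h0
  exact ⟨D, hDc, hDn⟩

/-- The conjugated family is the Fourier series of its diagonals: both sides have the same
coefficients, only the diagonal `ν = k - s` contributing. -/
lemma smoothCurve_phaseConj_of_decay [DiscreteTopology I] (x : I →ᵇ Op ℕ) (h : Decay offDiag x) :
    SmoothCurve (phaseConj x) := by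
  obtain ⟨D, hDc, hDn⟩ := exists_diagonals x h
  obtain ⟨F, hF, hs⟩ := exists_smoothCurve_hasSum D hDn
  suffices e : phaseConj x = F from e ▸ hF
  funext t
  refine BoundedContinuousFunction.ext fun i => op_ext fun k s => ?_
  refine HasSum.unique ?_ (hs (evalCoeff i k s) t)
  have h3 : coeff (phaseConj x t i) k s = _ := coeff_phase_conj t (x i) k s
  simp only [evalCoeff_apply, hDc, h3]
  convert hasSum_single ((k : ℤ) - s) ?_ using 1
  · simp
  · intro ν hν
    rw [if_neg hν.symm, mul_zero]

end OffDiag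

/-! ### Smoothness of products and inverses. -/

section PhaseHom

open BoundedContinuousFunction

variable {I : Type*} [TopologicalSpace I]

lemma phase_neg_mul_phase (t : ℝ) : phase (-t) * phase t = 1 := by
  simpa using phase_mul_phase_neg (-t)

/-- The conjugation by `exp (i t 𝕂)` as a ring homomorphism. -/
def phaseHom (t : ℝ) : (I →ᵇ Op ℕ) →+* (I →ᵇ Op ℕ) where
  toFun x := phaseConj x t
  map_one' := BoundedContinuousFunction.ext fun i => by
    change phase t * 1 * phase (-t) = 1
    rw [mul_one, phase_mul_phase_neg]
  map_mul' x y := BoundedContinuousFunction.ext fun i => by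
    change phase t * (x i * y i) * phase (-t) =
      (phase t * x i * phase (-t)) * (phase t * y i * phase (-t))
    calc _ = phase t * x i * 1 * y i * phase (-t) := by rw [mul_one]; simp only [mul_assoc]
      _ = _ := by rw [← phase_neg_mul_phase t]; simp only [mul_assoc]
  map_zero' := BoundedContinuousFunction.ext fun i => by
    change phase t * 0 * phase (-t) = 0
    rw [mul_zero, zero_mul]
  map_add' x y := BoundedContinuousFunction.ext fun i => by
    change phase t * (x i + y i) * phase (-t) =
      (phase t * x i * phase (-t)) + (phase t * y i * phase (-t))
    rw [mul_add, add_mul]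

lemma smoothCurve_phaseConj_mul (x y : I →ᵇ Op ℕ) (hx : SmoothCurve (phaseConj x))
    (hy : SmoothCurve (phaseConj y)) : SmoothCurve (phaseConj (x * y)) := by
  have e : phaseConj (x * y) = fun t => phaseConj x t * phaseConj y t :=
    funext fun t => map_mul (phaseHom t) x y
  rw [e]
  exact hx.mul hy

/-- Conjugation is a ring homomorphism, so it carries the inverse matrix to the inverse of the
conjugated matrix, at every time `t`. -/
lemma smoothCurve_phaseConj_entry {n : ℕ} (M N : Matrix (Fin n) (Fin n) (I →ᵇ Op ℕ))
    (hM : ∀ p q, SmoothCurve (phaseConj (M p q))) (hMN : M * N = 1) (hNM : N * M = 1)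
    (p q : Fin n) : SmoothCurve (phaseConj (N p q)) :=
  smoothCurve_entry_of_mul_eq_one (F := fun t => M.map (phaseHom t))
    (G := fun t => N.map (phaseHom t)) hM
    (fun t => by rw [← Matrix.map_mul, hMN, Matrix.map_one _ (map_zero _) (map_one _)])
    (fun t => by rw [← Matrix.map_mul, hNM, Matrix.map_one _ (map_zero _) (map_one _)]) p q

end PhaseHom

/-! ### Uniform off-diagonal decay for bounded families. -/

section Families

variable {I J : Type*}

/-- A bounded family whose coefficients decay rapidly away from the diagonal, uniformly. -/
def OffDiagDecay (x : I → Op ℕ) : Prop := (∃ C : ℝ, ∀ i, ‖x i‖ ≤ C) ∧ Decay offDiag x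

variable {x y : I → Op ℕ}

lemma OffDiagDecay.mul (hx : OffDiagDecay x) (hy : OffDiagDecay y) :
    OffDiagDecay fun i => x i * y i := by
  obtain ⟨⟨C, hC⟩, hx⟩ := hx
  obtain ⟨⟨D, hD⟩, hy⟩ := hy
  refine ⟨⟨C * D, fun i => (norm_mul_le _ _).trans
    (mul_le_mul (hC i) (hD i) (norm_nonneg _) ((norm_nonneg _).trans (hC i)))⟩, ?_⟩
  -- With the discrete topology on the index set, any bounded family is an element of the Banach
  -- algebra of bounded continuous functions; its sup norm encodes uniformity.
  let : TopologicalSpace I := ⊥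
  have : DiscreteTopology I := ⟨rfl⟩
  let x' := BoundedContinuousFunction.ofNormedAddCommGroupDiscrete x C hC
  let y' := BoundedContinuousFunction.ofNormedAddCommGroupDiscrete y D hD
  exact decay_of_smoothCurve_phaseConj (x' * y') (smoothCurve_phaseConj_mul x' y'
    (smoothCurve_phaseConj_of_decay x' hx) (smoothCurve_phaseConj_of_decay y' hy))

lemma OffDiagDecay.comp (hx : OffDiagDecay x) (g : J → I) : OffDiagDecay fun j => x (g j) :=
  ⟨hx.1.imp fun _ h j => h (g j), hx.2.comp g⟩

lemma OffDiagDecay.add (hx : OffDiagDecay x) (hy : OffDiagDecay y) :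
    OffDiagDecay fun i => x i + y i := by
  obtain ⟨⟨C, hC⟩, hx⟩ := hx
  obtain ⟨⟨D, hD⟩, hy⟩ := hy
  exact ⟨⟨C + D, fun i => norm_add_le_of_le (hC i) (hD i)⟩, hx.add one_le_offDiag hy⟩

lemma OffDiagDecay.star (hx : OffDiagDecay x) : OffDiagDecay fun i => star (x i) :=
  ⟨hx.1.imp fun _ h i => (norm_star (x i)).trans_le (h i), hx.2.star offDiag_comm⟩

/-- The entries of a bounded inverse of a family of matrices with off-diagonal decay have
off-diagonal decay. -/
lemma OffDiagDecay.of_mul_eq_one {n : ℕ} {x y : I → Matrix (Fin n) (Fin n) (Op ℕ)}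
    (hx : ∀ p q, OffDiagDecay fun i => x i p q)
    (hy : ∃ C : ℝ, ∀ i p q, ‖y i p q‖ ≤ C) (hxy : ∀ i, x i * y i = 1) (hyx : ∀ i, y i * x i = 1)
    (p q : Fin n) : OffDiagDecay fun i => y i p q := by
  obtain ⟨D, hD⟩ := hy
  refine ⟨⟨D, fun i => hD i p q⟩, ?_⟩
  choose C hC using fun p q => (hx p q).1
  let : TopologicalSpace I := ⊥
  have : DiscreteTopology I := ⟨rfl⟩
  let M : Matrix (Fin n) (Fin n) (BoundedContinuousFunction I (Op ℕ)) := fun p q =>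
    BoundedContinuousFunction.ofNormedAddCommGroupDiscrete (fun i => x i p q) (C p q) (hC p q)
  let N : Matrix (Fin n) (Fin n) (BoundedContinuousFunction I (Op ℕ)) := fun p q =>
    BoundedContinuousFunction.ofNormedAddCommGroupDiscrete (fun i => y i p q) D fun i => hD i p q
  have ev : ∀ (A B : Matrix (Fin n) (Fin n) (BoundedContinuousFunction I (Op ℕ))),
      (∀ i, A.map (fun f => f i) * B.map (fun f => f i) = 1) → A * B = 1 := fun A B h => by
    refine Matrix.ext fun p q => BoundedContinuousFunction.ext fun i => ?_
    have := congrFun (congrFun (h i) p) q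
    rw [Matrix.mul_apply] at this ⊢
    rw [BoundedContinuousFunction.sum_apply]
    refine Eq.trans this ?_
    rw [Matrix.one_apply, Matrix.one_apply]
    split_ifs <;> rfl
  exact decay_of_smoothCurve_phaseConj (N p q) (smoothCurve_phaseConj_entry M N
    (fun p q => smoothCurve_phaseConj_of_decay (M p q) (hx p q).2) (ev M N hxy) (ev N M hyx) p q)

end Families

/-! ## Operators that are asymptotically invariant under a translation -/

section Compress

/-- The compression `U*^l a U^l`. -/
def compress (l : ℕ) (a : Op ℕ) : Op ℕ := star (U ^ l) * a * U ^ l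

/-- The defect `U*^l a U^l - a` of the invariance of `a` under the translation by `l`. -/
def defect (l : ℕ) (a : Op ℕ) : Op ℕ := compress l a - a

/-- The projection onto the span of the first `l` basis vectors. -/
def initProj (l : ℕ) : Op ℕ := 1 - U ^ l * star (U ^ l)

lemma coeff_compress (l : ℕ) (a : Op ℕ) (k s : ℕ) :
    coeff (compress l a) k s = coeff a (k + l) (s + l) := by
  rw [compress, coeff_mul_U_pow, coeff_star_U_pow_mul]

lemma coeff_defect (l : ℕ) (a : Op ℕ) (k s : ℕ) :
    coeff (defect l a) k s = coeff a (k + l) (s + l) - coeff a k s := by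
  rw [defect, coeff_sub, coeff_compress]

lemma compress_one (l : ℕ) : compress l 1 = 1 := by
  rw [compress, mul_one, star_U_pow_mul_self]

/-- Insert `1 = U^l U*^l + initProj l` between the two factors. The error term factors through a
finite-rank projection. -/
lemma compress_mul (l : ℕ) (a b : Op ℕ) :
    compress l (a * b) = compress l a * compress l b +
      star (U ^ l) * a * initProj l * (b * U ^ l) := by
  simp only [compress, initProj, mul_sub, sub_mul, mul_one, mul_assoc]
  abel

lemma defect_add (l : ℕ) (a b : Op ℕ) : defect l (a + b) = defect l a + defect l b := by
  refine op_ext fun k s => ?_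
  simp only [coeff_defect, coeff_add]
  ring

lemma defect_smul_one (l : ℕ) (z : ℂ) : defect l (z • 1) = 0 := by
  refine op_ext fun k s => ?_
  simp [coeff_defect, coeff_smul, coeff_one, coeff_zero]

lemma defect_star (l : ℕ) (a : Op ℕ) : defect l (star a) = star (defect l a) := by
  refine op_ext fun k s => ?_
  simp [coeff_defect, coeff_star]

lemma defect_mul (l : ℕ) (a b : Op ℕ) :
    defect l (a * b) = defect l a * compress l b + a * defect l b +
      star (U ^ l) * a * initProj l * (b * U ^ l) := by
  rw [defect, compress_mul, defect, defect, sub_mul, mul_sub]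
  abel

/-- The cocycle rule for translations; by induction it bounds the defect for every multiple of `l`.
-/
lemma defect_add_index (l m : ℕ) (a : Op ℕ) :
    defect (l + m) a = compress m (defect l a) + defect m a := by
  refine op_ext fun k s => ?_
  simp only [coeff_defect, coeff_add, coeff_compress]
  rw [add_right_comm k, add_right_comm s, ← add_assoc, ← add_assoc]
  ring_nf

/-- The defect as a continuous linear map. -/
def defectL (l : ℕ) : Op ℕ →L[ℂ] Op ℕ :=
  ContinuousLinearMap.mulLeftRight ℂ (Op ℕ) (star (U ^ l)) (U ^ l) - ContinuousLinearMap.id ℂ _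

lemma defectL_apply (l : ℕ) (a : Op ℕ) : defectL l a = defect l a := by
  simp [defectL, defect, compress]

variable {I J : Type*} {l : ℕ}

lemma offDiagDecay_const_of_coeff {a : Op ℕ}
    (h : ∀ N : ℕ, ∃ C : ℝ, ∀ k s, offDiag k s ^ N * ‖coeff a k s‖ ≤ C) :
    OffDiagDecay fun _ : I => a :=
  ⟨⟨‖a‖, fun _ => le_rfl⟩, fun N => (h N).imp fun _ hC _ => hC⟩

lemma offDiagDecay_U_pow (l : ℕ) : OffDiagDecay fun _ : I => U ^ l :=
  offDiagDecay_const_of_coeff fun N => ⟨(1 + (l : ℝ)) ^ N, fun k s => by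
    rw [coeff_U_pow]
    split_ifs with h
    · subst h
      simp [offDiag]
    · simp only [norm_zero, mul_zero]
      positivity⟩

lemma offDiagDecay_star_U_pow (l : ℕ) : OffDiagDecay fun _ : I => star (U ^ l) :=
  (offDiagDecay_U_pow l).star

lemma decay_initProj (l : ℕ) : Decay radial fun _ : I => initProj l := fun N =>
  ⟨(1 + (l : ℝ) + l) ^ N, fun _ k s => by
    rw [initProj, coeff_one_sub_U_pow_mul_star]
    split_ifs with h
    · obtain ⟨rfl, h⟩ := h
      have : (k : ℝ) ≤ l := by exact_mod_cast h.le
      rw [norm_one, mul_one, radial]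
      gcongr
    · simp only [norm_zero, mul_zero]
      positivity⟩

lemma OffDiagDecay.compress {x : I → Op ℕ} (hx : OffDiagDecay x) (l : ℕ) :
    OffDiagDecay fun i => compress l (x i) :=
  ((offDiagDecay_star_U_pow l).mul hx).mul (offDiagDecay_U_pow l)

lemma Decay.compress {x : I → Op ℕ} (hx : Decay radial x) (l : ℕ) :
    Decay radial fun i => QuantumOdometer.compress l (x i) :=
  ((offDiagDecay_star_U_pow l).2.mul_radial hx).radial_mul (offDiagDecay_U_pow l).2

/-- The projection in the middle has finite rank, hence radial decay, which the outer factors with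
off-diagonal decay preserve. -/
lemma decay_corner {x y : I → Op ℕ} (hx : OffDiagDecay x) (hy : OffDiagDecay y) (l : ℕ) :
    Decay radial fun i => star (U ^ l) * x i * initProj l * (y i * U ^ l) :=
  (((offDiagDecay_star_U_pow l).mul hx).2.mul_radial (decay_initProj l)).radial_mul
    (hy.mul (offDiagDecay_U_pow l)).2

/-- A family with off-diagonal decay which is, up to rapidly decaying coefficients, invariant under
the translation by `l`. -/
def SmoothMod (l : ℕ) (x : I → Op ℕ) : Prop :=
  OffDiagDecay x ∧ Decay radial fun i => defect l (x i)

variable {x y : I → Op ℕ}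

lemma SmoothMod.comp (hx : SmoothMod l x) (g : J → I) : SmoothMod l fun j => x (g j) :=
  ⟨hx.1.comp g, hx.2.comp g⟩

lemma SmoothMod.add (hx : SmoothMod l x) (hy : SmoothMod l y) : SmoothMod l fun i => x i + y i :=
  ⟨hx.1.add hy.1, by simpa only [defect_add] using hx.2.add one_le_radial hy.2⟩

lemma SmoothMod.star (hx : SmoothMod l x) : SmoothMod l fun i => star (x i) :=
  ⟨hx.1.star, by simpa only [defect_star] using hx.2.star radial_comm⟩

lemma SmoothMod.mul (hx : SmoothMod l x) (hy : SmoothMod l y) :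
    SmoothMod l fun i => x i * y i := by
  refine ⟨hx.1.mul hy.1, ?_⟩
  simp only [defect_mul]
  exact ((hx.2.radial_mul (hy.1.compress l).2).add one_le_radial (hx.1.2.mul_radial hy.2)).add
    one_le_radial (decay_corner hx.1 hy.1 l)

lemma SmoothMod.smul_one {z : I → ℂ} (hz : ∃ C : ℝ, ∀ i, ‖z i‖ ≤ C) (l : ℕ) :
    SmoothMod l fun i => z i • (1 : Op ℕ) := by
  obtain ⟨C, hC⟩ := hz
  refine ⟨⟨⟨C, fun i => ?_⟩, fun N => ⟨C, fun i k s => ?_⟩⟩, ?_⟩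
  · rw [norm_smul]
    have := hC i
    have h1 : ‖(1 : Op ℕ)‖ ≤ 1 := ContinuousLinearMap.norm_id_le
    nlinarith [norm_nonneg (z i)]
  · rw [coeff_smul, coeff_one]
    split_ifs with h
    · simpa [h, offDiag] using hC i
    · simpa using (norm_nonneg _).trans (hC i)
  · simpa only [defect_smul_one] using Decay.zero

lemma SmoothMod.smul {z : I → ℂ} (hz : ∃ C : ℝ, ∀ i, ‖z i‖ ≤ C) (hx : SmoothMod l x) :
    SmoothMod l fun i => z i • x i := by
  simpa using (SmoothMod.smul_one hz l).mul hx

/-- This allows operators with different moduli to be compared at a common multiple, so that the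
union over `l ∣ S` is an algebra. -/
lemma SmoothMod.of_dvd {m : ℕ} (hx : SmoothMod l x) (h : l ∣ m) : SmoothMod m x := by
  refine ⟨hx.1, ?_⟩
  obtain ⟨c, rfl⟩ := h
  induction c with
  | zero =>
    have : ∀ a, defect (l * 0) a = 0 := fun a => by simp [defect, QuantumOdometer.compress]
    simpa only [this] using Decay.zero
  | succ c ih =>
    simp only [mul_add, mul_one, defect_add_index (l * c) l]
    exact (ih.compress l).add one_le_radial hx.2

lemma Dominated.map {x : I → Op ℕ} {y : J → Op ℕ} (h : Dominated x y) (L : Op ℕ →L[ℂ] Op ℕ) :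
    Dominated (fun i => L (x i)) fun j => L (y j) := by
  obtain ⟨K, hK⟩ := h
  exact ⟨K, fun Λ C hC j => hK (Λ ∘L L) C hC j⟩

lemma SmoothMod.of_dominated (hx : SmoothMod l x) {y : J → Op ℕ} (h : Dominated x y) :
    SmoothMod l y := by
  refine ⟨⟨?_, hx.1.2.of_dominated one_le_offDiag h⟩, ?_⟩
  · obtain ⟨C, hC⟩ := hx.1.1
    obtain ⟨K, hK⟩ := h
    refine ⟨K * C, fun j => ?_⟩
    -- A functional of norm at most `1` attaining `‖y j‖` turns domination into a norm bound.
    obtain ⟨g, hg, hgy⟩ := exists_dual_vector'' ℂ (y j)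
    have h1 := hK g C (fun i => (g.le_opNorm _).trans
      ((mul_le_of_le_one_left (norm_nonneg _) hg).trans (hC i))) j
    rw [hgy] at h1
    simpa using h1
  · have := hx.2.of_dominated one_le_radial (y := fun j => defect l (y j))
      (by simpa only [defectL_apply] using h.map (defectL l))
    exact this

/-- The entries of a bounded inverse of a family of matrices, whose entries are smooth and
asymptotically invariant under the translation by `l`, have the same property. -/
theorem SmoothMod.of_mul_eq_one {n : ℕ} {x y : I → Matrix (Fin n) (Fin n) (Op ℕ)}
    (hx : ∀ p q, SmoothMod l fun i => x i p q) (hy : ∃ C : ℝ, ∀ i p q, ‖y i p q‖ ≤ C)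
    (hxy : ∀ i, x i * y i = 1) (hyx : ∀ i, y i * x i = 1) (p q : Fin n) :
    SmoothMod l fun i => y i p q := by
  have hy' := OffDiagDecay.of_mul_eq_one (fun p q => (hx p q).1) hy hxy hyx
  refine ⟨hy' p q, ?_⟩
  let c : Op ℕ → Op ℕ := QuantumOdometer.compress l
  -- The total corner error in the compression of the matrix product `y x = 1`.
  let T : I → Matrix (Fin n) (Fin n) (Op ℕ) := fun i p q =>
    ∑ r, Star.star (U ^ l) * y i p r * initProj l * (x i r q * U ^ l)
  have hT : ∀ i, (y i).map c * (x i).map c + T i = 1 := fun i => by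
    have hsum : ∀ f : Fin n → Op ℕ, c (∑ r, f r) = ∑ r, c (f r) := fun f => by
      simp only [c, QuantumOdometer.compress, Finset.mul_sum, Finset.sum_mul]
    refine Matrix.ext fun p q => ?_
    have h1 : c ((y i * x i) p q) = (1 : Matrix (Fin n) (Fin n) (Op ℕ)) p q := by
      rw [hyx, Matrix.one_apply]
      split_ifs
      · exact compress_one l
      · simp [c, QuantumOdometer.compress]
    rw [← h1, Matrix.mul_apply, hsum, Matrix.add_apply, Matrix.mul_apply, ← Finset.sum_add_distrib]
    exact Finset.sum_congr rfl fun r _ => (compress_mul l _ _).symm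
  -- Multiply `c(y) c(x) = 1 - T` on the right by `y` and use `xy = 1`: this is the resolvent-type
  -- identity `c(y) - y = -Ty - c(y)(c(x) - x)y`. Each term on the right contains a radially
  -- decaying factor.
  have key : ∀ i, (y i).map (defect l) =
      -(T i * y i) - (y i).map c * (x i).map (defect l) * y i := fun i => by
    have e1 : (y i).map (defect l) = (y i).map c - y i := rfl
    have e2 : (x i).map (defect l) = (x i).map c - x i := rfl
    have e3 : (y i).map c * (x i).map c = 1 - T i := eq_sub_of_add_eq (hT i)
    rw [e1, e2, mul_sub, e3, sub_mul, sub_mul, one_mul, mul_assoc, hxy, mul_one]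
    abel
  have hd : ∀ i, defect l (y i p q) =
      -(∑ r, T i p r * y i r q) -
        ∑ r, (∑ r', c (y i p r') * defect l (x i r' r)) * y i r q := fun i => by
    have := congrFun (congrFun (key i) p) q
    rw [Matrix.sub_apply, Matrix.neg_apply, Matrix.mul_apply, Matrix.mul_apply] at this
    exact this
  simp only [hd]
  refine Decay.sub one_le_radial (Decay.neg ?_) ?_
  · exact Decay.sum one_le_radial _ fun r _ => (Decay.sum one_le_radial _ fun r' _ =>
      decay_corner (hy' p r') (hx r' r).1 l).radial_mul (hy' r q).2
  · exact Decay.sum one_le_radial _ fun r _ => (Decay.sum one_le_radial _ fun r' _ =>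
      ((hy' p r').compress l).2.mul_radial (hx r' r).2).radial_mul (hy' r q).2

end Compress

/-! ## Finite quotients of the odometer -/

section Quotients

/-- The projection of `ℤ / p ^ ε ℤ` onto `ℤ / p ^ v ℤ`, `v ≤ ε`. -/
def localProj (p : Nat.Primes) : (e : ℕ∞) → (v : ℕ) → (v : ℕ∞) ≤ e →
    LocalFactor p e →+* ZMod ((p : ℕ) ^ v)
  | none, v, _ => (PadicInt.toZModPow v : ℤ_[p] →+* ZMod ((p : ℕ) ^ v))
  | some _, _, h => ZMod.castHom (pow_dvd_pow _ (WithTop.coe_le_coe.mp h)) _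

/-- The map is locally constant: its kernel is the closed ball of radius `p^(-v)`. -/
lemma continuous_toZModPow (p : ℕ) [Fact p.Prime] (v : ℕ) :
    Continuous (PadicInt.toZModPow v : ℤ_[p] →+* ZMod (p ^ v)) := by
  refine IsLocallyConstant.continuous ((IsLocallyConstant.iff_eventually_eq _).mpr fun x => ?_)
  have hp : (0 : ℝ) < (p : ℝ) ^ (-v : ℤ) := by
    have : (0 : ℝ) < p := by exact_mod_cast (Fact.out : p.Prime).pos
    positivity
  filter_upwards [Metric.ball_mem_nhds x hp] with y hy
  rw [← sub_eq_zero, ← map_sub, ← RingHom.mem_ker, PadicInt.ker_toZModPow,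
    ← PadicInt.norm_le_pow_iff_mem_span_pow, ← dist_eq_norm]
  exact (Metric.mem_ball.mp hy).le

lemma continuous_localProj (p : Nat.Primes) : ∀ (e : ℕ∞) (v : ℕ) (h : (v : ℕ∞) ≤ e),
    Continuous (localProj p e v h)
  | none, v, _ => continuous_toZModPow p v
  | some k, v, h => by
    exact (continuous_of_discreteTopology : Continuous
      (ZMod.castHom (pow_dvd_pow _ (WithTop.coe_le_coe.mp h)) _ :
        ZMod ((p : ℕ) ^ k) →+* ZMod ((p : ℕ) ^ v)))

lemma exists_localProj_ne (p : Nat.Primes) : ∀ (e : ℕ∞) (x y : LocalFactor p e), x ≠ y →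
    ∃ (v : ℕ) (h : (v : ℕ∞) ≤ e), localProj p e v h x ≠ localProj p e v h y
  | none, x, y, hxy => by
    by_contra! H
    exact hxy (PadicInt.ext_of_toZModPow.mp fun v => H v le_top)
  | some k, x, y, hxy => by
    refine ⟨k, le_rfl, fun H => hxy ?_⟩
    have e : ∀ z : ZMod ((p : ℕ) ^ k), ZMod.castHom (dvd_refl _) (ZMod ((p : ℕ) ^ k)) z = z :=
      fun z => by simp
    exact (e x).symm.trans (H.trans (e y))

variable {S : Supernatural} {l : ℕ}

lemma Divides.lcm {m : ℕ} (hl : Divides l S) (hm : Divides m S) : Divides (l.lcm m) S := by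
  refine ⟨Nat.lcm_ne_zero hl.1 hm.1, fun p => ?_⟩
  rw [Nat.factorization_lcm hl.1 hm.1, Finsupp.sup_apply]
  rcases le_total (l.factorization p) (m.factorization p) with h | h
  · rw [sup_of_le_right h]; exact hm.2 p
  · rw [sup_of_le_left h]; exact hl.2 p

lemma divides_one (S : Supernatural) : Divides 1 S := ⟨one_ne_zero, fun p => by simp⟩

lemma divides_prime_pow (p : Nat.Primes) (v : ℕ) (h : (v : ℕ∞) ≤ S p) :
    Divides ((p : ℕ) ^ v) S := by
  refine ⟨pow_ne_zero _ p.2.ne_zero, fun q => ?_⟩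
  rw [p.2.factorization_pow, Finsupp.single_apply]
  split_ifs with hpq
  · rw [← Subtype.ext hpq]; exact h
  · simp

/-- The projection of the odometer `ℤ / S ℤ` onto `ℤ / l ℤ`, `l ∣ S`. -/
def odometerProj (h : Divides l S) : Odometer S →+* ZMod l :=
  ((ZMod.equivPi l h.1).symm : _ →+* ZMod l).comp
    (RingHom.pi fun p : l.primeFactors =>
      (localProj ⟨p, Nat.prime_of_mem_primeFactors p.2⟩ _ (l.factorization p) (h.2 _)).comp
        (Pi.evalRingHom (fun p : Nat.Primes => LocalFactor p (S p)) _))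

lemma continuous_odometerProj (h : Divides l S) : Continuous (odometerProj h) := by
  have h1 : Continuous (ZMod.equivPi l h.1).symm := continuous_of_discreteTopology
  exact h1.comp (continuous_pi fun p => (continuous_localProj _ _ _ _).comp (continuous_apply _))

/-- The continuous function on the odometer that is given by an `l`-periodic function. -/
def periodicFun (h : Divides l S) (g : ZMod l → ℂ) : C(Odometer S, ℂ) :=
  ⟨fun x => g (odometerProj h x), continuous_of_discreteTopology.comp (continuous_odometerProj h)⟩

lemma periodicFun_apply (h : Divides l S) (g : ZMod l → ℂ) (x : Odometer S) :
    periodicFun h g x = g (odometerProj h x) := rfl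

lemma periodicFun_intCast (h : Divides l S) (g : ZMod l → ℂ) (n : ℤ) :
    periodicFun h g (n : Odometer S) = g n := by
  rw [periodicFun_apply, map_intCast]

lemma periodicFun_add (h : Divides l S) (g : ZMod l → ℂ) (x : Odometer S) :
    periodicFun h g (x + (l : Odometer S)) = periodicFun h g x := by
  rw [periodicFun_apply, map_add, map_natCast, ZMod.natCast_self, add_zero]
  rfl

end Quotients

/-! ## The coefficients of the smooth Bunce-Deddens-Toeplitz algebra -/

section Identification

variable {S : Supernatural} {l : ℕ}

lemma norm_coordOp_le {ι κ : Type} (σ : ι → Option κ)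
    (hσ : ∀ i i' j, σ i = some j → σ i' = some j → i = i')
    (w : ι → ℂ) (C : ℝ) (hC : 0 ≤ C) (hw : ∀ i, ‖w i‖ ≤ C) : ‖coordOp σ hσ w C hC hw‖ ≤ C :=
  LinearMap.mkContinuous_norm_le _ hC _

lemma norm_shiftPow_le (n : ℤ) : ‖shiftPow n‖ ≤ 1 := norm_coordOp_le _ _ _ _ _ _

lemma norm_mulZ_le (f : C(Odometer S, ℂ)) : ‖mulZ f‖ ≤ ‖f‖ := norm_coordOp_le _ _ _ _ _ _

lemma norm_matrixUnit (p q : ℕ) : ‖matrixUnit p q‖ = 1 := by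
  rw [matrixUnit, InnerProductSpace.norm_rankOne, norm_E, norm_E, one_mul]

/-- The matrix coefficients of a series `∑ V ^ n m_{f_n}`. -/
lemma coeff_of_hasSum_shiftPow_mul {f : ℤ → C(Odometer S, ℂ)} {b : Op ℤ}
    (h : HasSum (fun n : ℤ => shiftPow n * mulZ (f n)) b) (k s : ℤ) :
    coeff b k s = f (k - s) (s : Odometer S) := by
  refine (hasSum_coeff h k s).unique ?_
  have e : ∀ n : ℤ, coeff (shiftPow n * mulZ (f n)) k s =
      if n = k - s then f (k - s) (s : Odometer S) else 0 := fun n => by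
    rw [coeff_shiftPow_mul, coeff_mulZ]
    by_cases hn : n = k - s
    · subst hn; simp
    · rw [if_neg hn, if_neg (by omega)]
  simp only [e]
  exact hasSum_ite_eq _ _

lemma smoothMod_of_decay {I : Type*} {x : I → Op ℕ} (hb : ∃ C : ℝ, ∀ i, ‖x i‖ ≤ C)
    (hx : Decay radial x) (l : ℕ) : SmoothMod l x :=
  ⟨⟨hb, hx.offDiag_of_radial⟩, (hx.compress l).sub one_le_radial hx⟩

lemma decay_of_mem_smoothCompact {c : Op ℕ} (hc : c ∈ smoothCompact) :
    Decay radial fun _ : Unit => c := fun N => by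
  obtain ⟨m, hm, hs⟩ := hc
  refine (hm N).imp fun C hC _ k s => ?_
  have e : coeff c k s = m k s := by
    refine (hasSum_coeff hs k s).unique ?_
    have e : ∀ q : ℕ × ℕ, coeff (m q.1 q.2 • matrixUnit q.1 q.2) k s =
        if q = (k, s) then m k s else 0 := fun q => by
      rw [coeff_smul, coeff_matrixUnit]
      by_cases hq : q = (k, s)
      · subst hq; simp
      · rw [if_neg hq, if_neg, mul_zero]
        rintro ⟨rfl, rfl⟩
        exact hq rfl
    simp only [e]
    exact hasSum_ite_eq _ _
  rw [e]
  exact hC k s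

lemma summable_inv_sq_mul_inv_sq :
    Summable fun q : ℕ × ℕ => ((1 + (q.1 : ℝ)) ^ 2)⁻¹ * ((1 + (q.2 : ℝ)) ^ 2)⁻¹ :=
  summable_one_add_nat.mul_of_nonneg summable_one_add_nat (fun _ => by positivity)
    fun _ => by positivity

/-- Decay of order four dominates the coefficients by a product of two summable inverse squares, so
the series of matrix units converges absolutely; its sum has the right coefficients. -/
lemma mem_smoothCompact_of_decay {c : Op ℕ} (hc : Decay radial fun _ : Unit => c) :
    c ∈ smoothCompact := by
  refine ⟨coeff c, fun N => (hc N).imp fun C hC k s => hC () k s, ?_⟩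
  have hsum : Summable fun q : ℕ × ℕ => coeff c q.1 q.2 • matrixUnit q.1 q.2 := by
    obtain ⟨C, hC⟩ := hc 4
    refine Summable.of_norm_bounded (summable_inv_sq_mul_inv_sq.mul_left C) fun q => ?_
    rw [norm_smul, norm_matrixUnit, mul_one, ← mul_inv, ← div_eq_mul_inv,
      le_div_iff₀ (by positivity), mul_comm]
    refine le_trans ?_ (hC () q.1 q.2)
    have h1 : 1 + (q.1 : ℝ) ≤ radial q.1 q.2 := by
      rw [radial]; linarith [(q.2.cast_nonneg : (0 : ℝ) ≤ q.2)]
    have h2 : 1 + (q.2 : ℝ) ≤ radial q.1 q.2 := by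
      rw [radial]; linarith [(q.1.cast_nonneg : (0 : ℝ) ≤ q.1)]
    have h0 := zero_le_one.trans (one_le_radial q.1 q.2)
    calc _ ≤ (radial q.1 q.2 ^ 2 * radial q.1 q.2 ^ 2) * ‖coeff c q.1 q.2‖ := by gcongr
      _ = _ := by ring
  have hs := hsum.hasSum
  convert hs using 1
  refine op_ext fun k s => (hasSum_coeff hs k s).unique ?_ |>.symm
  have e : ∀ q : ℕ × ℕ, coeff (coeff c q.1 q.2 • matrixUnit q.1 q.2) k s =
      if q = (k, s) then coeff c k s else 0 := fun q => by
    rw [coeff_smul, coeff_matrixUnit]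
    by_cases hq : q = (k, s)
    · subst hq; simp
    · rw [if_neg hq, if_neg, mul_zero]
      rintro ⟨rfl, rfl⟩
      exact hq rfl
  simp only [e]
  exact hasSum_ite_eq _ _

/-- The coefficient at `(k, s)` is `f_{k-s}(s)`. Translating both indices by `l` keeps `k - s` and,
by periodicity, the value, so the defect vanishes exactly. -/
lemma smoothMod_toeplitz {b : Op ℤ} (hb : b ∈ smoothBDStep S l) :
    SmoothMod l fun _ : Unit => toeplitz b := by
  obtain ⟨-, f, hf, hper, hs⟩ := hb
  have hc : ∀ k s : ℕ, coeff (toeplitz b) k s = f ((k : ℤ) - s) ((s : ℤ) : Odometer S) :=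
    fun k s => by rw [coeff_toeplitz, coeff_of_hasSum_shiftPow_mul hs]
  refine ⟨offDiagDecay_const_of_coeff fun N => (hf N).imp fun C hC k s => ?_, ?_⟩
  · rw [hc]
    refine le_trans ?_ (hC ((k : ℤ) - s))
    have : offDiag k s = 1 + |(((k : ℤ) - s : ℤ) : ℝ)| := by rw [offDiag]; push_cast; rfl
    rw [this]
    gcongr
    exact (f _).norm_coe_le_norm _
  · have : defect l (toeplitz b) = 0 := op_ext fun k s => by
      rw [coeff_defect, hc, hc, coeff_zero, sub_eq_zero]
      push_cast
      rw [add_sub_add_right_eq_sub, hper]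
    simpa only [this] using Decay.zero

/-- The limit of the coefficients `a_{k + jl, s + jl}` for `j → ∞`. -/
lemma exists_limit_coeff {a : Op ℕ} (hl : l ≠ 0) (ha : SmoothMod l fun _ : Unit => a) :
    ∃ g : ℕ → ℕ → ℂ, (∀ k s, g (k + l) (s + l) = g k s) ∧
      (∀ N : ℕ, ∃ C : ℝ, ∀ k s, offDiag k s ^ N * ‖g k s‖ ≤ C) ∧
      ∀ N : ℕ, ∃ C : ℝ, ∀ k s, radial k s ^ N * ‖coeff a k s - g k s‖ ≤ C := by
  -- The increments of `j ↦ a_{k+lj, s+lj}`. Since `l ≠ 0`, the radial weight at these positions is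
  -- at least `1 + j`, so two surplus powers of decay make the increments summable in `j`, with
  -- rapid decay in `(k, s)`.
  let d : ℕ → ℕ → ℕ → ℂ := fun k s j => coeff (defect l a) (k + l * j) (s + l * j)
  have hd : ∀ k s j, d k s j =
      coeff a (k + l * (j + 1)) (s + l * (j + 1)) - coeff a (k + l * j) (s + l * j) :=
    fun k s j => by simp only [d, coeff_defect, mul_add, mul_one, add_assoc]
  have hdn : ∀ N : ℕ, ∃ C : ℝ, ∀ k s j, radial k s ^ N * ‖d k s j‖ ≤ C * ((1 + (j : ℝ)) ^ 2)⁻¹ :=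
    fun N => by
    obtain ⟨C, hC⟩ := ha.2 (N + 2)
    refine ⟨C, fun k s j => ?_⟩
    rw [← div_eq_mul_inv, le_div_iff₀ (by positivity)]
    refine le_trans ?_ (hC () (k + l * j) (s + l * j))
    have hj : (j : ℝ) ≤ l * j := by
      exact_mod_cast Nat.le_mul_of_pos_left j (Nat.pos_of_ne_zero hl)
    have h1 : 1 + (j : ℝ) ≤ radial (k + l * j) (s + l * j) := by
      rw [radial]; push_cast
      linarith [(k.cast_nonneg : (0 : ℝ) ≤ k), (s.cast_nonneg : (0 : ℝ) ≤ s),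
        (j.cast_nonneg : (0 : ℝ) ≤ j)]
    have h2 : radial k s ≤ radial (k + l * j) (s + l * j) := by
      rw [radial, radial]; push_cast
      linarith [(j.cast_nonneg : (0 : ℝ) ≤ j)]
    have h0 := zero_le_one.trans (one_le_radial k s)
    have h3 := h0.trans h2
    calc _ ≤ radial (k + l * j) (s + l * j) ^ N * ‖d k s j‖ *
          radial (k + l * j) (s + l * j) ^ 2 := by gcongr
      _ = _ := by ring
  have hsum : ∀ k s, Summable (d k s) := fun k s => by
    obtain ⟨C, hC⟩ := hdn 0
    exact Summable.of_norm_bounded (summable_one_add_nat.mul_left C)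
      fun j => by simpa using hC k s j
  let g : ℕ → ℕ → ℂ := fun k s => coeff a k s + ∑' j, d k s j
  have hlim : ∀ k s, Filter.Tendsto (fun j => coeff a (k + l * j) (s + l * j)) Filter.atTop
      (nhds (g k s)) := fun k s => by
    have h1 := ((hsum k s).hasSum.tendsto_sum_nat).const_add (coeff a k s)
    refine h1.congr fun j => ?_
    induction j with
    | zero => simp
    | succ j ih => rw [Finset.sum_range_succ, ← add_assoc, ih, hd]; ring
  refine ⟨g, fun k s => ?_, fun N => ?_, fun N => ?_⟩
  · refine tendsto_nhds_unique (hlim (k + l) (s + l)) ?_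
    refine ((hlim k s).comp (Filter.tendsto_add_atTop_nat 1)).congr fun j => ?_
    have e : ∀ k, k + l * (j + 1) = k + l + l * j := fun k => by ring
    simp only [Function.comp_apply, e]
  · obtain ⟨C, hC⟩ := ha.1.2 N
    refine ⟨C, fun k s => le_of_tendsto (((hlim k s).norm).const_mul _)
      (Filter.Eventually.of_forall fun j => ?_)⟩
    refine le_trans (le_of_eq ?_) (hC () (k + l * j) (s + l * j))
    congr 2
    rw [offDiag, offDiag]
    push_cast
    rw [add_sub_add_right_eq_sub]
  · obtain ⟨C, hC⟩ := hdn N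
    refine ⟨∑' j : ℕ, C * ((1 + (j : ℝ)) ^ 2)⁻¹, fun k s => ?_⟩
    have h0 : 0 ≤ radial k s ^ N := pow_nonneg (zero_le_one.trans (one_le_radial k s)) N
    have e : radial k s ^ N * ‖coeff a k s - g k s‖ =
        ‖∑' j, ((radial k s ^ N : ℝ) : ℂ) * d k s j‖ := by
      rw [tsum_mul_left, norm_mul, Complex.norm_real, Real.norm_of_nonneg h0]
      simp only [g, sub_add_cancel_left, norm_neg]
    rw [e]
    refine tsum_of_norm_bounded (summable_one_add_nat.mul_left C).hasSum fun j => ?_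
    rw [norm_mul, Complex.norm_real, Real.norm_of_nonneg h0]
    exact hC k s j

lemma shiftPow_mem (n : ℤ) : shiftPow n ∈ BunceDeddens S := by
  have hV : V ∈ BunceDeddens S :=
    StarSubalgebra.le_topologicalClosure _ (StarAlgebra.subset_adjoin ℂ _ (by simp))
  have hV' : shiftPow (-1) ∈ BunceDeddens S := by
    have : shiftPow (-1) = star V := op_ext fun k s => by
      rw [coeff_star, ← mul_one (shiftPow _), coeff_shiftPow_mul, coeff_one, V,
        ← mul_one (shiftPow 1), coeff_shiftPow_mul, coeff_one]
      by_cases h : k = s - 1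
      · rw [if_pos (by omega), if_pos (by omega), star_one]
      · rw [if_neg (by omega), if_neg (by omega), star_zero]
    rw [this]
    exact star_mem hV
  induction n using Int.induction_on with
  | zero => rw [shiftPow_zero]; exact one_mem _
  | succ n ih => rw [shiftPow_add]; exact mul_mem ih hV
  | pred n ih => rw [sub_eq_add_neg, shiftPow_add]; exact mul_mem ih hV'

lemma mulZ_mem (f : C(Odometer S, ℂ)) : mulZ f ∈ BunceDeddens S :=
  StarSubalgebra.le_topologicalClosure _
    (StarAlgebra.subset_adjoin ℂ _ (Set.mem_union_right _ ⟨f, rfl⟩))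

/-- The smooth Bunce-Deddens-Toeplitz algebra consists of the operators that are smooth and
asymptotically invariant under a translation by some `l ∣ S`. -/
theorem mem_smoothBDT_iff (a : Op ℕ) :
    a ∈ smoothBDT S ↔ ∃ l, Divides l S ∧ SmoothMod l fun _ : Unit => a := by
  constructor
  · rintro ⟨b, ⟨l, hl, hb⟩, c, hc, rfl⟩
    exact ⟨l, hl, (smoothMod_toeplitz hb).add
      (smoothMod_of_decay ⟨‖c‖, fun _ => le_rfl⟩ (decay_of_mem_smoothCompact hc) l)⟩
  · rintro ⟨l, hl, ha⟩
    obtain ⟨g, hgl, hgo, hgr⟩ := exists_limit_coeff hl.1 ha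
    have hgm : ∀ j k s, g (k + l * j) (s + l * j) = g k s := fun j => by
      induction j with
      | zero => simp
      | succ j ih =>
        intro k s
        rw [mul_add, mul_one, ← add_assoc, ← add_assoc, hgl, ih]
    have hge : ∀ k s k' s' : ℕ, s ≤ s' → (k : ℤ) - s = (k' : ℤ) - s' → (s : ZMod l) = s' →
        g k s = g k' s' := fun k s k' s' hs hk hz => by
      obtain ⟨j, hj⟩ := (Nat.modEq_iff_dvd' hs).mp ((ZMod.natCast_eq_natCast_iff s s' l).mp hz)
      have h1 : s' = s + l * j := by omega
      have h2 : k' = k + l * j := by omega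
      rw [h1, h2, hgm]
    have : NeZero l := ⟨hl.1⟩
    -- A column in the residue class `r` that is at least `|n|`, so that the row `s₀ + n` is not
    -- negative. The value of `g` at this position depends only on the diagonal `n` and the class
    -- `r`, by periodicity.
    let s₀ : ℤ → ZMod l → ℕ := fun n r => r.val + l * n.natAbs
    have hs₀ : ∀ n r, n.natAbs ≤ s₀ n r := fun n r =>
      (Nat.le_mul_of_pos_left _ (Nat.pos_of_ne_zero hl.1)).trans (Nat.le_add_left _ _)
    let φ : ℤ → ZMod l → ℂ := fun n r => g (s₀ n r + n).toNat (s₀ n r)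
    have hφ : ∀ k s : ℕ, φ ((k : ℤ) - s) (s : ZMod l) = g k s := fun k s => by
      have hz : ((s₀ ((k : ℤ) - s) (s : ZMod l) : ℕ) : ZMod l) = s := by simp [s₀]
      have hk : (((s₀ ((k : ℤ) - s) (s : ZMod l) + ((k : ℤ) - s)).toNat : ℕ) : ℤ) -
          (s₀ ((k : ℤ) - s) (s : ZMod l) : ℕ) = (k : ℤ) - s := by
        have := hs₀ ((k : ℤ) - s) (s : ZMod l)
        omega
      rcases le_total (s₀ ((k : ℤ) - s) (s : ZMod l)) s with h | h
      · exact hge _ _ _ _ h hk hz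
      · exact (hge _ _ _ _ h hk.symm hz.symm).symm
    -- The symbol `b` has these Fourier coefficients; by the choice of `φ`, `T(b)` has the limit
    -- matrix `g`, from which `a` differs by a radially decaying matrix.
    let f : ℤ → C(Odometer S, ℂ) := fun n => periodicFun hl (φ n)
    have hfn : ∀ N : ℕ, ∃ C : ℝ, ∀ n : ℤ, (1 + |(n : ℝ)|) ^ N * ‖f n‖ ≤ C := fun N => by
      obtain ⟨C, hC⟩ := hgo N
      refine ⟨max C 0, fun n => ?_⟩
      rw [← le_div_iff₀' (by positivity)]
      refine (ContinuousMap.norm_le _ (by positivity)).mpr fun x => ?_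
      rw [le_div_iff₀' (by positivity)]
      refine le_trans (le_of_eq ?_) ((hC (s₀ n (odometerProj hl x) + n).toNat
        (s₀ n (odometerProj hl x))).trans (le_max_left _ _))
      congr 2
      rw [offDiag]
      have h1 := hs₀ n (odometerProj hl x)
      have h2 : (((s₀ n (odometerProj hl x) + n).toNat : ℕ) : ℤ) -
        (s₀ n (odometerProj hl x) : ℕ) = n := by omega
      have h3 := congrArg (Int.cast : ℤ → ℝ) h2
      push_cast at h3
      rw [h3]
    have hsum : Summable fun n : ℤ => shiftPow n * mulZ (f n) := by
      obtain ⟨C, hC⟩ := hfn 2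
      refine Summable.of_norm_bounded (summable_one_add_int.mul_left C) fun n => ?_
      rw [← div_eq_mul_inv, le_div_iff₀ (by positivity), mul_comm]
      refine le_trans ?_ (hC n)
      gcongr
      refine (norm_mul_le _ _).trans ?_
      have h1 := norm_shiftPow_le n
      have h2 := norm_mulZ_le (f n)
      nlinarith [norm_nonneg (mulZ (f n)), norm_nonneg (shiftPow n)]
    have hb := hsum.hasSum
    refine ⟨_, ⟨l, hl, ?_, f, hfn, fun n x => periodicFun_add hl (φ n) x, hb⟩,
      a - toeplitz (∑' n : ℤ, shiftPow n * mulZ (f n)), ?_, (add_sub_cancel _ _).symm⟩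
    · exact (StarSubalgebra.isClosed_topologicalClosure _).mem_of_tendsto hb
        (Filter.Eventually.of_forall fun t =>
          sum_mem fun n _ => mul_mem (shiftPow_mem n) (mulZ_mem (f n)))
    · refine mem_smoothCompact_of_decay fun N => (hgr N).imp fun C hC _ k s => ?_
      rw [coeff_sub, coeff_toeplitz, coeff_of_hasSum_shiftPow_mul hb]
      have : f ((k : ℤ) - s) ((s : ℤ) : Odometer S) = g k s := by
        refine (periodicFun_intCast hl _ _).trans ?_
        rw [Int.cast_natCast, hφ]
      rw [this]
      exact hC k s

end Identification

/-! ## The smooth Bunce-Deddens-Toeplitz algebra as a dense subalgebra -/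

section Subalgebra

/-- The smooth Bunce-Deddens-Toeplitz algebra as a star subalgebra. -/
def smoothAlg (S : Supernatural) : StarSubalgebra ℂ (Op ℕ) where
  carrier := smoothBDT S
  mul_mem' {a b} ha hb := by
    rw [mem_smoothBDT_iff] at *
    obtain ⟨l, hl, ha⟩ := ha
    obtain ⟨m, hm, hb⟩ := hb
    exact ⟨l.lcm m, hl.lcm hm,
      (ha.of_dvd (Nat.dvd_lcm_left l m)).mul (hb.of_dvd (Nat.dvd_lcm_right l m))⟩
  add_mem' {a b} ha hb := by
    rw [mem_smoothBDT_iff] at *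
    obtain ⟨l, hl, ha⟩ := ha
    obtain ⟨m, hm, hb⟩ := hb
    exact ⟨l.lcm m, hl.lcm hm,
      (ha.of_dvd (Nat.dvd_lcm_left l m)).add (hb.of_dvd (Nat.dvd_lcm_right l m))⟩
  algebraMap_mem' z := by
    rw [mem_smoothBDT_iff, Algebra.algebraMap_eq_smul_one]
    exact ⟨1, divides_one S, SmoothMod.smul_one (z := fun _ => z) ⟨‖z‖, fun _ => le_rfl⟩ 1⟩
  star_mem' {a} ha := by
    rw [mem_smoothBDT_iff] at *
    obtain ⟨l, hl, ha⟩ := ha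
    exact ⟨l, hl, ha.star⟩

variable {S : Supernatural} {l : ℕ}

lemma mem_smoothAlg_iff (a : Op ℕ) :
    a ∈ smoothAlg S ↔ ∃ l, Divides l S ∧ SmoothMod l fun _ : Unit => a :=
  mem_smoothBDT_iff a

/-- The Toeplitz map as a continuous linear map. -/
def toeplitzL : Op ℤ →L[ℂ] Op ℕ :=
  (ContinuousLinearMap.compL ℂ (Ell2 ℕ) (Ell2 ℤ) (Ell2 ℕ) proj) ∘L
    ((ContinuousLinearMap.compL ℂ (Ell2 ℕ) (Ell2 ℤ) (Ell2 ℤ)).flip incl)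

lemma coeff_mul_mulN (x : Op ℕ) (f : C(Odometer S, ℂ)) (k s : ℕ) :
    coeff (x * mulN f) k s = f ((s : ℕ) : Odometer S) * coeff x k s := by
  rw [coeff, mul_apply_eq_comp, mulN_E, map_smul]
  rfl

lemma U_mem : U ∈ BunceDeddensToeplitz S :=
  StarSubalgebra.le_topologicalClosure _ (StarAlgebra.subset_adjoin ℂ _ (by simp))

lemma mulN_mem (f : C(Odometer S, ℂ)) : mulN f ∈ BunceDeddensToeplitz S :=
  StarSubalgebra.le_topologicalClosure _
    (StarAlgebra.subset_adjoin ℂ _ (Set.mem_union_right _ ⟨f, rfl⟩))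

lemma toeplitz_shiftPow_mul_mulZ_mem (n : ℤ) (f : C(Odometer S, ℂ)) :
    toeplitz (shiftPow n * mulZ f) ∈ BunceDeddensToeplitz S := by
  obtain ⟨m, rfl | rfl⟩ := n.eq_nat_or_neg
  · have : toeplitz (shiftPow m * mulZ f) = U ^ m * mulN f := op_ext fun k s => by
      rw [coeff_toeplitz, coeff_shiftPow_mul, coeff_mulZ, coeff_mul_mulN, coeff_U_pow]
      by_cases h : k = s + m
      · rw [if_pos (by omega), if_pos h, mul_one, Int.cast_natCast]
      · rw [if_neg (by omega), if_neg h, mul_zero]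
    rw [this]
    exact mul_mem (pow_mem U_mem m) (mulN_mem f)
  · have : toeplitz (shiftPow (-m) * mulZ f) = star (U ^ m) * mulN f := op_ext fun k s => by
      rw [coeff_toeplitz, coeff_shiftPow_mul, coeff_mulZ, coeff_mul_mulN, coeff_star, coeff_U_pow]
      by_cases h : s = k + m
      · rw [if_pos (by omega), if_pos h, star_one, mul_one, Int.cast_natCast]
      · rw [if_neg (by omega), if_neg h, star_zero, mul_zero]
    rw [this]
    exact mul_mem (star_mem (pow_mem U_mem m)) (mulN_mem f)

/-- The projection `1 - UU*` is the matrix unit at the origin and shifts move it anywhere, so the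
algebra generated by `U` contains all matrix units and the closure all of `K^∞`. -/
lemma matrixUnit_eq (p q : ℕ) : matrixUnit p q = U ^ p * initProj 1 * star (U ^ q) := by
  have h : initProj 1 = matrixUnit 0 0 := op_ext fun k s => by
    rw [initProj, coeff_one_sub_U_pow_mul_star, coeff_matrixUnit]
    congr 1
    apply propext
    omega
  rw [h, matrixUnit, matrixUnit]
  refine ContinuousLinearMap.ext fun v => ?_
  rw [mul_apply_eq_comp, mul_apply_eq_comp, InnerProductSpace.rankOne_apply,
    InnerProductSpace.rankOne_apply, map_smul, U_pow_E, zero_add,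
    ContinuousLinearMap.star_eq_adjoint, ContinuousLinearMap.adjoint_inner_right, U_pow_E, zero_add]

lemma smoothAlg_le (S : Supernatural) : smoothAlg S ≤ BunceDeddensToeplitz S := by
  have hcl : IsClosed (BunceDeddensToeplitz S : Set (Op ℕ)) :=
    StarSubalgebra.isClosed_topologicalClosure _
  rintro _ ⟨b, ⟨l, -, -, f, -, -, hb⟩, c, ⟨m, -, hc⟩, rfl⟩
  refine add_mem ?_ ?_
  · refine hcl.mem_of_tendsto (hb.mapL toeplitzL) (Filter.Eventually.of_forall fun t => ?_)
    exact sum_mem fun n _ => toeplitz_shiftPow_mul_mulZ_mem n (f n)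
  · refine hcl.mem_of_tendsto hc (Filter.Eventually.of_forall fun t => ?_)
    refine sum_mem fun q _ => SMulMemClass.smul_mem _ ?_
    rw [matrixUnit_eq]
    exact mul_mem (mul_mem (pow_mem U_mem _) (sub_mem (one_mem _)
      (mul_mem (pow_mem U_mem _) (star_mem (pow_mem U_mem _))))) (star_mem (pow_mem U_mem _))

lemma U_mem_smoothAlg : U ∈ smoothAlg S := by
  refine (mem_smoothAlg_iff U).mpr ⟨1, divides_one S, ?_⟩
  refine ⟨by simpa using offDiagDecay_U_pow (I := Unit) 1, ?_⟩
  have : defect 1 U = 0 := op_ext fun k s => by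
    rw [coeff_defect, coeff_U, coeff_U, coeff_zero, sub_eq_zero]
    congr 1
    apply propext
    omega
  simpa only [this] using Decay.zero

lemma mulN_mem_smoothAlg (hl : Divides l S) (f : C(Odometer S, ℂ))
    (hf : ∀ x, f (x + (l : Odometer S)) = f x) : mulN f ∈ smoothAlg S := by
  refine (mem_smoothAlg_iff _).mpr ⟨l, hl, offDiagDecay_const_of_coeff fun N =>
    ⟨‖f‖, fun k s => ?_⟩, ?_⟩
  · rw [coeff_mulN]
    split_ifs with h
    · subst h
      simpa [offDiag] using f.norm_coe_le_norm _
    · simp only [norm_zero, mul_zero]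
      positivity
  · have : defect l (mulN f) = 0 := op_ext fun k s => by
      rw [coeff_defect, coeff_mulN, coeff_mulN, coeff_zero, sub_eq_zero]
      push_cast
      rw [hf]
      simp
    simpa only [this] using Decay.zero

/-- The representation of the continuous functions on the odometer by multiplication operators. -/
def mulNHom (S : Supernatural) : C(Odometer S, ℂ) →⋆ₐ[ℂ] Op ℕ where
  toFun := mulN
  map_one' := op_ext fun k s => by simp [coeff_mulN, coeff_one]
  map_mul' f g := op_ext fun k s => by
    rw [coeff_mul_mulN, coeff_mulN, coeff_mulN]
    split_ifs <;> simp [mul_comm]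
  map_zero' := op_ext fun k s => by simp [coeff_mulN, coeff_zero]
  map_add' f g := op_ext fun k s => by
    rw [coeff_add, coeff_mulN, coeff_mulN, coeff_mulN]
    split_ifs <;> simp
  commutes' z := op_ext fun k s => by
    rw [coeff_mulN, Algebra.algebraMap_eq_smul_one, Algebra.algebraMap_eq_smul_one, coeff_smul,
      coeff_one]
    split_ifs <;> simp
  map_star' f := op_ext fun k s => by
    rw [coeff_star, coeff_mulN, coeff_mulN]
    by_cases h : k = s
    · subst h; simp
    · rw [if_neg h, if_neg (Ne.symm h), star_zero]

lemma norm_mulN_le (f : C(Odometer S, ℂ)) : ‖mulN f‖ ≤ ‖f‖ := norm_coordOp_le _ _ _ _ _ _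

lemma continuous_mulNHom (S : Supernatural) : Continuous (mulNHom S) :=
  AddMonoidHomClass.continuous_of_bound (mulNHom S) 1 fun f => by
    rw [one_mul]
    exact norm_mulN_le f

/-- Stone-Weierstrass: the functions whose multiplication operator lies in the closure form a closed
star subalgebra. It contains the indicators of residue classes modulo `p^v`, which separate the
points of the odometer. -/
lemma mulN_mem_closure (f : C(Odometer S, ℂ)) : mulN f ∈ (smoothAlg S).topologicalClosure := by
  let B : StarSubalgebra ℂ C(Odometer S, ℂ) := (smoothAlg S).topologicalClosure.comap (mulNHom S)
  have hB : IsClosed (B : Set C(Odometer S, ℂ)) :=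
    (StarSubalgebra.isClosed_topologicalClosure _).preimage (continuous_mulNHom S)
  have hsep : B.SeparatesPoints := by
    intro x y hxy
    obtain ⟨p, hp⟩ := Function.ne_iff.mp hxy
    obtain ⟨v, hv, hne⟩ := exists_localProj_ne p (S p) (x p) (y p) hp
    let χ : ZMod ((p : ℕ) ^ v) → ℂ := fun z => if z = localProj p (S p) v hv (x p) then 1 else 0
    have hχ : Continuous χ := continuous_of_discreteTopology
    have hp' : Continuous fun z : Odometer S => z p := continuous_apply p
    let g : C(Odometer S, ℂ) := ⟨fun z => χ (localProj p (S p) v hv (z p)),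
      hχ.comp ((continuous_localProj p (S p) v hv).comp hp')⟩
    refine ⟨g, ⟨g, ?_, rfl⟩, ?_⟩
    · refine StarSubalgebra.le_topologicalClosure _
        (mulN_mem_smoothAlg (divides_prime_pow p v hv) g fun z => ?_)
      change χ (localProj p (S p) v hv (z p + (((p : ℕ) ^ v : ℕ) : Odometer S) p)) =
        χ (localProj p (S p) v hv (z p))
      rw [Pi.natCast_apply, map_add, map_natCast, ZMod.natCast_self, add_zero]
    · change χ (localProj p (S p) v hv (x p)) ≠ χ (localProj p (S p) v hv (y p))
      simp [χ, hne.symm]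
  have htop := ContinuousMap.starSubalgebra_topologicalClosure_eq_top_of_separatesPoints B hsep
  have hle : B.topologicalClosure ≤ B := StarSubalgebra.topologicalClosure_minimal le_rfl hB
  exact hle (htop ▸ trivial : f ∈ B.topologicalClosure)

lemma le_closure_smoothAlg (S : Supernatural) :
    BunceDeddensToeplitz S ≤ (smoothAlg S).topologicalClosure := by
  refine StarSubalgebra.topologicalClosure_minimal (StarAlgebra.adjoin_le ?_)
    (StarSubalgebra.isClosed_topologicalClosure _)
  rintro _ (rfl | ⟨f, rfl⟩)
  · exact StarSubalgebra.le_topologicalClosure _ U_mem_smoothAlg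
  · exact mulN_mem_closure f

end Subalgebra

/-! ## The K-theory of dense inverse-closed subalgebras -/

section Units

lemma exists_map_mem {R B : Type*} [Ring R] [NormedRing B] {φ : R →+* B}
    (hφ : DenseRange φ) {m n : ℕ} {V : Set (Matrix (Fin m) (Fin n) B)} (hV : IsOpen V) (hne : V.Nonempty) :
    ∃ x : Matrix (Fin m) (Fin n) R, x.map φ ∈ V := by
  have h1 : DenseRange (Pi.map fun _ : Fin n => φ) := DenseRange.piMap fun _ => hφ
  have h2 : DenseRange (Pi.map fun _ : Fin m => Pi.map fun _ : Fin n => φ) :=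
    DenseRange.piMap fun _ => h1
  exact h2.exists_mem_open hV hne

variable {B : Type*} [NormedRing B] [CompleteSpace B] {n : ℕ}

lemma isOpen_isUnit_matrix : IsOpen {x : Matrix (Fin n) (Fin n) B | IsUnit x} := by
  let _ : NormedRing (Matrix (Fin n) (Fin n) B) := Matrix.linftyOpNormedRing
  have : @CompleteSpace (Matrix (Fin n) (Fin n) B)
    (inferInstance : PseudoMetricSpace (Matrix (Fin n) (Fin n) B)).toUniformSpace :=
    completeSpace_matrix n
  exact Units.isOpen (R := Matrix (Fin n) (Fin n) B)

end Units

/-! ### Functoriality of `K_0`. -/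

section KZeroMap

variable {R B : Type*} [Ring R] [Ring B]

lemma blockDiag_map (φ : R →+* B) {m n : ℕ} (e : Matrix (Fin m) (Fin m) R)
    (f : Matrix (Fin n) (Fin n) R) :
    (blockDiag e f).map φ = blockDiag (e.map φ) (f.map φ) := by
  ext i j
  obtain ⟨i, rfl⟩ := finSumFinEquiv.surjective i
  obtain ⟨j, rfl⟩ := finSumFinEquiv.surjective j
  rcases i with i | i <;> rcases j with j | j <;>
    simp only [Matrix.map_apply, blockDiag_inl_inl, blockDiag_inl_inr, blockDiag_inr_inl,
      blockDiag_inr_inr, map_zero]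

lemma IdemMatrix.MvN.map (φ : R →+* B) {e f : IdemMatrix R} :
    e.MvN f → (e.map φ).MvN (f.map φ)
  | ⟨x, y, hxy, hyx⟩ => ⟨x.map φ, y.map φ,
      Matrix.map_mul.symm.trans (congrArg (fun M => M.map φ) hxy),
      Matrix.map_mul.symm.trans (congrArg (fun M => M.map φ) hyx)⟩

/-- The homomorphism of the monoids of idempotents that is induced by a ring homomorphism. -/
def IdemMonoid.map (φ : R →+* B) : IdemMonoid R →+ IdemMonoid B where
  toFun := Quotient.map (IdemMatrix.map φ) fun _ _ h => h.map φ
  map_zero' := by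
    refine Quotient.sound ?_
    have : (IdemMatrix.zero R).map φ = IdemMatrix.zero B := by
      simp only [IdemMatrix.map, IdemMatrix.zero, IdemMatrix.mk.injEq, heq_eq_eq, true_and]
      exact Subsingleton.elim _ _
    rw [this]
  map_add' a b := by
    induction a, b using Quotient.inductionOn₂ with
    | _ e f =>
      refine Quotient.sound ?_
      have : (e.sum f).map φ = (e.map φ).sum (f.map φ) := by
        simp only [IdemMatrix.map, IdemMatrix.sum, IdemMatrix.mk.injEq, heq_eq_eq, true_and]
        exact blockDiag_map φ e.mat f.mat
      rw [this]

lemma grothendieck_lift_of {M G : Type*} [AddCommMonoid M] [AddCommGroup G] (f : M →+ G) (x : M) :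
    Algebra.GrothendieckAddGroup.lift f (Algebra.GrothendieckAddGroup.of x) = f x :=
  DFunLike.congr_fun (Algebra.GrothendieckAddGroup.lift.symm_apply_apply f) x

/-- Isomorphic monoids have isomorphic Grothendieck groups. -/
def grothendieckCongr {M N : Type*} [AddCommMonoid M] [AddCommMonoid N] (e : M ≃+ N) :
    Algebra.GrothendieckAddGroup M ≃+ Algebra.GrothendieckAddGroup N :=
  AddMonoidHom.toAddEquiv
    (Algebra.GrothendieckAddGroup.lift (Algebra.GrothendieckAddGroup.of.comp e.toAddMonoidHom))
    (Algebra.GrothendieckAddGroup.lift (Algebra.GrothendieckAddGroup.of.comp e.symm.toAddMonoidHom))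
    (Algebra.GrothendieckAddGroup.lift.symm.injective (AddMonoidHom.ext fun x => by
      change Algebra.GrothendieckAddGroup.lift
        (Algebra.GrothendieckAddGroup.of.comp e.symm.toAddMonoidHom)
        (Algebra.GrothendieckAddGroup.lift _ (Algebra.GrothendieckAddGroup.of x)) =
          Algebra.GrothendieckAddGroup.of x
      rw [grothendieck_lift_of]
      exact (grothendieck_lift_of _ _).trans
        (congrArg Algebra.GrothendieckAddGroup.of (e.symm_apply_apply x))))
    (Algebra.GrothendieckAddGroup.lift.symm.injective (AddMonoidHom.ext fun x => by
      change Algebra.GrothendieckAddGroup.lift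
        (Algebra.GrothendieckAddGroup.of.comp e.toAddMonoidHom)
        (Algebra.GrothendieckAddGroup.lift _ (Algebra.GrothendieckAddGroup.of x)) =
          Algebra.GrothendieckAddGroup.of x
      rw [grothendieck_lift_of]
      exact (grothendieck_lift_of _ _).trans
        (congrArg Algebra.GrothendieckAddGroup.of (e.apply_symm_apply x))))

lemma grothendieckCongr_of {M N : Type*} [AddCommMonoid M] [AddCommMonoid N] (e : M ≃+ N) (x : M) :
    grothendieckCongr e (Algebra.GrothendieckAddGroup.of x) =
      Algebra.GrothendieckAddGroup.of (e x) :=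
  grothendieck_lift_of (Algebra.GrothendieckAddGroup.of.comp e.toAddMonoidHom) x

end KZeroMap

/-! ### Comparison of `K_0`. -/

section KZeroIso

variable {R B : Type*} [Ring R] [NormedRing B] [CompleteSpace B] {φ : R →+* B}

/-- Idempotents over a dense inverse-closed subring are equivalent if they are equivalent over the
Banach algebra. -/
lemma IdemMatrix.MvN.of_map (hφ : DenseRange φ)
    (hinv : ∀ (n : ℕ) (x : Matrix (Fin n) (Fin n) R), IsUnit (x.map φ) → IsUnit x)
    {e f : IdemMatrix R} (h : (e.map φ).MvN (f.map φ)) :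
    e.MvN f := by
  obtain ⟨x, y, hxy, hyx⟩ := h
  obtain ⟨m, e, he⟩ := e
  obtain ⟨n, f, hf⟩ := f
  change Matrix (Fin m) (Fin n) B at x
  change Matrix (Fin n) (Fin m) B at y
  change x * y = e.map φ at hxy
  change y * x = f.map φ at hyx
  have he' : e.map φ * e.map φ = e.map φ := by rw [← Matrix.map_mul, he]
  have hf' : f.map φ * f.map φ = f.map φ := by rw [← Matrix.map_mul, hf]
  -- Approximants of `x` and `y` are cut down by `e` and `f`. Then `XY + (1 - e)` and `YX + (1 - f)`
  -- are close to `1`, an open condition that survives passing to the dense subring.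
  let G : Matrix (Fin m) (Fin n) B × Matrix (Fin n) (Fin m) B → Matrix (Fin m) (Fin m) B :=
    fun q => (e.map φ * q.1 * f.map φ) * (f.map φ * q.2 * e.map φ) + (1 - e.map φ)
  let H : Matrix (Fin m) (Fin n) B × Matrix (Fin n) (Fin m) B → Matrix (Fin n) (Fin n) B :=
    fun q => (f.map φ * q.2 * e.map φ) * (e.map φ * q.1 * f.map φ) + (1 - f.map φ)
  have hG : Continuous G := by fun_prop
  have hH : Continuous H := by fun_prop
  have hV : IsOpen {q | IsUnit (G q) ∧ IsUnit (H q)} :=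
    (isOpen_isUnit_matrix.preimage hG).inter (isOpen_isUnit_matrix.preimage hH)
  have hmem : (x, y) ∈ {q | IsUnit (G q) ∧ IsUnit (H q)} := by
    have h1 : x * f.map φ * y = e.map φ := by
      rw [← hyx, ← Matrix.mul_assoc, hxy, Matrix.mul_assoc, hxy, he']
    have h2 : y * e.map φ * x = f.map φ := by
      rw [← hxy, ← Matrix.mul_assoc, hyx, Matrix.mul_assoc, hyx, hf']
    have h3 : G (x, y) = 1 := by
      change (e.map φ * x * f.map φ) * (f.map φ * y * e.map φ) + (1 - e.map φ) = 1
      have : (e.map φ * x * f.map φ) * (f.map φ * y * e.map φ) =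
          e.map φ * (x * (f.map φ * f.map φ) * y) * e.map φ := by simp only [Matrix.mul_assoc]
      rw [this, hf', h1, he', he']
      abel
    have h4 : H (x, y) = 1 := by
      change (f.map φ * y * e.map φ) * (e.map φ * x * f.map φ) + (1 - f.map φ) = 1
      have : (f.map φ * y * e.map φ) * (e.map φ * x * f.map φ) =
          f.map φ * (y * (e.map φ * e.map φ) * x) * f.map φ := by simp only [Matrix.mul_assoc]
      rw [this, he', h2, hf', hf']
      abel
    exact ⟨h3 ▸ isUnit_one, h4 ▸ isUnit_one⟩
  obtain ⟨V, W, hVo, hWo, hx, hy, hVW⟩ := isOpen_prod_iff.mp hV x y hmem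
  obtain ⟨x', hx'⟩ := exists_map_mem hφ hVo ⟨x, hx⟩
  obtain ⟨y', hy'⟩ := exists_map_mem hφ hWo ⟨y, hy⟩
  obtain ⟨hu, hv⟩ := hVW (Set.mk_mem_prod hx' hy')
  let X := e * x' * f
  let Y := f * y' * e
  have hone : ∀ k : ℕ, (1 : Matrix (Fin k) (Fin k) R).map φ = 1 := fun k =>
    Matrix.map_one _ (map_zero _) (map_one _)
  have hsub : ∀ (k : ℕ) (a b : Matrix (Fin k) (Fin k) R), (a - b).map φ = a.map φ - b.map φ :=
    fun k a b => Matrix.map_sub _ (map_sub φ) a b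
  have hadd : ∀ (k : ℕ) (a b : Matrix (Fin k) (Fin k) R), (a + b).map φ = a.map φ + b.map φ :=
    fun k a b => Matrix.map_add _ (map_add φ) a b
  have hu' : IsUnit (X * Y + (1 - e)) := hinv m _ (by
    rw [hadd, hsub, hone]
    simpa only [X, Y, Matrix.map_mul] using hu)
  have hv' : IsUnit (Y * X + (1 - f)) := hinv n _ (by
    rw [hadd, hsub, hone]
    simpa only [X, Y, Matrix.map_mul] using hv)
  obtain ⟨u, hu⟩ := hu'
  have heX : (1 - e) * X = 0 := by
    simp only [X, ← Matrix.mul_assoc, Matrix.sub_mul, Matrix.one_mul, he, sub_self, Matrix.zero_mul]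
  have hfY : (1 - f) * Y = 0 := by
    simp only [Y, ← Matrix.mul_assoc, Matrix.sub_mul, Matrix.one_mul, hf, sub_self, Matrix.zero_mul]
  have hXf : X * f = X := by simp only [X, Matrix.mul_assoc, hf]
  have heX' : e * X = X := by simp only [X, ← Matrix.mul_assoc, he]
  clear_value X Y
  have heu : (1 - e) * (u : Matrix (Fin m) (Fin m) R) = 1 - e := by
    have : (1 - e) * (1 - e) = 1 - e := by
      rw [mul_sub, mul_one, sub_mul, one_mul, he, sub_self, sub_zero]
    rw [hu, mul_add, ← Matrix.mul_assoc, heX, Matrix.zero_mul, zero_add, this]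
  have heu' : (1 - e) * (↑u⁻¹ : Matrix (Fin m) (Fin m) R) = 1 - e := by
    conv_lhs => rw [← heu, Matrix.mul_assoc, Units.mul_inv, Matrix.mul_one]
  have hXY : X * (Y * (↑u⁻¹ : Matrix (Fin m) (Fin m) R)) = e := by
    rw [← Matrix.mul_assoc, eq_sub_of_add_eq hu.symm, Matrix.sub_mul, heu', Units.mul_inv,
      sub_sub_cancel]
  refine ⟨X, Y * (↑u⁻¹ : Matrix (Fin m) (Fin m) R), hXY, ?_⟩
  -- The factor `Y` was corrected by the inverse of `XY + (1 - e)` so that one product is exactly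
  -- `e`; the other is seen to be `f` after multiplying by the invertible `YX + (1 - f)`.
  refine hv'.mul_left_cancel ?_
  change (Y * X + (1 - f)) * (Y * (↑u⁻¹ : Matrix (Fin m) (Fin m) R) * X) = (Y * X + (1 - f)) * f
  have h1 : (Y * X) * (Y * (↑u⁻¹ : Matrix (Fin m) (Fin m) R) * X) = Y * X := by
    calc _ = Y * (X * (Y * (↑u⁻¹ : Matrix (Fin m) (Fin m) R))) * X := by
          simp only [Matrix.mul_assoc]
      _ = _ := by rw [hXY, Matrix.mul_assoc, heX']
  have h2 : (1 - f) * (Y * (↑u⁻¹ : Matrix (Fin m) (Fin m) R) * X) = 0 := by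
    rw [← Matrix.mul_assoc, ← Matrix.mul_assoc, hfY, Matrix.zero_mul, Matrix.zero_mul]
  rw [Matrix.add_mul, Matrix.add_mul, h1, h2, Matrix.mul_assoc, hXf, Matrix.sub_mul, hf,
    Matrix.one_mul, sub_self]

/-- Nearby idempotents are equivalent, so every idempotent over the Banach algebra comes from the
dense subring if it is a limit of idempotents over the latter. -/
lemma IdemMatrix.exists_map_MvN (e : IdemMatrix B)
    (h : e.mat ∈ closure {x | ∃ e' : Matrix (Fin e.size) (Fin e.size) R,
      e' * e' = e' ∧ e'.map φ = x}) : ∃ e' : IdemMatrix R, (e'.map φ).MvN e := by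
  obtain ⟨n, e, he⟩ := e
  change e ∈ closure {x | ∃ e' : Matrix (Fin n) (Fin n) R, e' * e' = e' ∧ e'.map φ = x} at h
  -- For an idempotent `a`, this element `z` satisfies `a z = z e`, and it is `1` at `a = e`, hence
  -- invertible nearby. It conjugates `e` into `a`.
  let G : Matrix (Fin n) (Fin n) B → Matrix (Fin n) (Fin n) B := fun a =>
    a * e + (1 - a) * (1 - e)
  have hG : Continuous G := by fun_prop
  have hGe : G e = 1 := by
    simp only [G, mul_sub, sub_mul, mul_one, one_mul, he]
    abel
  obtain ⟨_, hu, e', he', rfl⟩ := mem_closure_iff.mp h _ (isOpen_isUnit_matrix.preimage hG)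
    (show IsUnit (G e) from hGe ▸ isUnit_one)
  have ha : e'.map φ * e'.map φ = e'.map φ := by rw [← Matrix.map_mul, he']
  obtain ⟨z, hz⟩ : IsUnit (G (e'.map φ)) := hu
  have h1 : e'.map φ * (z : Matrix (Fin n) (Fin n) B) = e'.map φ * e := by
    rw [hz]
    simp only [G, mul_add, mul_sub, sub_mul, mul_one, one_mul, ← mul_assoc, ha]
    abel
  have h2 : (z : Matrix (Fin n) (Fin n) B) * e = e'.map φ * e := by
    rw [hz]
    simp only [G, add_mul, mul_sub, sub_mul, mul_one, one_mul, mul_assoc, he]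
    abel
  have h12 : e'.map φ * (z : Matrix (Fin n) (Fin n) B) = z * e := h1.trans h2.symm
  refine ⟨⟨n, e', he'⟩, e'.map φ * (z : Matrix (Fin n) (Fin n) B),
    (↑z⁻¹ : Matrix (Fin n) (Fin n) B) * e'.map φ, ?_, ?_⟩
  · change e'.map φ * (z : Matrix (Fin n) (Fin n) B) *
      ((↑z⁻¹ : Matrix (Fin n) (Fin n) B) * e'.map φ) = e'.map φ
    rw [mul_assoc, Units.mul_inv_cancel_left, ha]
  · change (↑z⁻¹ : Matrix (Fin n) (Fin n) B) * e'.map φ *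
      (e'.map φ * (z : Matrix (Fin n) (Fin n) B)) = e
    rw [mul_assoc, ← mul_assoc (e'.map φ), ha, h12, Units.inv_mul_cancel_left]

/-- A dense inverse-closed subring, over which idempotent matrices can be approximated, has the
same `K_0`. -/
theorem exists_kZero_equiv (hφ : DenseRange φ)
    (hinv : ∀ (n : ℕ) (x : Matrix (Fin n) (Fin n) R), IsUnit (x.map φ) → IsUnit x)
    (hidem : ∀ (n : ℕ) (e : Matrix (Fin n) (Fin n) B), e * e = e →
      e ∈ closure {x | ∃ e' : Matrix (Fin n) (Fin n) R, e' * e' = e' ∧ e'.map φ = x}) :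
    ∃ Φ : KZero R ≃+ KZero B, ∀ e : IdemMatrix R, Φ (KZero.mk e) = KZero.mk (e.map φ) := by
  have hbij : Function.Bijective (IdemMonoid.map φ) := by
    constructor
    · intro a b hab
      induction a, b using Quotient.inductionOn₂ with
      | _ e f => exact Quotient.sound (IdemMatrix.MvN.of_map hφ hinv (Quotient.exact hab))
    · intro b
      induction b using Quotient.inductionOn with
      | _ e =>
        obtain ⟨e', he'⟩ := IdemMatrix.exists_map_MvN (φ := φ) e (hidem e.size e.mat e.idem)
        exact ⟨Quotient.mk _ e', Quotient.sound he'⟩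
  exact ⟨grothendieckCongr (AddEquiv.ofBijective (IdemMonoid.map φ) hbij), fun e =>
    grothendieckCongr_of _ _⟩

end KZeroIso

/-! ### The group `GL_∞` and paths of invertible matrices. -/

section Limit

variable {R : Type*} [Ring R]

lemma GLInf.mk_stab {n m : ℕ} (h : n ≤ m) (u : GLn R n) :
    GLInf.mk (QuantumOdometer.stab n m h u) = GLInf.mk u :=
  DirectLimit.mk_apply n m u h

lemma GLInf.mk_mul {n : ℕ} (u v : GLn R n) : GLInf.mk (u * v) = GLInf.mk u * GLInf.mk v :=
  (DirectLimit.mul_def (f := QuantumOdometer.stab (R := R)) n u v).symm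

lemma GLInf.mk_inv {n : ℕ} (u : GLn R n) : GLInf.mk u⁻¹ = (GLInf.mk u)⁻¹ := rfl

lemma GLInf.mk_one (n : ℕ) : GLInf.mk (1 : GLn R n) = 1 :=
  (DirectLimit.one_def (f := QuantumOdometer.stab (R := R)) n).symm

end Limit

section Joined

variable {R : Type*} [Ring R] [t : TopologicalSpace R]

lemma joinedToOne_iff {n : ℕ} {u : GLn R n} :
    JoinedToOne t u ↔ JoinedIn {x : Matrix (Fin n) (Fin n) R | IsUnit x} 1 u :=
  ⟨fun ⟨γ, hγ, h0, h1, h⟩ => ⟨⟨⟨γ, hγ⟩, h0, h1⟩, h⟩,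
    fun ⟨γ, h⟩ => ⟨γ, γ.continuous, γ.source, γ.target, h⟩⟩

lemma joinedToOne_one (n : ℕ) : JoinedToOne t (1 : GLn R n) :=
  joinedToOne_iff.mpr (JoinedIn.refl isUnit_one)

lemma continuous_stabMat {n m : ℕ} (h : n ≤ m) :
    Continuous (stabMat h : Matrix (Fin n) (Fin n) R →* Matrix (Fin m) (Fin m) R) := by
  refine continuous_matrix fun i j => ?_
  simp only [stabMat_apply]
  split_ifs <;> fun_prop

lemma JoinedToOne.stab {n m : ℕ} (h : n ≤ m) {u : GLn R n} (hu : JoinedToOne t u) :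
    JoinedToOne t (stab n m h u) := by
  obtain ⟨γ, hγ, h0, h1, hu⟩ := hu
  exact ⟨fun s => stabMat h (γ s), (continuous_stabMat h).comp hγ,
    (congrArg (stabMat h) h0).trans (map_one _),
    congrArg (stabMat h) h1, fun s => (hu s).map (stabMat h)⟩

lemma JoinedToOne.map {R' : Type*} [Ring R'] [t' : TopologicalSpace R'] {φ : R →+* R'}
    (hφ : Continuous φ) {n : ℕ} {u : GLn R n} (hu : JoinedToOne t u) :
    JoinedToOne t' (u.map φ) := by
  obtain ⟨γ, hγ, h0, h1, hu⟩ := hu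
  exact ⟨fun s => (γ s).map φ, hγ.matrix_map hφ,
    (congrArg (RingHom.mapMatrix φ) h0).trans (map_one (RingHom.mapMatrix φ)),
    congrArg (RingHom.mapMatrix φ) h1, fun s => (hu s).map (RingHom.mapMatrix φ)⟩

lemma JoinedToOne.mk_mem {n : ℕ} {u : GLn R n} (hu : JoinedToOne t u) :
    GLInf.mk u ∈ GLInfZero t :=
  Subgroup.subset_normalClosure ⟨n, u, hu, rfl⟩

variable [IsTopologicalRing R]

lemma JoinedToOne.mul {n : ℕ} {u v : GLn R n} (hu : JoinedToOne t u) (hv : JoinedToOne t v) :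
    JoinedToOne t (u * v) := by
  obtain ⟨γ, hγ, h0, h1, hu⟩ := hu
  obtain ⟨δ, hδ, h0', h1', hv⟩ := hv
  exact ⟨fun s => γ s * δ s, hγ.mul hδ, by simp only [h0, h0', one_mul],
    by simp only [h1, h1', Units.val_mul],
    fun s => (hu s).mul (hv s)⟩

lemma JoinedToOne.conj {n : ℕ} {u : GLn R n} (hu : JoinedToOne t u) (w : GLn R n) :
    JoinedToOne t (w * u * w⁻¹) := by
  obtain ⟨γ, hγ, h0, h1, hu⟩ := hu
  exact ⟨fun s => w * γ s * (w⁻¹ : GLn R n), (continuous_const.mul hγ).mul continuous_const,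
    by simp only [h0, mul_one, Units.mul_inv], by simp only [h1, Units.val_mul],
    fun s => (w.isUnit.mul (hu s)).mul w⁻¹.isUnit⟩

lemma joinedToOne_inv_mul {n : ℕ} {u v : GLn R n}
    (h : JoinedIn {x : Matrix (Fin n) (Fin n) R | IsUnit x} u v) :
    JoinedToOne t (u⁻¹ * v) := by
  obtain ⟨γ, hγ⟩ := h
  exact ⟨fun s => (u⁻¹ : GLn R n) * γ s, continuous_const.mul γ.continuous,
    by simp only [γ.source, Units.inv_mul], by simp only [γ.target, Units.val_mul],
    fun s => u⁻¹.isUnit.mul (hγ s)⟩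

lemma JoinedToOne.inv {n : ℕ} {u : GLn R n} (hu : JoinedToOne t u) : JoinedToOne t u⁻¹ := by
  simpa using joinedToOne_inv_mul (u := u) (v := 1) (joinedToOne_iff.mp hu).symm

/-- Over a topological ring, the path components of `1` make up a normal subgroup of `GL_∞`. -/
lemma exists_joinedToOne {g : GLInf R} (hg : g ∈ GLInfZero t) :
    ∃ (n : ℕ) (u : GLn R n), JoinedToOne t u ∧ g = GLInf.mk u := by
  let N : Subgroup (GLInf R) :=
    { carrier := {g | ∃ (n : ℕ) (u : GLn R n), JoinedToOne t u ∧ g = GLInf.mk u}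
      one_mem' := ⟨0, 1, joinedToOne_one 0, (GLInf.mk_one 0).symm⟩
      mul_mem' := by
        rintro _ _ ⟨n, u, hu, rfl⟩ ⟨m, v, hv, rfl⟩
        refine ⟨max n m, _, (hu.stab (le_max_left n m)).mul (hv.stab (le_max_right n m)), ?_⟩
        rw [GLInf.mk_mul, GLInf.mk_stab, GLInf.mk_stab]
      inv_mem' := by
        rintro _ ⟨n, u, hu, rfl⟩
        exact ⟨n, u⁻¹, hu.inv, rfl⟩ }
  have hN : N.Normal := by
    refine ⟨?_⟩
    rintro _ ⟨n, u, hu, rfl⟩ g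
    obtain ⟨m, w, rfl⟩ : ∃ (m : ℕ) (w : GLn R m), g = GLInf.mk w := DirectLimit.exists_eq_mk _ g
    refine ⟨max n m, _, (hu.stab (le_max_left n m)).conj
      (QuantumOdometer.stab m _ (le_max_right n m) w), ?_⟩
    rw [GLInf.mk_mul, GLInf.mk_mul, GLInf.mk_inv, GLInf.mk_stab, GLInf.mk_stab]
  exact Subgroup.normalClosure_le_normal (N := N) (fun _ h => h) hg

end Joined

/-! ### Functoriality of `GL_∞`. -/

section GLInfMap

variable {R B : Type*} [Ring R] [Ring B]

lemma stab_map (φ : R →+* B) {n m : ℕ} (h : n ≤ m) (u : GLn R n) :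
    stab n m h (u.map φ) = (stab n m h u).map φ := by
  ext i j
  change stabMat h (u.val.map φ) i j = φ (stabMat h u.val i j)
  simp only [stabMat_apply, Matrix.map_apply]
  split_ifs <;> simp

/-- The homomorphism `GL_∞(R) → GL_∞(B)` that is induced by a ring homomorphism. -/
def GLInf.map (φ : R →+* B) : GLInf R →* GLInf B :=
  MonoidHom.mk' (DirectLimit.map _ _ (fun _ u => GLn.map φ u) fun _ _ h u => stab_map φ h u)
    fun a b => by
      induction a, b using DirectLimit.induction₂ with
      | _ n u v =>
        change DirectLimit.map _ _ _ _ (GLInf.mk u * GLInf.mk v) =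
          GLInf.mk (u.map φ) * GLInf.mk (v.map φ)
        rw [← GLInf.mk_mul, ← GLInf.mk_mul]
        exact congrArg GLInf.mk (map_mul _ u v)

end GLInfMap

/-! ### Comparison of `K_1`. -/

section KOneIso

/-- Segments are continuous in any vector space topology; no continuity of the multiplication is
required, which is why they are the only paths built over the smooth algebra. -/
lemma joinedIn_of_segment {R : Type*} [Ring R] [Module ℂ R] [TopologicalSpace R] [ContinuousAdd R]
    [ContinuousSMul ℂ R] {n : ℕ} {x y : Matrix (Fin n) (Fin n) R}
    {F : Set (Matrix (Fin n) (Fin n) R)}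
    (h : ∀ s : ℝ, s ∈ Set.Icc 0 1 → (1 - s : ℂ) • x + (s : ℂ) • y ∈ F) :
    JoinedIn F x y := by
  refine JoinedIn.ofLine (f := fun s : ℝ => (1 - s : ℂ) • x + (s : ℂ) • y) ?_ (by simp) (by simp) ?_
  · have h1 : Continuous fun s : ℝ => (1 - s : ℂ) := by fun_prop
    exact ((h1.smul continuous_const).add
      (Complex.continuous_ofReal.smul continuous_const)).continuousOn
  · rintro _ ⟨s, hs, rfl⟩
    exact h s hs

variable {B : Type*} [NormedRing B] [NormedAlgebra ℂ B] [CompleteSpace B]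

/-- The invertible matrices are open and balls for the sup norm of the entries are convex. -/
lemma exists_isOpen_segment {n : ℕ} {b : Matrix (Fin n) (Fin n) B} (hb : IsUnit b) :
    ∃ V : Set (Matrix (Fin n) (Fin n) B), IsOpen V ∧ b ∈ V ∧ ∀ x ∈ V, ∀ y ∈ V, ∀ s : ℝ,
      s ∈ Set.Icc 0 1 → IsUnit ((1 - s : ℂ) • x + (s : ℂ) • y) := by
  obtain ⟨ε, hε, h⟩ := Metric.isOpen_iff (α := Fin n → Fin n → B).mp
    (isOpen_isUnit_matrix (B := B) (n := n)) b hb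
  refine ⟨Metric.ball (α := Fin n → Fin n → B) b ε, Metric.isOpen_ball (α := Fin n → Fin n → B),
    Metric.mem_ball_self (α := Fin n → Fin n → B) hε, fun x hx y hy s hs => ?_⟩
  have := (convex_ball (E := Fin n → Fin n → B) b ε) hx hy (sub_nonneg.mpr hs.2) hs.1 (by ring)
  have hxy : (1 - s : ℂ) • x + (s : ℂ) • y =
      ((1 - s) • (x : Fin n → Fin n → B) + s • (y : Fin n → Fin n → B) : Fin n → Fin n → B) := by
    rw [← Complex.coe_smul, ← Complex.coe_smul s, Complex.ofReal_sub, Complex.ofReal_one]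
  rw [hxy]
  exact h this

variable {R : Type*} [Ring R] [Module ℂ R] {φ : R →+* B}

/-- Invertible matrices over a dense inverse-closed subring are joined to `1` if they are joined
to `1` over the Banach algebra. -/
lemma JoinedToOne.of_map [t : TopologicalSpace R] [ContinuousAdd R] [ContinuousSMul ℂ R]
    (hφ : DenseRange φ) (hsmul : ∀ (c : ℂ) (x : R), φ (c • x) = c • φ x)
    (hinv : ∀ (n : ℕ) (x : Matrix (Fin n) (Fin n) R), IsUnit (x.map φ) → IsUnit x)
    {n : ℕ} {u : GLn R n} (hu : JoinedToOne inferInstance (u.map φ)) : JoinedToOne t u := by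
  obtain ⟨γ, hγ, h0, h1, hγu⟩ := hu
  -- The property that all matrices over the subring with image close to `γ s` are joined to `1`. On
  -- a neighbourhood where segments stay invertible, one joined matrix suffices for all, so `P` is
  -- locally constant; it holds at `0` and thus at `1`, where it is applied to `u`.
  let P : unitInterval → Prop := fun s => ∀ᶠ b in nhds (γ s), ∀ x : Matrix (Fin n) (Fin n) R,
    x.map φ = b → JoinedIn {x : Matrix (Fin n) (Fin n) R | IsUnit x} 1 x
  have hP : ∀ (s : unitInterval) (V : Set (Matrix (Fin n) (Fin n) B)), IsOpen V → γ s ∈ V →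
      (∀ x ∈ V, ∀ y ∈ V, ∀ s : ℝ, s ∈ Set.Icc 0 1 → IsUnit ((1 - s : ℂ) • x + (s : ℂ) • y)) →
      (P s ↔ ∃ x : Matrix (Fin n) (Fin n) R, x.map φ ∈ V ∧
        JoinedIn {x : Matrix (Fin n) (Fin n) R | IsUnit x} 1 x) := by
    intro s V hV hs hseg
    constructor
    · intro h
      obtain ⟨W, hW, hWo, hsW⟩ := eventually_nhds_iff.mp h
      obtain ⟨x, hx⟩ := exists_map_mem hφ (hV.inter hWo) ⟨_, hs, hsW⟩
      exact ⟨x, hx.1, hW _ hx.2 x rfl⟩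
    · rintro ⟨x, hx, hx1⟩
      filter_upwards [hV.mem_nhds hs] with b hb y hy
      refine hx1.trans (joinedIn_of_segment fun r hr => hinv n _ ?_)
      have := hseg _ hx _ hb r hr
      convert this using 1
      subst hy
      ext i j
      simp only [Matrix.map_apply, Matrix.add_apply, Matrix.smul_apply, map_add, hsmul]
  have hconst : IsLocallyConstant P := by
    refine IsLocallyConstant.iff_exists_open P |>.mpr fun s => ?_
    obtain ⟨V, hV, hs, hseg⟩ := exists_isOpen_segment (hγu s)
    exact ⟨γ ⁻¹' V, hV.preimage hγ, hs, fun r hr =>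
      propext ((hP r V hV hr hseg).trans (hP s V hV hs hseg).symm)⟩
  have hP0 : P 0 := by
    obtain ⟨V, hV, hs, hseg⟩ := exists_isOpen_segment (hγu 0)
    refine (hP 0 V hV hs hseg).mpr ⟨1, ?_, JoinedIn.refl isUnit_one⟩
    rw [Matrix.map_one φ (map_zero _) (map_one _), ← h0]
    exact hs
  have hP1 : P 1 := hconst.apply_eq_of_preconnectedSpace 0 1 ▸ hP0
  exact joinedToOne_iff.mpr (hP1.self_of_nhds u h1.symm)

/-- A dense inverse-closed subring with a finer vector space topology has the same `K_1`. -/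
theorem exists_kOne_equiv [t : TopologicalSpace R] [ContinuousAdd R] [ContinuousSMul ℂ R]
    (hφ : DenseRange φ) (hc : Continuous φ) (hsmul : ∀ (c : ℂ) (x : R), φ (c • x) = c • φ x)
    (hinv : ∀ (n : ℕ) (x : Matrix (Fin n) (Fin n) R), IsUnit (x.map φ) → IsUnit x) :
    ∃ ψ : KOne R t ≃* KOne B inferInstance, ∀ (n : ℕ) (u : GLn R n),
      ψ (KOne.mk t u) = KOne.mk _ (u.map φ) := by
  have hle : GLInfZero t ≤ (GLInfZero (R := B) inferInstance).comap (GLInf.map φ) := by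
    refine Subgroup.normalClosure_le_normal ?_
    rintro _ ⟨n, u, hu, rfl⟩
    exact (hu.map hc).mk_mem
  let ψ : KOne R t →* KOne B inferInstance := QuotientGroup.map _ _ (GLInf.map φ) hle
  have hψ : Function.Bijective ψ := by
    constructor
    · refine (injective_iff_map_eq_one ψ).mpr fun x hx => ?_
      obtain ⟨g, rfl⟩ := QuotientGroup.mk_surjective x
      obtain ⟨n, u, rfl⟩ : ∃ (n : ℕ) (u : GLn R n), g = GLInf.mk u := DirectLimit.exists_eq_mk _ g
      have hx' : GLInf.mk (u.map φ) ∈ GLInfZero (R := B) inferInstance :=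
        (QuotientGroup.eq_one_iff _).mp hx
      obtain ⟨k, v, hv, huv⟩ := exists_joinedToOne hx'
      -- Equality in the direct limit means equality at some finite stage `m`, where the path for
      -- `v` becomes a path for the image of `u`.
      obtain ⟨m, hn, hk, h⟩ := Quotient.exact huv
      have h' : (stab n m hn u).map φ = stab k m hk v := (stab_map φ hn u).symm.trans h
      refine (QuotientGroup.eq_one_iff _).mpr ?_
      rw [← GLInf.mk_stab hn]
      exact (JoinedToOne.of_map hφ hsmul hinv (h' ▸ hv.stab hk)).mk_mem
    · intro y
      obtain ⟨g, rfl⟩ := QuotientGroup.mk_surjective y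
      obtain ⟨n, u, rfl⟩ : ∃ (n : ℕ) (u : GLn B n), g = GLInf.mk u := DirectLimit.exists_eq_mk _ g
      obtain ⟨V, hV, hu, hseg⟩ := exists_isOpen_segment u.isUnit
      obtain ⟨x, hx⟩ := exists_map_mem hφ hV ⟨_, hu⟩
      -- The endpoint `s = 1` of the segment is `x` itself, so its image is invertible and
      -- inverse-closedness applies.
      obtain ⟨w, hw⟩ : IsUnit x := hinv n x (by simpa using hseg _ hu _ hx 1 (by simp))
      have hwV : (GLn.map φ w).val ∈ V := by
        subst hw
        exact hx
      refine ⟨KOne.mk t w, (QuotientGroup.eq.mpr ?_).symm⟩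
      have : JoinedToOne inferInstance (u⁻¹ * GLn.map φ w) :=
        joinedToOne_inv_mul (joinedIn_of_segment (hseg _ hu _ hwV))
      have h2 := this.mk_mem
      rwa [GLInf.mk_mul, GLInf.mk_inv] at h2
  exact ⟨MulEquiv.ofBijective ψ hψ, fun n u => rfl⟩

end KOneIso

/-! ## Approximation of idempotents -/

section Catalan

variable {X : Type*} [NormedRing X] [NormedAlgebra ℂ X]

lemma catalan_le_four_pow (n : ℕ) : (catalan n : ℝ) ≤ 4 ^ n := by
  have h1 : catalan n ≤ 4 ^ n := by
    refine (Nat.le_mul_of_pos_left _ n.succ_pos).trans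
      ((succ_mul_catalan_eq_centralBinom n).le.trans
      ((Nat.choose_le_two_pow _ _).trans ?_))
    rw [pow_mul]
    norm_num
  exact_mod_cast h1

/-- The power series solution `g` of `g = k + g ^ 2`. -/
def catalanSum (k : X) : X := ∑' m : ℕ, (catalan m : ℂ) • k ^ (m + 1)

variable {k : X}

lemma norm_catalan_smul_pow_le (hk : ‖k‖ ≤ 1 / 8) (m : ℕ) :
    ‖(catalan m : ℂ) • k ^ (m + 1)‖ ≤ ‖k‖ * (1 / 2) ^ m := by
  rw [norm_smul, Complex.norm_natCast]
  calc (catalan m : ℝ) * ‖k ^ (m + 1)‖ ≤ 4 ^ m * (‖k‖ ^ (m + 1)) := by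
        gcongr
        · exact catalan_le_four_pow m
        · exact norm_pow_le' k m.succ_pos
    _ = ‖k‖ * (4 * ‖k‖) ^ m := by ring
    _ ≤ _ := by
        gcongr
        linarith

lemma norm_catalanSum_le (hk : ‖k‖ ≤ 1 / 8) : ‖catalanSum k‖ ≤ 2 * ‖k‖ := by
  rw [mul_comm]
  exact tsum_of_norm_bounded (hasSum_geometric_two.mul_left ‖k‖) (norm_catalan_smul_pow_le hk)

lemma summable_norm_catalan (hk : ‖k‖ ≤ 1 / 8) :
    Summable fun m : ℕ => ‖(catalan m : ℂ) • k ^ (m + 1)‖ :=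
  Summable.of_nonneg_of_le (fun _ => norm_nonneg _) (norm_catalan_smul_pow_le hk)
    (summable_geometric_two.mul_left ‖k‖)

variable [CompleteSpace X]

/-- Segner's recursion for the Catalan numbers is the Cauchy product of the series with itself. -/
lemma catalanSum_eq (hk : ‖k‖ ≤ 1 / 8) : catalanSum k = k + catalanSum k * catalanSum k := by
  have hs := summable_norm_catalan hk
  have h := tsum_mul_tsum_eq_tsum_sum_antidiagonal_of_summable_norm hs hs
  have h' : ∀ n : ℕ, ∑ q ∈ Finset.HasAntidiagonal.antidiagonal n,
      ((catalan q.1 : ℂ) • k ^ (q.1 + 1)) * ((catalan q.2 : ℂ) • k ^ (q.2 + 1)) =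
        (catalan (n + 1) : ℂ) • k ^ (n + 1 + 1) := fun n => by
    rw [catalan_succ', Nat.cast_sum, Finset.sum_smul]
    refine Finset.sum_congr rfl fun q hq => ?_
    rw [smul_mul_smul_comm, ← pow_add, Nat.cast_mul,
      ← Finset.HasAntidiagonal.mem_antidiagonal.mp hq]
    congr 2
    ring
  simp only [h'] at h
  conv_lhs => rw [catalanSum, hs.of_norm.tsum_eq_zero_add]
  rw [catalanSum, h]
  simp

lemma catalanSum_commute (hk : ‖k‖ ≤ 1 / 8) {a : X} (h : k * a = a * k) :
    catalanSum k * a = a * catalanSum k := by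
  have hs := (summable_norm_catalan hk).of_norm
  rw [catalanSum, ← hs.tsum_mul_left, ← hs.tsum_mul_right]
  refine tsum_congr fun m => ?_
  rw [smul_mul_assoc, mul_smul_comm, (Commute.pow_left h (m + 1) : _ = _)]

/-- The idempotent that is associated with an almost idempotent element `a`. -/
lemma idem_of_almost_idem {a w : X} (hw : (1 + 4 * (a * a - a)) * w = 1)
    (hk : ‖(a * a - a) * w‖ ≤ 1 / 8) (hw' : w * (1 + 4 * (a * a - a)) = 1) :
    (a + (1 - 2 * a) * catalanSum ((a * a - a) * w)) *
      (a + (1 - 2 * a) * catalanSum ((a * a - a) * w)) =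
        a + (1 - 2 * a) * catalanSum ((a * a - a) * w) := by
  have hwa : w * a = a * w := by
    have h1 : a * (1 + 4 * (a * a - a)) = (1 + 4 * (a * a - a)) * a := by noncomm_ring
    calc w * a = w * (a * ((1 + 4 * (a * a - a)) * w)) := by rw [hw, mul_one]
      _ = w * ((1 + 4 * (a * a - a)) * a * w) := by rw [← mul_assoc a, h1]
      _ = (w * (1 + 4 * (a * a - a))) * (a * w) := by simp only [mul_assoc]
      _ = a * w := by rw [hw', one_mul]
  have hka : (a * a - a) * w * a = a * ((a * a - a) * w) := by
    rw [mul_assoc, hwa]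
    noncomm_ring
  have hga := catalanSum_commute hk hka
  have hg := catalanSum_eq hk
  have hkw : (1 + 4 * (a * a - a)) * ((a * a - a) * w) = a * a - a := by
    have h1 : (1 + 4 * (a * a - a)) * (a * a - a) = (a * a - a) * (1 + 4 * (a * a - a)) := by
      noncomm_ring
    rw [← mul_assoc, h1, mul_assoc, hw, mul_one]
  generalize catalanSum ((a * a - a) * w) = g at *
  generalize (a * a - a) * w = k at *
  have hgk : k = g - g * g := eq_sub_of_add_eq hg.symm
  -- With `h = a² - a`, `(1 - 2a)² = 1 + 4h`; when `g` commutes with `a` the idempotent defect is `h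
  -- - (1 + 4h)(g - g²)`, which vanishes as `g - g² = k` and `(1 + 4h) k = h`. The last summand
  -- collects the commutators.
  have h3 : (a + (1 - 2 * a) * g) * (a + (1 - 2 * a) * g) - (a + (1 - 2 * a) * g) =
      (a * a - a) - (1 + 4 * (a * a - a)) * (g - g * g) +
        ((1 - 2 * a) * (g * a - a * g) - 2 * (1 - 2 * a) * (g * a - a * g) * g) := by
    noncomm_ring
  rw [← sub_eq_zero, h3, hga, ← hgk, hkw]
  simp

/-- At `a = e` the element `a² - a` vanishes and `1 + 4(a² - a) = 1`, so by continuity `k` and its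
Catalan sum are small nearby. The inverse is quantified as any `w` so that a smooth inverse can be
used. -/
lemma eventually_almost_idem {e : X} (he : e * e = e) {U : Set X} (hU : U ∈ nhds e) :
    ∀ᶠ a in nhds e, IsUnit (1 + 4 * (a * a - a)) ∧ ∀ w, w * (1 + 4 * (a * a - a)) = 1 →
      (1 + 4 * (a * a - a)) * w = 1 →
      ‖(a * a - a) * w‖ ≤ 1 / 8 ∧ a + (1 - 2 * a) * catalanSum ((a * a - a) * w) ∈ U := by
  have h0 : Continuous fun a : X => 1 + 4 * (a * a - a) := by fun_prop
  have h1 : 1 + 4 * (e * e - e) = 1 := by rw [he, sub_self, mul_zero, add_zero]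
  have hunit : ∀ᶠ a in nhds e, IsUnit (1 + 4 * (a * a - a)) :=
    (Units.isOpen.preimage h0).mem_nhds (by
      change IsUnit (1 + 4 * (e * e - e))
      rw [h1]
      exact isUnit_one)
  have hF : Filter.Tendsto (fun a : X => (a * a - a) * Ring.inverse (1 + 4 * (a * a - a)))
      (nhds e) (nhds 0) := by
    have h2 : Filter.Tendsto (fun a : X => Ring.inverse (1 + 4 * (a * a - a))) (nhds e)
        (nhds (Ring.inverse 1)) := by
      have := (NormedRing.inverse_continuousAt (1 : Xˣ)).tendsto
      refine this.comp ?_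
      have := h0.tendsto e
      rwa [h1] at this
    have h3 : Filter.Tendsto (fun a : X => a * a - a) (nhds e) (nhds 0) := by
      have : Continuous fun a : X => a * a - a := by fun_prop
      simpa [he] using this.tendsto e
    simpa using h3.mul h2
  have hle : ∀ᶠ a : X in nhds e, ‖(a * a - a) * Ring.inverse (1 + 4 * (a * a - a))‖ ≤ 1 / 8 := by
    have := hF.norm
    rw [norm_zero] at this
    exact this.eventually_le_const (by norm_num)
  have hG : Filter.Tendsto (fun a : X => catalanSum
      ((a * a - a) * Ring.inverse (1 + 4 * (a * a - a)))) (nhds e) (nhds 0) := by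
    refine squeeze_zero_norm' (hle.mono fun a ha => norm_catalanSum_le ha) ?_
    simpa using hF.norm.const_mul 2
  have hE : Filter.Tendsto (fun a : X => a + (1 - 2 * a) * catalanSum
      ((a * a - a) * Ring.inverse (1 + 4 * (a * a - a)))) (nhds e) (nhds e) := by
    have h2 : Continuous fun a : X => 1 - 2 * a := by fun_prop
    simpa using (Filter.tendsto_id (x := nhds e)).add ((h2.tendsto e).mul hG)
  filter_upwards [hunit, hle, hE.eventually_mem hU] with a h4 h5 h6
  refine ⟨h4, fun w hw hw' => ?_⟩
  have : Ring.inverse (1 + 4 * (a * a - a)) = w :=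
    Ring.inverse_unit ⟨1 + 4 * (a * a - a), w, hw', hw⟩
  rw [this] at h5 h6
  exact ⟨h5, h6⟩

/-- The powers of `x` are dominated by the inverses of `1 - z x`, `|z| = 1`. -/
lemma norm_apply_pow_le {x : X} (hx : ‖x‖ < 1) (Λ : X →L[ℂ] ℂ) {C : ℝ}
    (h : ∀ z : ℂ, ‖z‖ = 1 → ‖Λ (Ring.inverse (1 - z • x))‖ ≤ C) (n : ℕ) : ‖Λ (x ^ n)‖ ≤ C := by
  have hp := Λ.comp_hasFPowerSeriesOnBall (spectrum.hasFPowerSeriesOnBall_inverse_one_sub_smul ℂ x)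
  have hball : Metric.closedBall (0 : ℂ) 1 ⊆ Metric.eball 0 (‖x‖₊⁻¹ : ℝ≥0∞) := fun z hz => by
    rw [Metric.mem_eball, edist_zero_right]
    have h1 : ‖z‖ₑ ≤ 1 := by
      rw [← enorm_one (G := ℂ), enorm_le_iff_norm_le, norm_one]
      simpa using hz
    exact h1.trans_lt (ENNReal.one_lt_inv.mpr (by exact_mod_cast hx))
  have hd : DiffContOnCl ℂ (Λ ∘ fun z : ℂ => Ring.inverse (1 - z • x)) (Metric.ball 0 1) :=
    hp.differentiableOn.diffContOnCl_ball hball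
  have h1 := Complex.norm_iteratedDeriv_le_of_forall_mem_sphere_norm_le n zero_lt_one hd
    (C := C) (fun z hz => h z (by simpa using hz))
  rw [iteratedDeriv_eq_iteratedFDeriv, ← hp.factorial_smul, one_pow, div_one, nsmul_eq_mul,
    norm_mul, Complex.norm_natCast] at h1
  have h2 := le_of_mul_le_mul_left h1 (by positivity)
  have h3 : (Λ.compFormalMultilinearSeries
      (fun n => ContinuousMultilinearMap.mkPiRing ℂ (Fin n) (x ^ n)) n) (fun _ => 1) =
        Λ (x ^ n) := by
    change Λ (ContinuousMultilinearMap.mkPiRing ℂ (Fin n) (x ^ n) fun _ => 1) = _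
    rw [ContinuousMultilinearMap.mkPiRing_apply, Finset.prod_const_one, one_smul]
  rwa [h3] at h2

/-- The factor `5` lies between the growth rate `4` of the Catalan numbers and the bound `8` for `1
/ ‖k‖`: `‖5k‖ ≤ 5/8 < 1` permits the Cauchy estimate for the powers of `5k`, while `catalan m /
5^(m+1) ≤ (1/5)(4/5)^m` sums to at most `1`. -/
lemma norm_apply_catalanSum_le (hk : ‖k‖ ≤ 1 / 8) (Λ : X →L[ℂ] ℂ) {C : ℝ}
    (h : ∀ z : ℂ, ‖z‖ = 1 → ‖Λ (Ring.inverse (1 - z • (5 : ℂ) • k))‖ ≤ C) :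
    ‖Λ (catalanSum k)‖ ≤ C := by
  obtain ⟨x, hx⟩ : ∃ x, x = (5 : ℂ) • k := ⟨_, rfl⟩
  rw [← hx] at h
  have hx1 : ‖x‖ < 1 := by
    rw [hx, norm_smul]
    norm_num
    linarith
  have hgeom : HasSum (fun m : ℕ => (C / 5) * (4 / 5 : ℝ) ^ m) C := by
    have h1 : C / 5 * (1 - 4 / 5)⁻¹ = C := by
      norm_num
    have h2 := (hasSum_geometric_of_lt_one (r := (4 / 5 : ℝ)) (by norm_num)
      (by norm_num)).mul_left (C / 5)
    rwa [h1] at h2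
  rw [catalanSum, Λ.map_tsum (summable_norm_catalan hk).of_norm]
  refine tsum_of_norm_bounded hgeom fun m => ?_
  have hkx : k = (5⁻¹ : ℂ) • x := by rw [hx, smul_smul]; norm_num
  rw [hkx, smul_pow, smul_smul, map_smul, norm_smul, norm_mul, Complex.norm_natCast, norm_pow]
  calc (catalan m : ℝ) * ‖(5⁻¹ : ℂ)‖ ^ (m + 1) * ‖Λ (x ^ (m + 1))‖
      ≤ 4 ^ m * ‖(5⁻¹ : ℂ)‖ ^ (m + 1) * C := by
        gcongr
        · exact catalan_le_four_pow m
        · exact norm_apply_pow_le hx1 Λ h (m + 1)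
    _ = _ := by
        rw [norm_inv, Complex.norm_ofNat, div_pow, inv_pow, pow_succ (5 : ℝ)]
        field_simp

end Catalan

/-! ### Smoothness of the Catalan series. -/

section SmoothCatalan

attribute [local instance] Matrix.linftyOpNormedRing Matrix.linftyOpNormedAlgebra

/-- The inverses of `1 - 5zk` over the unit circle are uniformly bounded by the geometric series,
hence uniformly smooth, and they dominate the Catalan series. -/
lemma smoothMod_catalanSum {n l : ℕ} {k : Matrix (Fin n) (Fin n) (Op ℕ)}
    (hk : ∀ p q, SmoothMod l fun _ : Unit => k p q) (hn : ‖k‖ ≤ 1 / 8) (p q : Fin n) :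
    SmoothMod l fun _ : Unit => catalanSum k p q := by
  have := completeSpace_matrix (X := Op ℕ) n
  obtain ⟨x, hx⟩ : ∃ x, x = (5 : ℂ) • k := ⟨_, rfl⟩
  have hx1 : ‖x‖ ≤ 5 / 8 := by
    rw [hx, norm_smul]
    norm_num
    linarith
  have hzx : ∀ z : {z : ℂ // ‖z‖ = 1}, ‖(z : ℂ) • x‖ < 1 := fun z => by
    rw [norm_smul, z.2]
    linarith
  have hinv : ∀ z : {z : ℂ // ‖z‖ = 1}, IsUnit (1 - (z : ℂ) • x) := fun z =>
    isUnit_one_sub_of_norm_lt_one (hzx z)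
  have hbound : ∀ z : {z : ℂ // ‖z‖ = 1}, ‖Ring.inverse (1 - (z : ℂ) • x)‖ ≤
      ‖(1 : Matrix (Fin n) (Fin n) (Op ℕ))‖ - 1 + (1 - 5 / 8)⁻¹ := fun z => by
    rw [NormedRing.inverse_one_sub _ (hzx z)]
    refine (tsum_geometric_le_of_norm_lt_one _ (hzx z)).trans ?_
    have : ‖(z : ℂ) • x‖ ≤ 5 / 8 := by rwa [norm_smul, z.2, one_mul]
    gcongr
  have hsm : SmoothMod l fun z : {z : ℂ // ‖z‖ = 1} => Ring.inverse (1 - (z : ℂ) • x) p q := by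
    refine SmoothMod.of_mul_eq_one (x := fun z : {z : ℂ // ‖z‖ = 1} => 1 - (z : ℂ) • x)
      (fun p q => ?_) ⟨‖(1 : Matrix (Fin n) (Fin n) (Op ℕ))‖ - 1 + (1 - 5 / 8)⁻¹, fun z p q => ?_⟩
      (fun z => Ring.mul_inverse_cancel _ (hinv z))
      (fun z => Ring.inverse_mul_cancel _ (hinv z)) p q
    · have e : (fun z : {z : ℂ // ‖z‖ = 1} => (1 - (z : ℂ) • x) p q) = fun z : {z : ℂ // ‖z‖ = 1} =>
          (if p = q then 1 else 0 : ℂ) • (1 : Op ℕ) + (-(z * 5) : ℂ) • k p q := funext fun z => by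
        rw [hx, Matrix.sub_apply, Matrix.one_apply, Matrix.smul_apply, Matrix.smul_apply, smul_smul,
          neg_smul, sub_eq_add_neg]
        split_ifs <;> simp
      rw [e]
      exact (SmoothMod.smul_one (z := fun _ => if p = q then 1 else 0) ⟨_, fun _ => le_rfl⟩ l).add
        (SmoothMod.smul ⟨5, fun z => by simp [z.2]⟩ ((hk p q).comp fun _ => ()))
    · refine le_trans ?_ (hbound z)
      exact norm_entry_le _ p q
  refine hsm.of_dominated ⟨1, fun Λ C hΛ _ => ?_⟩
  rw [one_mul]
  exact norm_apply_catalanSum_le hn (Λ ∘L entryCLM ℂ p q) fun z hz => hx ▸ hΛ ⟨z, hz⟩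

end SmoothCatalan

/-! ## The smooth algebra is inverse-closed and its idempotents are dense -/

variable {S : Supernatural}

lemma exists_common_modulus {ι : Type*} [Finite ι] {x : ι → Op ℕ}
    (hx : ∀ i, x i ∈ smoothAlg S) :
    ∃ l, Divides l S ∧ ∀ i, SmoothMod l fun _ : Unit => x i := by
  classical
  have := Fintype.ofFinite ι
  choose l hl hlx using fun i => (mem_smoothAlg_iff (x i)).mp (hx i)
  have key : ∀ s : Finset ι, ∃ m, Divides m S ∧ ∀ i ∈ s, l i ∣ m := fun s => by
    induction s using Finset.induction_on with
    | empty => exact ⟨1, divides_one S, by simp⟩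
    | insert i s _ ih =>
      obtain ⟨m, hm, h⟩ := ih
      refine ⟨(l i).lcm m, (hl i).lcm hm, fun j hj => ?_⟩
      rcases Finset.mem_insert.mp hj with rfl | hj
      · exact Nat.dvd_lcm_left _ _
      · exact (h j hj).trans (Nat.dvd_lcm_right _ _)
  obtain ⟨m, hm, h⟩ := key Finset.univ
  exact ⟨m, hm, fun i => (hlx i).of_dvd (h i (Finset.mem_univ i))⟩

lemma SmoothMod.of_mul_eq_one_op {I : Type*} {l : ℕ} {x y : I → Op ℕ} (hx : SmoothMod l x)
    (hy : ∃ C : ℝ, ∀ i, ‖y i‖ ≤ C) (hxy : ∀ i, x i * y i = 1) (hyx : ∀ i, y i * x i = 1) :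
    SmoothMod l y := by
  refine SmoothMod.of_mul_eq_one (n := 1) (x := fun i => Matrix.of fun _ _ => x i)
    (y := fun i => Matrix.of fun _ _ => y i) (fun _ _ => hx) (hy.imp fun C h i _ _ => h i)
    (fun i => ?_) (fun i => ?_) 0 0
  · ext1 p q
    rw [Matrix.mul_apply, Subsingleton.elim p q, Matrix.one_apply_eq]
    simpa using hxy i
  · ext1 p q
    rw [Matrix.mul_apply, Subsingleton.elim p q, Matrix.one_apply_eq]
    simpa using hyx i

lemma mem_smoothAlg_of_mul_eq_one {x y : Op ℕ} (hx : x ∈ smoothAlg S) (hxy : x * y = 1)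
    (hyx : y * x = 1) : y ∈ smoothAlg S := by
  obtain ⟨l, hl, hx⟩ := (mem_smoothAlg_iff x).mp hx
  exact (mem_smoothAlg_iff y).mpr ⟨l, hl, hx.of_mul_eq_one_op ⟨‖y‖, fun _ => le_rfl⟩
    (fun _ => hxy) fun _ => hyx⟩

/-- The matrices over the smooth algebra. -/
def smoothMatrix (S : Supernatural) (n : ℕ) : Subring (Matrix (Fin n) (Fin n) (Op ℕ)) :=
  (smoothAlg S).toSubalgebra.toSubring.matrix

lemma mem_smoothMatrix_of_mul_eq_one {n : ℕ} {x y : Matrix (Fin n) (Fin n) (Op ℕ)}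
    (hx : x ∈ smoothMatrix S n) (hxy : x * y = 1) (hyx : y * x = 1) : y ∈ smoothMatrix S n := by
  obtain ⟨l, hl, hlx⟩ := exists_common_modulus (x := fun r : Fin n × Fin n => x r.1 r.2)
    fun r => hx r.1 r.2
  obtain ⟨C, hC⟩ := (Set.finite_range fun r : Fin n × Fin n => ‖y r.1 r.2‖).bddAbove
  exact fun p q => (mem_smoothAlg_iff _).mpr ⟨l, hl, SmoothMod.of_mul_eq_one
    (fun p q => hlx (p, q)) ⟨C, fun _ p q => hC ⟨(p, q), rfl⟩⟩ (fun _ => hxy) (fun _ => hyx) p q⟩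

/-- The inclusion of the smooth algebra into the Bunce-Deddens-Toeplitz algebra. -/
abbrev smoothIncl (S : Supernatural) : smoothAlg S →+* BunceDeddensToeplitz S :=
  (StarSubalgebra.inclusion (smoothAlg_le S) : smoothAlg S →+* BunceDeddensToeplitz S)

lemma map_subtype_injective (A : StarSubalgebra ℂ (Op ℕ)) (n : ℕ) :
    Function.Injective fun x : Matrix (Fin n) (Fin n) A => x.map (A.subtype : A →+* Op ℕ) :=
  fun _ _ h => Matrix.ext fun p q => Subtype.ext (congrFun (congrFun h p) q)

/-- The inclusion of the Bunce-Deddens-Toeplitz algebra into the bounded operators. -/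
abbrev bdtSubtype (S : Supernatural) : BunceDeddensToeplitz S →+* Op ℕ :=
  ((BunceDeddensToeplitz S).subtype : BunceDeddensToeplitz S →+* Op ℕ)

/-- An inverse over `A_S` is also an inverse over the bounded operators, where its entries are shown
to be smooth with a common modulus. -/
lemma isUnit_of_map_smoothIncl (n : ℕ) (x : Matrix (Fin n) (Fin n) (smoothAlg S))
    (hx : IsUnit (x.map (smoothIncl S))) : IsUnit x := by
  obtain ⟨u, hu⟩ := hx
  have hx' : (u.val.map (bdtSubtype S)) =
      x.map ((smoothAlg S).subtype : smoothAlg S →+* Op ℕ) := by rw [hu]; rfl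
  have h1 : (RingHom.mapMatrix (bdtSubtype S)) u.val *
      (RingHom.mapMatrix (bdtSubtype S)) (u⁻¹).val = 1 := by
    rw [← map_mul, Units.mul_inv, map_one]
  have h2 : (RingHom.mapMatrix (bdtSubtype S)) (u⁻¹).val *
      (RingHom.mapMatrix (bdtSubtype S)) u.val = 1 := by
    rw [← map_mul, Units.inv_mul, map_one]
  simp only [RingHom.mapMatrix_apply, hx'] at h1 h2
  have hy := mem_smoothMatrix_of_mul_eq_one (S := S) (fun p q => (x p q).2) h1 h2
  refine ⟨⟨x, Matrix.of fun p q => ⟨_, hy p q⟩, ?_, ?_⟩, rfl⟩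
  · refine map_subtype_injective _ n ?_
    change (RingHom.mapMatrix ((smoothAlg S).subtype : smoothAlg S →+* Op ℕ)) _ =
      (RingHom.mapMatrix ((smoothAlg S).subtype : smoothAlg S →+* Op ℕ)) _
    rw [map_mul, map_one]
    exact h1
  · refine map_subtype_injective _ n ?_
    change (RingHom.mapMatrix ((smoothAlg S).subtype : smoothAlg S →+* Op ℕ)) _ =
      (RingHom.mapMatrix ((smoothAlg S).subtype : smoothAlg S →+* Op ℕ)) _
    rw [map_mul, map_one]
    exact h2

lemma denseRange_smoothIncl (S : Supernatural) : DenseRange (smoothIncl S) := by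
  intro x
  rw [closure_subtype]
  refine closure_mono ?_ (le_closure_smoothAlg S x.2)
  intro y hy
  exact ⟨smoothIncl S ⟨y, hy⟩, ⟨⟨y, hy⟩, rfl⟩, rfl⟩

/-! ### Smooth idempotents near a given idempotent. -/

section IdemApprox

attribute [local instance] Matrix.linftyOpNormedRing Matrix.linftyOpNormedAlgebra

lemma catalanSum_mem_smoothMatrix {n : ℕ} {k : Matrix (Fin n) (Fin n) (Op ℕ)}
    (hk : k ∈ smoothMatrix S n) (hn : ‖k‖ ≤ 1 / 8) : catalanSum k ∈ smoothMatrix S n := by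
  obtain ⟨l, hl, hlk⟩ := exists_common_modulus (x := fun r : Fin n × Fin n => k r.1 r.2)
    fun r => hk r.1 r.2
  exact fun p q => (mem_smoothAlg_iff _).mpr
    ⟨l, hl, smoothMod_catalanSum (fun p q => hlk (p, q)) hn p q⟩

/-- Near an idempotent matrix, every matrix over the smooth algebra has a smooth idempotent
nearby. -/
lemma eventually_exists_idem {n : ℕ} {e : Matrix (Fin n) (Fin n) (Op ℕ)} (he : e * e = e)
    {U : Set (Matrix (Fin n) (Fin n) (Op ℕ))} (hU : IsOpen U) (heU : e ∈ U) :
    ∃ V : Set (Matrix (Fin n) (Fin n) (Op ℕ)), IsOpen V ∧ e ∈ V ∧ ∀ a ∈ V, a ∈ smoothMatrix S n →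
      ∃ e' ∈ smoothMatrix S n, e' * e' = e' ∧ e' ∈ U := by
  have := completeSpace_matrix (X := Op ℕ) n
  obtain ⟨V, hV, hVo, heV⟩ := eventually_nhds_iff.mp (eventually_almost_idem he (hU.mem_nhds heU))
  refine ⟨V, hVo, heV, fun a haV ha => ?_⟩
  obtain ⟨⟨u, hu⟩, h⟩ := hV a haV
  have hw : (↑u⁻¹ : Matrix (Fin n) (Fin n) (Op ℕ)) * (1 + 4 * (a * a - a)) = 1 := by
    rw [← hu, Units.inv_mul]
  have hw' : (1 + 4 * (a * a - a)) * (↑u⁻¹ : Matrix (Fin n) (Fin n) (Op ℕ)) = 1 := by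
    rw [← hu, Units.mul_inv]
  obtain ⟨hk, hmem⟩ := h _ hw hw'
  have hh : a * a - a ∈ smoothMatrix S n := sub_mem (mul_mem ha ha) ha
  have hwS : (↑u⁻¹ : Matrix (Fin n) (Fin n) (Op ℕ)) ∈ smoothMatrix S n :=
    mem_smoothMatrix_of_mul_eq_one (add_mem (one_mem _) (mul_mem (ofNat_mem _ 4) hh)) hw' hw
  refine ⟨_, add_mem ha (mul_mem (sub_mem (one_mem _) (mul_mem (ofNat_mem _ 2) ha))
    (catalanSum_mem_smoothMatrix (mul_mem hh hwS) hk)), idem_of_almost_idem hw' hk hw, hmem⟩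

end IdemApprox

/-- The topology on matrices over `A_S` is induced from matrices of bounded operators, where a
smooth approximant is corrected to a smooth idempotent. -/
lemma idem_mem_closure (n : ℕ) (e : Matrix (Fin n) (Fin n) (BunceDeddensToeplitz S))
    (he : e * e = e) :
    e ∈ closure {x | ∃ e' : Matrix (Fin n) (Fin n) (smoothAlg S),
      e' * e' = e' ∧ e'.map (smoothIncl S) = x} := by
  obtain ⟨j, hj⟩ : ∃ j : Matrix (Fin n) (Fin n) (BunceDeddensToeplitz S) →
    Matrix (Fin n) (Fin n) (Op ℕ), j = fun x => x.map Subtype.val := ⟨_, rfl⟩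
  have hjc : Topology.IsInducing j := by
    rw [hj]
    exact Topology.IsInducing.piMap fun _ => Topology.IsInducing.piMap fun _ =>
      Topology.IsInducing.subtypeVal
  have hje : j e * j e = j e := by
    rw [hj]
    change (RingHom.mapMatrix (bdtSubtype S)) e *
      (RingHom.mapMatrix (bdtSubtype S)) e = _
    rw [← map_mul, he]
    rfl
  rw [mem_closure_iff]
  intro o ho heo
  obtain ⟨U, hU, rfl⟩ := hjc.isOpen_iff.mp ho
  obtain ⟨V, hV, heV, h⟩ := eventually_exists_idem (S := S) hje hU heo
  obtain ⟨a, ha⟩ := exists_map_mem (denseRange_smoothIncl S) (hV.preimage hjc.continuous) ⟨e, heV⟩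
  obtain ⟨e', he'S, he', he'U⟩ := h _ ha (by subst hj; exact fun p q => (a p q).2)
  refine ⟨_, ?_, Matrix.of fun p q => ⟨e' p q, he'S p q⟩, map_subtype_injective _ n ?_, rfl⟩
  · subst hj
    exact he'U
  · change (RingHom.mapMatrix ((smoothAlg S).subtype : smoothAlg S →+* Op ℕ)) _ =
      (RingHom.mapMatrix ((smoothAlg S).subtype : smoothAlg S →+* Op ℕ)) _
    rw [map_mul]
    exact he'

/-! ## The topology of the smooth algebra -/

lemma withSeminorms_lfTopology (S : Supernatural) (A : StarSubalgebra ℂ (Op ℕ)) :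
    @WithSeminorms ℂ A (LFSeminorm S A) _ _ _ (fun p => p.1) (lfTopology S A) := by
  let _ := lfTopology S A
  exact ⟨rfl⟩

/-- A matrix determines at most one operator, so the infimum in `matrixNorm` runs over operators
equal to `b`. -/
lemma enorm_le_normBD (b : Op ℤ) : ‖b‖ₑ ≤ normBD 0 b := by
  simp only [normBD, zero_add, Finset.sum_range_one, Nat.choose_self, Nat.cast_one, one_mul,
    pow_zero]
  exact le_iInf₂ fun x hx => by rw [op_ext hx]

lemma enorm_le_normCompact (c : Op ℕ) : ‖c‖ₑ ≤ normCompact 0 0 c := by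
  simp only [normCompact, zero_add, Finset.sum_range_one, Nat.choose_self, Nat.cast_one, one_mul,
    pow_zero, mul_one]
  exact le_iInf₂ fun x hx => by rw [op_ext hx]

/-- The operator norm is continuous for the LF topology. -/
def lfNorm (S : Supernatural) (A : StarSubalgebra ℂ (Op ℕ)) : LFSeminorm S A :=
  ⟨(normSeminorm ℂ (Op ℕ)).comp (A.toSubalgebra.val.toLinearMap : A →ₗ[ℂ] Op ℕ), fun l _ =>
    ⟨0, 0, 0, ‖toeplitzL‖₊ + 1, fun b _ c _ a ha => by
      change ENNReal.ofReal ‖(a : Op ℕ)‖ ≤ _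
      rw [ofReal_norm, ha]
      calc ‖toeplitz b + c‖ₑ ≤ ‖toeplitz b‖ₑ + ‖c‖ₑ := by exact enorm_add_le (toeplitz b) c
        _ ≤ ‖toeplitzL‖ₑ * ‖b‖ₑ + 1 * ‖c‖ₑ := by
          rw [one_mul]
          gcongr
          exact toeplitzL.le_opENorm b
        _ ≤ (‖toeplitzL‖ₑ + 1) * ‖b‖ₑ + (‖toeplitzL‖ₑ + 1) * ‖c‖ₑ := by
          gcongr
          · exact le_self_add
          · exact le_add_self
        _ = (‖toeplitzL‖ₑ + 1) * (‖b‖ₑ + ‖c‖ₑ) := (mul_add _ _ _).symm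
        _ ≤ _ := by
          gcongr
          · simp [enorm]
          · exact enorm_le_normBD b
          · exact enorm_le_normCompact c⟩⟩

lemma continuous_smoothIncl (S : Supernatural) :
    @Continuous _ _ (lfTopology S (smoothAlg S)) _ (smoothIncl S) := by
  let _ := lfTopology S (smoothAlg S)
  let f : smoothAlg S →ₗ[ℂ] BunceDeddensToeplitz S :=
    (StarSubalgebra.inclusion (smoothAlg_le S)).toAlgHom.toLinearMap
  exact WithSeminorms.continuous_normedSpace_rng _ (withSeminorms_lfTopology S _) f
    ⟨{lfNorm S (smoothAlg S)}, 1, by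
      rw [one_smul, Finset.sup_singleton]
      exact fun x => le_rfl⟩

/-! ## The holomorphic functional calculus -/

/-- The resolvents along the compact arc are bounded and uniformly smooth with the modulus of `a`; a
bounded weight `c` puts the integral in a multiple of their closed absolutely convex hull. -/
lemma intervalIntegral_mem_smoothAlg (a : BunceDeddensToeplitz S) (ha : (a : Op ℕ) ∈ smoothAlg S)
    {γ c : ℝ → ℂ} (hγ : ContinuousOn γ (Set.Icc 0 1)) (hc : ContinuousOn c (Set.Icc 0 1))
    (hγa : ∀ t ∈ Set.Icc (0 : ℝ) 1, γ t ∉ spectrum ℂ a) :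
    ((∫ t in (0 : ℝ)..1, c t • resolvent a (γ t) : BunceDeddensToeplitz S) : Op ℕ) ∈
      smoothAlg S := by
  have hcl : IsClosed (BunceDeddensToeplitz S : Set (Op ℕ)) :=
    StarSubalgebra.isClosed_topologicalClosure _
  have : CompleteSpace (BunceDeddensToeplitz S) := hcl.completeSpace_coe
  by_cases hint : IntervalIntegrable (fun t => c t • resolvent a (γ t)) MeasureTheory.volume 0 1
  swap
  -- The integral of a non-integrable function is `0` by convention, which is smooth.
  · rw [intervalIntegral.integral_undef hint]
    exact zero_mem (smoothAlg S)
  have hunit : ∀ t ∈ Set.Icc (0 : ℝ) 1, IsUnit (algebraMap ℂ (BunceDeddensToeplitz S) (γ t) - a) :=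
    fun t ht => not_not.mp (hγa t ht)
  have hcont : ContinuousOn (fun t => resolvent a (γ t)) (Set.Icc 0 1) := fun t ht =>
    (spectrum.hasDerivAt_resolvent_const_left (hunit t ht)).continuousAt.comp_continuousWithinAt
      (hγ t ht)
  obtain ⟨C, hC⟩ := isCompact_Icc.exists_bound_of_continuousOn hcont
  obtain ⟨D, hD⟩ := isCompact_Icc.exists_bound_of_continuousOn hc
  obtain ⟨G, hG⟩ := isCompact_Icc.exists_bound_of_continuousOn hγ
  obtain ⟨l, hl, hla⟩ := (mem_smoothAlg_iff _).mp ha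
  have hx : SmoothMod l fun t : Set.Icc (0 : ℝ) 1 => γ t • (1 : Op ℕ) + (-1 : ℂ) • (a : Op ℕ) :=
    (SmoothMod.smul_one (z := fun t : Set.Icc (0 : ℝ) 1 => γ t) ⟨G, fun t => hG t t.2⟩ l).add
      (SmoothMod.smul ⟨_, fun _ => le_rfl⟩ (hla.comp fun _ : Set.Icc (0 : ℝ) 1 => ()))
  have hxe : ∀ t, γ t • (1 : Op ℕ) + (-1 : ℂ) • (a : Op ℕ) =
      ((algebraMap ℂ (BunceDeddensToeplitz S) (γ t) - a : BunceDeddensToeplitz S) : Op ℕ) :=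
    fun t => by
      rw [Algebra.algebraMap_eq_smul_one, neg_one_smul, ← sub_eq_add_neg]
      rfl
  have hy : SmoothMod l fun t : Set.Icc (0 : ℝ) 1 =>
      ((resolvent a (γ t) : BunceDeddensToeplitz S) : Op ℕ) := by
    refine hx.of_mul_eq_one_op ⟨C, fun t => hC t t.2⟩ (fun t => ?_) fun t => ?_
    · rw [hxe]
      exact congrArg Subtype.val (Ring.mul_inverse_cancel _ (hunit t t.2))
    · rw [hxe]
      exact congrArg Subtype.val (Ring.inverse_mul_cancel _ (hunit t t.2))
  refine (mem_smoothAlg_iff _).mpr ⟨l, hl, hy.of_dominated ⟨D, fun Λ M hM _ => ?_⟩⟩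
  let Λ' : BunceDeddensToeplitz S →L[ℂ] ℂ :=
    Λ ∘L ⟨(BunceDeddensToeplitz S).toSubalgebra.val.toLinearMap, continuous_subtype_val⟩
  change ‖Λ' (∫ t in (0 : ℝ)..1, c t • resolvent a (γ t))‖ ≤ _
  rw [← ContinuousLinearMap.intervalIntegral_comp_comm Λ' hint]
  refine (intervalIntegral.norm_integral_le_of_norm_le_const (C := D * M) fun t ht => ?_).trans
    (by simp)
  have ht' : t ∈ Set.Icc (0 : ℝ) 1 := by
    rw [Set.uIoc_of_le zero_le_one] at ht
    exact ⟨ht.1.le, ht.2⟩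
  rw [map_smul, norm_smul]
  exact mul_le_mul (hD t ht') (hM ⟨t, ht'⟩) (norm_nonneg _) ((norm_nonneg _).trans (hD t ht'))

theorem holomorphicCalculus_mem_smoothAlg (a : BunceDeddensToeplitz S)
    (ha : (a : Op ℕ) ∈ smoothAlg S) {W : Set ℂ} {f : ℂ → ℂ}
    (hf : ContinuousOn f W) {Γ : Chain} (hΓ : Γ.support ⊆ W \ spectrum ℂ a) :
    ((holomorphicCalculus Γ f a : BunceDeddensToeplitz S) : Op ℕ) ∈ smoothAlg S := by
  have hmem : ∀ i, ∀ t ∈ Set.Icc (0 : ℝ) 1, Γ.arc i t ∈ W \ spectrum ℂ a := fun i t ht =>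
    hΓ (Set.mem_iUnion.mpr ⟨i, t, ht, rfl⟩)
  have h : ∀ i, ((∫ t in (0 : ℝ)..1, derivWithin (Γ.arc i) (Set.Icc 0 1) t •
      f (Γ.arc i t) • resolvent a (Γ.arc i t) : BunceDeddensToeplitz S) : Op ℕ) ∈
        smoothAlg S := fun i => by
    simp only [smul_smul]
    refine intervalIntegral_mem_smoothAlg a ha (Γ.contDiff i).continuousOn (ContinuousOn.mul
      ((Γ.contDiff i).continuousOn_derivWithin (uniqueDiffOn_Icc zero_lt_one) le_rfl)
      (hf.comp (Γ.contDiff i).continuousOn fun t ht => (hmem i t ht).1)) fun t ht => (hmem i t ht).2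
  rw [holomorphicCalculus, Chain.integral]
  have hs := (smoothAlg S).smul_mem (sum_mem fun i (_ : i ∈ Finset.univ) => h i)
    ((2 * Real.pi * Complex.I)⁻¹ : ℂ)
  simpa using hs

end QuantumOdometer
end

open QuantumOdometer in
theorem mainTheorem4 (S : Supernatural) (hS : S.IsInfinite) :
    ∃ (A : StarSubalgebra ℂ (Op ℕ)) (hA : A ≤ BunceDeddensToeplitz S),
      (A : Set (Op ℕ)) = smoothBDT S ∧
      (∀ (a : BunceDeddensToeplitz S), (a : Op ℕ) ∈ A →
        ∀ (W : Set ℂ), IsOpen W → spectrum ℂ a ⊆ W →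
        ∀ f : ℂ → ℂ, DifferentiableOn ℂ f W →
        ∀ Γ : Chain, Γ.Surrounds (spectrum ℂ a) W →
          ((holomorphicCalculus Γ f a : BunceDeddensToeplitz S) : Op ℕ) ∈ A) ∧
      (∀ a a' : BunceDeddensToeplitz S, (a : Op ℕ) ∈ A → a * a' = 1 → a' * a = 1 →
        (a' : Op ℕ) ∈ A) ∧
      (∃ φ : KZero A ≃+ KZero (BunceDeddensToeplitz S), ∀ e : IdemMatrix A,
        φ (KZero.mk e) =
          KZero.mk (e.map (StarSubalgebra.inclusion hA : A →+* BunceDeddensToeplitz S))) ∧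
      (∃ ψ : KOne A (lfTopology S A) ≃* KOne (BunceDeddensToeplitz S) inferInstance,
        ∀ (n : ℕ) (u : GLn A n),
          ψ (KOne.mk _ u) =
            KOne.mk _ (u.map (StarSubalgebra.inclusion hA : A →+* BunceDeddensToeplitz S))) := by
  refine ⟨smoothAlg S, smoothAlg_le S, rfl,
    fun a ha W _ _ f hf Γ hΓ => holomorphicCalculus_mem_smoothAlg a ha hf.continuousOn hΓ.2.1,
    fun a a' ha h h' => mem_smoothAlg_of_mul_eq_one ha (congrArg Subtype.val h)
      (congrArg Subtype.val h'), ?_, ?_⟩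
  · have : CompleteSpace (BunceDeddensToeplitz S) :=
      (StarSubalgebra.isClosed_topologicalClosure _).completeSpace_coe
    exact exists_kZero_equiv (denseRange_smoothIncl S) isUnit_of_map_smoothIncl idem_mem_closure
  · have : CompleteSpace (BunceDeddensToeplitz S) :=
      (StarSubalgebra.isClosed_topologicalClosure _).completeSpace_coe
    let _ := lfTopology S (smoothAlg S)
    have hw := withSeminorms_lfTopology S (smoothAlg S)
    have := hw.topologicalAddGroup
    have := hw.continuousSMul
    exact exists_kOne_equiv (denseRange_smoothIncl S) (continuous_smoothIncl S)
      (fun _ _ => rfl) isUnit_of_map_smoothIncl
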